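/- Let $k$ be a field. An $\mathbb N$-graded category is a small category $\mathcal C$ with a length function $l$ on morphisms such that $l(\mathrm{Id})=0$ and $l(f\circ g)=l(f)+l(g)$. It is \emph{indiscretely based} if each connected component of the subcategory $\mathcal C_0$ of morphisms of length $0$ is an indiscrete category (exactly one morphism between any two objects). The category algebra $k\mathcal C$ is the free $k$-module on the morphisms of $\mathcal C$, with product the composition, or $0$ if two morphisms are not composable; it is graded by length (and it need not be unital). A positively graded algebra $A=\bigoplus_{j\ge 0}A_j$ is \emph{Koszul} if $A_0$ is semisimple and the graded left $A$-module $A_0$ has a graded projective resolution $\cdots\to P^1\to P^0\to A_0\to 0$ with $P^i=A\,P^i_i$ for all $i$. A \emph{nontrivial factorization} of a morphism $p$ is a tuple $(f_0,\dots,f_{n+1})$, $n\ge 0$, of non-isomorphisms with $p=f_0\circ\dots\circ f_{n+1}$. Two of them are equivalent if they differ by isomorphisms at the $n+1$ interior objects. For $\mathcal C$ indiscretely based, the equivalence classes for $n\ge 0$ form a semi-simplicial set $\mathcal C(p)$, whose faces compose two adjacent morphisms. A semi-simplicial set $X$ is \emph{bouquet} if $\widetilde H^j(|X|,k)=0$ for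 all $j<\dim|X|$ (with $\dim\emptyset=-1$), and $\mathcal C$ is \emph{locally bouquet} if $\mathcal C(p)$ is bouquet for every morphism $p$ of $\mathcal C$. A functor $F:\mathcal C\to\mathcal D$ is an \emph{almost discrete fibration} if for every morphism $p$ of $\mathcal C$ each nontrivial factorization of $F(p)$ lifts to a nontrivial factorization of $p$, uniquely up to equivalence, where the image under $F$ of the lift has to agree with the given factorization up to equivalence. \textbf{Statement.} Let $\mathcal C$ and $\mathcal D$ be indiscretely based categories, and let $F:\mathcal C\to\mathcal D$ be a length-preserving functor that is an almost discrete fibration and such that every morphism of $\mathcal D$ is the image of a morphism of $\mathcal C$. (a) If every morphism of positive length of $\mathcal C$ is a composition of morphisms of length $1$, then the following are equivalent: (1) $k\mathcal C$ is Koszul; (2) $k\mathcal D$ is Koszul; (3) $\mathcal C$ is locally bouquet; (4) $\mathcal D$ is locally bouquet. (b) Without this assumption on $\mathcal C$: (1) is equivalent to (2); (3) is equivalent to (4); and (1) implies both (3) and that every morphism of positive length of $\mathcal C$ is a composition of morphisms of length $1$. (c) For every morphism $p$ of $\mathcal C$, the functor $F$ induces an isomorphism of semi-simplicial sets $\mathcal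 C(p)\cong\mathcal D(F(p))$. -/

import Mathlib

open CategoryTheory Opposite

universe u v w u' v'

section SemiSimplicial

/-- A semi-simplicial set: a contravariant functor on the category of the finite ordinals
`[n] = {0 < ... < n}` and their strictly increasing maps. -/
abbrev SemiSimplicialSet := SemiSimplexCategoryᵒᵖ ⥤ Type u

namespace SemiSimplicialSet

/-- The set of `n`-simplices. -/
abbrev simplices (X : SemiSimplicialSet.{u}) (n : ℕ) : Type u :=
  X.obj (op (SemiSimplexCategory.mk n))

/-- The face operator `∂ᵢ`, which omits the `i`-th vertex. -/
def face (X : SemiSimplicialSet.{u}) {n : ℕ} (i : Fin (n + 2)) :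
    X.simplices (n + 1) → X.simplices n :=
  fun x => (ConcreteCategory.hom
    (X.map (SemiSimplexCategory.homEquiv.symm (Fin.succAboveOrderEmb i) :
      SemiSimplexCategory.mk n ⟶ SemiSimplexCategory.mk (n + 1)).op)) x

/-- The dimension of (the geometric realization of) `X`: the supremum of all `n` such that there
is an `n`-simplex. It is `⊤` if there is no bound and `⊥` if `X` is empty. -/
noncomputable def dim (X : SemiSimplicialSet.{u}) : WithBot ℕ∞ :=
  ⨆ (n : ℕ) (_ : Nonempty (X.simplices n)), (n : WithBot ℕ∞)

/-- The cells of the augmented complex, in a degree shifted by one: index `0` is the one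
`(-1)`-dimensional (empty) cell, index `n + 1` stands for the `n`-simplices. -/
def augSimplices (X : SemiSimplicialSet.{u}) : ℕ → Type u
  | 0 => PUnit
  | n + 1 => X.simplices n

/-- The faces of the cells of the augmented complex. -/
def augFace (X : SemiSimplicialSet.{u}) :
    (m : ℕ) → Fin (m + 1) → X.augSimplices (m + 1) → X.augSimplices m
  | 0, _ => fun _ => PUnit.unit
  | _ + 1, i => X.face i

/-- The differential of the augmented cellular cochain complex of `X` with coefficients in `k`. -/
def coboundary (X : SemiSimplicialSet.{u}) (k : Type w) [CommRing k] (m : ℕ) :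
    (X.augSimplices m → k) →ₗ[k] (X.augSimplices (m + 1) → k) where
  toFun φ x := ∑ i : Fin (m + 1), (-1 : k) ^ (i : ℕ) * φ (X.augFace m i x)
  map_add' φ ψ := by
    funext x
    simp [mul_add, Finset.sum_add_distrib]
  map_smul' c φ := by
    funext x
    simp [Finset.mul_sum, mul_left_comm]

/-- The coboundaries of the augmented cochain complex. -/
def coboundaries (X : SemiSimplicialSet.{u}) (k : Type w) [CommRing k] :
    (m : ℕ) → Submodule k (X.augSimplices m → k)
  | 0 => ⊥
  | m + 1 => LinearMap.range (X.coboundary k m)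

/-- The reduced cohomology `H̃ʲ(|X|, k)` in degree `j = m - 1`, computed from the cell structure
of the geometric realization `|X|`, which has one `n`-cell for every `n`-simplex of `X`.
For empty `X` it is `k` in degree `-1` and zero otherwise. -/
abbrev ReducedCohomology (X : SemiSimplicialSet.{u}) (k : Type w) [CommRing k] (m : ℕ) :
    Type (max u w) :=
  LinearMap.ker (X.coboundary k m) ⧸
    (X.coboundaries k m).submoduleOf (LinearMap.ker (X.coboundary k m))

/-- `X` is bouquet (cohomologically): `H̃ʲ(|X|, k) = 0` for all `j < dim |X|`.
Here `j = m - 1`, so that `j < dim |X|` means `m ≤ dim |X|`. -/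
def IsBouquet (X : SemiSimplicialSet.{u}) (k : Type w) [CommRing k] : Prop :=
  ∀ m : ℕ, (m : WithBot ℕ∞) ≤ X.dim → Subsingleton (X.ReducedCohomology k m)

end SemiSimplicialSet

end SemiSimplicial

/-- An `ℕ`-grading of a category: a functor to `ℕ`, seen as a category with one object. -/
structure CategoryGrading (C : Type u) [Category.{v} C] where
  len : ∀ {X Y : C}, (X ⟶ Y) → ℕ
  len_id : ∀ X : C, len (𝟙 X) = 0
  len_comp : ∀ {X Y Z : C} (f : X ⟶ Y) (g : Y ⟶ Z), len (f ≫ g) = len f + len g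

namespace CategoryGrading

variable {C : Type u} [Category.{v} C]

/-- Each connected component of the subcategory `C₀` of the morphisms of length zero is
indiscrete: if `X` and `Y` are connected by a zigzag of morphisms of length zero, then there is
exactly one morphism of length zero from `X` to `Y`. -/
def IsIndiscretelyBased (l : CategoryGrading C) : Prop :=
  ∀ X Y : C, Relation.EqvGen (fun A B : C => ∃ f : A ⟶ B, l.len f = 0) X Y →
    ∃! f : X ⟶ Y, l.len f = 0

/-- The morphisms that are a composition of (one or more) morphisms of length one. -/
inductive IsCompOfLengthOne (l : CategoryGrading C) : ∀ {X Y : C}, (X ⟶ Y) → Prop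
  | of {X Y : C} (f : X ⟶ Y) (h : l.len f = 1) : IsCompOfLengthOne l f
  | comp {X Y Z : C} (f : X ⟶ Y) (g : Y ⟶ Z) :
      IsCompOfLengthOne l f → IsCompOfLengthOne l g → IsCompOfLengthOne l (f ≫ g)

/-- Every morphism of positive length is a composition of morphisms of length one. -/
def IsGeneratedInDegreeOne (l : CategoryGrading C) : Prop :=
  ∀ ⦃X Y : C⦄ (f : X ⟶ Y), 0 < l.len f → l.IsCompOfLengthOne f

theorem len_eq_zero_of_isIso (l : CategoryGrading C) {X Y : C} (f : X ⟶ Y) [IsIso f] :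
    l.len f = 0 := by
  have h := l.len_comp f (inv f)
  rw [IsIso.hom_inv_id, l.len_id] at h
  omega

theorem IsIndiscretelyBased.isIso {l : CategoryGrading C} (hl : l.IsIndiscretelyBased)
    {X Y : C} (f : X ⟶ Y) (hf : l.len f = 0) : IsIso f := by
  obtain ⟨g, hg, -⟩ := hl Y X (.symm _ _ (.rel _ _ ⟨f, hf⟩))
  have hX := (hl X X (.refl X)).unique (y₁ := f ≫ g) (y₂ := 𝟙 X)
    (by simp only [l.len_comp]; omega) (l.len_id X)
  have hY := (hl Y Y (.refl Y)).unique (y₁ := g ≫ f) (y₂ := 𝟙 Y)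
    (by simp only [l.len_comp]; omega) (l.len_id Y)
  exact ⟨g, hX, hY⟩

theorem IsIndiscretelyBased.not_isIso_comp {l : CategoryGrading C} (hl : l.IsIndiscretelyBased)
    {X Y Z : C} (f : X ⟶ Y) (g : Y ⟶ Z) (h : ¬ IsIso f ∨ ¬ IsIso g) : ¬ IsIso (f ≫ g) := by
  intro hfg
  have h0 := l.len_eq_zero_of_isIso (f ≫ g)
  rw [l.len_comp] at h0
  rcases h with h | h
  · exact h (hl.isIso f (by omega))
  · exact h (hl.isIso g (by omega))

end CategoryGrading

section Factorizations

variable {C : Type u} [Category.{v} C]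

/-- A nontrivial factorization of `p` into `n + 2` morphisms `X ⟶ Z₀ ⟶ ... ⟶ Zₙ ⟶ Y`, none of
which is an isomorphism. In the notation `p = f₀ ∘ ... ∘ fₙ₊₁` we have `first = fₙ₊₁` and
`last = f₀`, and the functor `mid` records `Z₀ ⟶ ... ⟶ Zₙ`. -/
structure NontrivialFactorization {X Y : C} (p : X ⟶ Y) (n : ℕ) where
  mid : Fin (n + 1) ⥤ C
  first : X ⟶ mid.obj 0
  last : mid.obj (Fin.last n) ⟶ Y
  fac : first ≫ mid.map (homOfLE (Fin.zero_le (Fin.last n))) ≫ last = p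
  first_not_isIso : ¬ IsIso first
  last_not_isIso : ¬ IsIso last
  mid_not_isIso : ∀ i : Fin n, ¬ IsIso (mid.map (homOfLE i.castSucc_lt_succ.le))

namespace NontrivialFactorization

variable {X Y : C} {p : X ⟶ Y}

/-- Two factorizations are equivalent if they differ by isomorphisms at the `n + 1` interior
objects. -/
def Equivalent {n : ℕ} (f g : NontrivialFactorization p n) : Prop :=
  ∃ e : f.mid ≅ g.mid,
    f.first ≫ e.hom.app 0 = g.first ∧ e.hom.app (Fin.last n) ≫ g.last = f.last

theorem equivalent_equivalence (p : X ⟶ Y) (n : ℕ) :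
    Equivalence (Equivalent (p := p) (n := n)) where
  refl f := ⟨Iso.refl _, by simp, by simp⟩
  symm := by
    rintro f g ⟨e, h₁, h₂⟩
    exact ⟨e.symm, by simp [← h₁], by simp [← h₂]⟩
  trans := by
    rintro f g h ⟨e, h₁, h₂⟩ ⟨e', h₁', h₂'⟩
    exact ⟨e.trans e', by simp [← h₁', ← h₁], by simp [← h₂', ← h₂]⟩

instance setoid (p : X ⟶ Y) (n : ℕ) : Setoid (NontrivialFactorization p n) :=
  ⟨Equivalent, equivalent_equivalence p n⟩

theorem mid_map_not_isIso {l : CategoryGrading C} (hl : l.IsIndiscretelyBased) {n : ℕ}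
    (f : NontrivialFactorization p n) {i j : Fin (n + 1)} (hij : i < j) :
    ¬ IsIso (f.mid.map (homOfLE hij.le)) := by
  have hn : (i : ℕ) < n := by have := j.isLt; have := Fin.lt_def.1 hij; omega
  let a : Fin n := ⟨i, hn⟩
  have h2 : a.succ ≤ j := by
    have := Fin.lt_def.1 hij
    rw [Fin.le_def]
    simp only [a, Fin.val_succ]
    omega
  have hcomp : f.mid.map (homOfLE hij.le) =
      f.mid.map (homOfLE a.castSucc_lt_succ.le) ≫ f.mid.map (homOfLE h2) := by
    rw [← f.mid.map_comp]
    rfl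
  rw [hcomp]
  exact hl.not_isIso_comp _ _ (Or.inl (f.mid_not_isIso a))

/-- The factorization obtained by keeping only those interior objects whose index is in the image
of `α`, and composing the morphisms in between. -/
def restrict {l : CategoryGrading C} (hl : l.IsIndiscretelyBased) {n m : ℕ}
    (α : Fin (m + 1) ↪o Fin (n + 1)) (f : NontrivialFactorization p n) :
    NontrivialFactorization p m where
  mid := α.monotone.functor ⋙ f.mid
  first := f.first ≫ f.mid.map (homOfLE (Fin.zero_le (α 0)))
  last := f.mid.map (homOfLE (Fin.le_last (α (Fin.last m)))) ≫ f.last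
  fac := by
    have h := f.fac
    rw [Functor.comp_map, Category.assoc, ← f.mid.map_comp_assoc, ← f.mid.map_comp_assoc]
    exact h
  first_not_isIso := hl.not_isIso_comp _ _ (Or.inl f.first_not_isIso)
  last_not_isIso := hl.not_isIso_comp _ _ (Or.inr f.last_not_isIso)
  mid_not_isIso i := f.mid_map_not_isIso hl (α.strictMono i.castSucc_lt_succ)

theorem restrict_equivalent {l : CategoryGrading C} (hl : l.IsIndiscretelyBased) {n m : ℕ}
    (α : Fin (m + 1) ↪o Fin (n + 1)) {f g : NontrivialFactorization p n}
    (h : f.Equivalent g) : (f.restrict hl α).Equivalent (g.restrict hl α) := by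
  obtain ⟨e, h₁, h₂⟩ := h
  exact ⟨Functor.isoWhiskerLeft _ e, by simp [restrict, ← h₁], by simp [restrict, ← h₂]⟩

theorem restrict_refl_equivalent {l : CategoryGrading C} (hl : l.IsIndiscretelyBased) {n : ℕ}
    (f : NontrivialFactorization p n) : (f.restrict hl (RelEmbedding.refl _)).Equivalent f := by
  have h : ∀ (i : Fin (n + 1)) (g : i ⟶ i), f.mid.map g = 𝟙 _ := fun i g => f.mid.map_id i
  refine ⟨Iso.refl f.mid, ?_, ?_⟩
  · change (f.first ≫ f.mid.map (homOfLE _)) ≫ 𝟙 (f.mid.obj 0) = f.first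
    rw [Category.comp_id]
    exact (congrArg _ (h 0 _)).trans (Category.comp_id _)
  · change 𝟙 (f.mid.obj (Fin.last n)) ≫ f.last = f.mid.map (homOfLE _) ≫ f.last
    rw [Category.id_comp]
    exact ((congrArg (· ≫ f.last) (h (Fin.last n) _)).trans (Category.id_comp _)).symm

theorem restrict_trans_equivalent {l : CategoryGrading C} (hl : l.IsIndiscretelyBased)
    {n m r : ℕ} (α : Fin (r + 1) ↪o Fin (m + 1)) (β : Fin (m + 1) ↪o Fin (n + 1))
    (f : NontrivialFactorization p n) :
    (f.restrict hl (α.trans β)).Equivalent ((f.restrict hl β).restrict hl α) := by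
  refine ⟨Iso.refl ((OrderEmbedding.monotone (α.trans β)).functor ⋙ f.mid), ?_, ?_⟩
  · change (f.first ≫ f.mid.map (homOfLE _)) ≫ 𝟙 (f.mid.obj (β (α 0))) =
      (f.first ≫ f.mid.map (homOfLE _)) ≫ f.mid.map (homOfLE _)
    rw [Category.comp_id, Category.assoc, ← f.mid.map_comp]
    rfl
  · change 𝟙 (f.mid.obj (β (α (Fin.last r)))) ≫ (f.mid.map (homOfLE _) ≫
      f.mid.map (homOfLE _) ≫ f.last) = f.mid.map (homOfLE _) ≫ f.last
    rw [Category.id_comp, ← f.mid.map_comp_assoc]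
    rfl

end NontrivialFactorization

/-- The semi-simplicial set `C(p)` of the nontrivial factorizations of `p` up to equivalence. The
`i`-th face omits the `i`-th interior object, that is, it composes the two adjacent morphisms. -/
def factorizationComplex {l : CategoryGrading C} (hl : l.IsIndiscretelyBased) {X Y : C}
    (p : X ⟶ Y) : SemiSimplicialSet.{max u v} where
  obj n := Quotient (NontrivialFactorization.setoid p n.unop.len)
  map α := TypeCat.ofHom (Quotient.map
    (NontrivialFactorization.restrict hl (SemiSimplexCategory.homEquiv α.unop))
    (fun _ _ h => NontrivialFactorization.restrict_equivalent hl _ h))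
  map_id n := by
    ext x
    induction x using Quotient.inductionOn with
    | h f => exact Quotient.sound (f.restrict_refl_equivalent hl)
  map_comp α β := by
    ext x
    induction x using Quotient.inductionOn with
    | h f =>
      have h := f.restrict_trans_equivalent hl (SemiSimplexCategory.homEquiv β.unop)
        (SemiSimplexCategory.homEquiv α.unop)
      rw [← SemiSimplexCategory.homEquiv_comp, ← unop_comp] at h
      exact Quotient.sound h

/-- The simplex of `C(p)` represented by a nontrivial factorization of `p`. -/
def NontrivialFactorization.toSimplex {l : CategoryGrading C} (hl : l.IsIndiscretelyBased)
    {X Y : C} {p : X ⟶ Y} {n : ℕ} (f : NontrivialFactorization p n) :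
    (factorizationComplex hl p).simplices n :=
  Quotient.mk (NontrivialFactorization.setoid p n) f

end Factorizations

section Fibrations

variable {C : Type u} [Category.{v} C] {D : Type u'} [Category.{v'} D]

/-- The factorization `g` of `F p` is the image under `F` of the factorization `f` of `p`, up to
isomorphisms at the interior objects. -/
def NontrivialFactorization.LiesOver (F : C ⥤ D) {X Y : C} {p : X ⟶ Y} {n : ℕ}
    (f : NontrivialFactorization p n) (g : NontrivialFactorization (F.map p) n) : Prop :=
  ∃ e : f.mid ⋙ F ≅ g.mid, F.map f.first ≫ e.hom.app 0 = g.first ∧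
    e.hom.app (Fin.last n) ≫ g.last = F.map f.last

/-- An almost discrete fibration: for every morphism `p`, every nontrivial factorization of `F p`
has a lift to a nontrivial factorization of `p`, unique up to equivalence of factorizations. -/
def CategoryTheory.Functor.IsAlmostDiscreteFibration (F : C ⥤ D) : Prop :=
  ∀ ⦃X Y : C⦄ (p : X ⟶ Y) (n : ℕ) (g : NontrivialFactorization (F.map p) n),
    (∃ f : NontrivialFactorization p n, f.LiesOver F g) ∧
    ∀ f f' : NontrivialFactorization p n, f.LiesOver F g → f'.LiesOver F g → f.Equivalent f'

/-- All factorization complexes `C(p)` are bouquet with coefficients in `k`. -/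
def CategoryGrading.IsLocallyBouquet {l : CategoryGrading C} (hl : l.IsIndiscretelyBased)
    (k : Type w) [CommRing k] : Prop :=
  ∀ ⦃X Y : C⦄ (p : X ⟶ Y), (factorizationComplex hl p).IsBouquet k

end Fibrations

section Koszul

theorem decompose_mul_zero {k : Type w} [CommRing k] {A : Type u} [NonUnitalRing A] [Module k A]
    (𝒜 : ℕ → Submodule k A) [SetLike.GradedMul 𝒜] [DirectSum.Decomposition 𝒜] (a b : A) :
    (DirectSum.decompose 𝒜 (a * b) 0 : A) =
      DirectSum.decompose 𝒜 a 0 * DirectSum.decompose 𝒜 b 0 := by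
  induction a using DirectSum.Decomposition.inductionOn 𝒜 with
  | zero => simp
  | add a a' h h' => simp [add_mul, h, h']
  | @homogeneous i a =>
    induction b using DirectSum.Decomposition.inductionOn 𝒜 with
    | zero => simp
    | add b b' h h' => simp [mul_add, h, h']
    | @homogeneous j b =>
      have hab := SetLike.GradedMul.mul_mem a.2 b.2
      by_cases hij : i + j = 0
      · obtain ⟨rfl, rfl⟩ : i = 0 ∧ j = 0 := by omega
        rw [DirectSum.decompose_of_mem_same 𝒜 hab, DirectSum.decompose_of_mem_same 𝒜 a.2,
          DirectSum.decompose_of_mem_same 𝒜 b.2]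
      · rw [DirectSum.decompose_of_mem_ne 𝒜 hab hij]
        by_cases hi : i = 0
        · rw [DirectSum.decompose_of_mem_ne 𝒜 b.2 (by omega), mul_zero]
        · rw [DirectSum.decompose_of_mem_ne 𝒜 a.2 hi, zero_mul]

variable (k : Type w) [CommRing k] {A : Type u} [NonUnitalRing A] [Module k A]
  [IsScalarTower k A A] [SMulCommClass k A A] (𝒜 : ℕ → Submodule k A)

/-- The degree zero part `A₀` of a graded `k`-algebra `A`. -/
def DegreeZero : Type u := 𝒜 0

namespace DegreeZero

instance : AddCommGroup (DegreeZero k 𝒜) := inferInstanceAs (AddCommGroup (𝒜 0))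

instance : Module k (DegreeZero k 𝒜) := inferInstanceAs (Module k (𝒜 0))

variable [SetLike.GradedMul 𝒜] [DirectSum.Decomposition 𝒜]

/-- The left action of `A` on `A₀ = A / A_{>0}`: an element acts as left multiplication by its
component of degree zero. -/
noncomputable def action : A →ₙₐ[k] Module.End k (DegreeZero k 𝒜) where
  toFun a :=
    { toFun := fun x => (⟨(DirectSum.decompose 𝒜 a 0 : A) * (x : 𝒜 0).1, by
        simpa using SetLike.GradedMul.mul_mem (DirectSum.decompose 𝒜 a 0).2 (x : 𝒜 0).2⟩ : 𝒜 0)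
      map_add' := fun x y => Subtype.ext (mul_add _ _ _)
      map_smul' := fun c x => Subtype.ext (mul_smul_comm c _ _) }
  map_smul' c a := by
    refine LinearMap.ext fun x => Subtype.ext ?_
    change (DirectSum.decompose 𝒜 (c • a) 0 : A) * (x : 𝒜 0).1 =
      c • ((DirectSum.decompose 𝒜 a 0 : A) * (x : 𝒜 0).1)
    rw [DirectSum.decompose_smul, DirectSum.smul_apply, Submodule.coe_smul, smul_mul_assoc]
  map_zero' := by
    refine LinearMap.ext fun x => Subtype.ext ?_
    change (DirectSum.decompose 𝒜 (0 : A) 0 : A) * (x : 𝒜 0).1 = 0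
    simp
  map_add' a b := by
    refine LinearMap.ext fun x => Subtype.ext ?_
    change (DirectSum.decompose 𝒜 (a + b) 0 : A) * (x : 𝒜 0).1 =
      (DirectSum.decompose 𝒜 a 0 : A) * (x : 𝒜 0).1 +
      (DirectSum.decompose 𝒜 b 0 : A) * (x : 𝒜 0).1
    simp [add_mul]
  map_mul' a b := by
    refine LinearMap.ext fun x => Subtype.ext ?_
    change (DirectSum.decompose 𝒜 (a * b) 0 : A) * (x : 𝒜 0).1 =
      (DirectSum.decompose 𝒜 a 0 : A) * ((DirectSum.decompose 𝒜 b 0 : A) * (x : 𝒜 0).1)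
    rw [decompose_mul_zero, mul_assoc]

noncomputable instance : Module (Unitization k A) (DegreeZero k 𝒜) :=
  Module.compHom _ (Unitization.lift (action k 𝒜)).toRingHom

end DegreeZero

variable [SetLike.GradedMul 𝒜] [DirectSum.Decomposition 𝒜]

/-- A graded projective resolution `... ⟶ P₂ ⟶ P₁ ⟶ P₀ ⟶ A₀` of the graded left `A`-module `A₀`
such that `Pᵢ = A (Pᵢ)ᵢ` for all `i`.

As `A` need not have a unit, left `A`-modules are written as modules over the unitization `k ⊕ A`.
The condition `Pᵢ = A (Pᵢ)ᵢ` implies `Pᵢ = A Pᵢ`, so that a unit of `A`, if there is one, acts as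
the identity on `Pᵢ`, and then being projective over `k ⊕ A` is the same as being projective over
the unital ring `A`. -/
structure LinearProjectiveResolution where
  P : ℕ → Type (max u w)
  [addCommGroup : ∀ i, AddCommGroup (P i)]
  [moduleBase : ∀ i, Module k (P i)]
  [module : ∀ i, Module (Unitization k A) (P i)]
  [isScalarTower : ∀ i, IsScalarTower k (Unitization k A) (P i)]
  piece : ∀ i, ℤ → Submodule k (P i)
  isInternal : ∀ i, DirectSum.IsInternal (piece i)
  smul_mem : ∀ (i m : ℕ) (n : ℤ) (a : A) (x : P i), a ∈ 𝒜 m → x ∈ piece i n →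
    (a : Unitization k A) • x ∈ piece i (m + n)
  projective : ∀ i, Module.Projective (Unitization k A) (P i)
  d : ∀ i, P (i + 1) →ₗ[Unitization k A] P i
  d_mem : ∀ (i : ℕ) (n : ℤ) (x : P (i + 1)), x ∈ piece (i + 1) n → d i x ∈ piece i n
  ε : P 0 →ₗ[Unitization k A] DegreeZero k 𝒜
  ε_eq_zero : ∀ (n : ℤ) (x : P 0), x ∈ piece 0 n → n ≠ 0 → ε x = 0
  ε_surjective : Function.Surjective ε
  exact_zero : Function.Exact (d 0) ε
  exact_succ : ∀ i, Function.Exact (d (i + 1)) (d i)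
  generated : ∀ (i : ℕ) (x : P i), x ∈ AddSubgroup.closure
    {z | ∃ (a : A) (y : P i), y ∈ piece i i ∧ z = (a : Unitization k A) • y}

/-- A (not necessarily unital) positively graded `k`-algebra `A` is Koszul if `A₀` is semisimple
and `A₀`, as a graded left `A`-module, has a graded projective resolution whose `i`-th term is
generated by its component of degree `i`. -/
def IsKoszul : Prop :=
  IsSemisimpleModule (Unitization k A) (DegreeZero k 𝒜) ∧
    Nonempty (LinearProjectiveResolution k 𝒜)

end Koszul

/-- The category algebra `kC`: the free `k`-module on the morphisms of `C`, with the product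
`α β = α ∘ β` if `α` and `β` are composable and `α β = 0` otherwise. -/
def CategoryAlgebra (k : Type w) (C : Type u) [CommRing k] [Category.{v} C] :
    Type (max u v w) :=
  Arrow C →₀ k

namespace CategoryAlgebra

variable (k : Type w) {C : Type u} [CommRing k] [Category.{v} C]

noncomputable instance : AddCommGroup (CategoryAlgebra k C) :=
  inferInstanceAs (AddCommGroup (Arrow C →₀ k))

noncomputable instance : Module k (CategoryAlgebra k C) :=
  inferInstanceAs (Module k (Arrow C →₀ k))

/-- The basis element given by a morphism. -/
noncomputable def basis (α : Arrow C) : CategoryAlgebra k C := Finsupp.single α 1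

open Classical in
/-- The product of two morphisms. -/
noncomputable def basisMul (α β : Arrow C) : CategoryAlgebra k C :=
  if h : β.right = α.left then basis k (Arrow.mk (β.hom ≫ eqToHom h ≫ α.hom)) else 0

variable {k} in
/-- The linear map with prescribed values on the morphisms. -/
noncomputable def lift {M : Type*} [AddCommMonoid M] [Module k M] (φ : Arrow C → M) :
    CategoryAlgebra k C →ₗ[k] M :=
  Finsupp.lift M k (Arrow C) φ

variable {k} in
theorem lift_basis {M : Type*} [AddCommMonoid M] [Module k M] (φ : Arrow C → M) (α : Arrow C) :
    lift φ (basis k α) = φ α :=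
  (Finsupp.sum_single_index (zero_smul k (φ α))).trans (one_smul k (φ α))

variable {k} in
theorem hom_ext {M : Type*} [AddCommMonoid M] [Module k M] {f g : CategoryAlgebra k C →ₗ[k] M}
    (h : ∀ α, f (basis k α) = g (basis k α)) : f = g :=
  Finsupp.lhom_ext' fun α => LinearMap.ext_ring (h α)

/-- The bilinear extension of the product of morphisms. -/
noncomputable def mulLinear :
    CategoryAlgebra k C →ₗ[k] CategoryAlgebra k C →ₗ[k] CategoryAlgebra k C :=
  lift fun α => lift fun β => basisMul k α β

theorem mulLinear_basis (α β : Arrow C) :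
    mulLinear k (basis k α) (basis k β) = basisMul k α β := by
  rw [mulLinear, lift_basis, lift_basis]

theorem basisMul_of_comp {X Y Z : C} (f : X ⟶ Y) (g : Y ⟶ Z) :
    basisMul k (Arrow.mk g) (Arrow.mk f) = basis k (Arrow.mk (f ≫ g)) := by
  have h : (Arrow.mk f).right = (Arrow.mk g).left := rfl
  rw [basisMul, dif_pos h]
  simp

theorem basisMul_of_ne {X Y Z W : C} (f : X ⟶ Y) (g : Z ⟶ W) (h : Y ≠ Z) :
    basisMul k (Arrow.mk g) (Arrow.mk f) = 0 :=
  dif_neg h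

theorem basisMul_assoc {a a' b b' c c' : C} (α : a ⟶ a') (β : b ⟶ b') (γ : c ⟶ c') :
    mulLinear k (basisMul k (Arrow.mk α) (Arrow.mk β)) (basis k (Arrow.mk γ)) =
      mulLinear k (basis k (Arrow.mk α)) (basisMul k (Arrow.mk β) (Arrow.mk γ)) := by
  by_cases h₁ : b' = a
  · subst h₁
    by_cases h₂ : c' = b
    · subst h₂
      rw [basisMul_of_comp, basisMul_of_comp, mulLinear_basis, mulLinear_basis,
        basisMul_of_comp, basisMul_of_comp, Category.assoc]
    · rw [basisMul_of_comp, mulLinear_basis, basisMul_of_ne k γ (β ≫ α) h₂,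
        basisMul_of_ne k γ β h₂, map_zero]
  · by_cases h₂ : c' = b
    · subst h₂
      rw [basisMul_of_comp, mulLinear_basis, basisMul_of_ne k (γ ≫ β) α h₁,
        basisMul_of_ne k β α h₁, map_zero, LinearMap.zero_apply]
    · rw [basisMul_of_ne k β α h₁, basisMul_of_ne k γ β h₂, map_zero, map_zero,
        LinearMap.zero_apply]

theorem mulLinear_assoc (a b c : CategoryAlgebra k C) :
    mulLinear k (mulLinear k a b) c = mulLinear k a (mulLinear k b c) := by
  have hspan : ∀ x : CategoryAlgebra k C, x ∈ Submodule.span k (Set.range (basis k)) := by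
    intro x
    refine Finsupp.induction_linear x (Submodule.zero_mem _)
      (fun f g hf hg => Submodule.add_mem _ hf hg) fun α r => ?_
    have h : (Finsupp.single α r : CategoryAlgebra k C) = r • basis k α :=
      ((Finsupp.smul_single r α (1 : k)).trans (congrArg _ (mul_one r))).symm
    rw [h]
    exact Submodule.smul_mem _ r (Submodule.subset_span ⟨α, rfl⟩)
  induction hspan a using Submodule.span_induction with
  | zero => simp
  | add x y _ _ hx hy => simp [hx, hy]
  | smul r x _ hx => simp [hx]
  | mem x hx =>
    obtain ⟨α, rfl⟩ := hx
    induction hspan b using Submodule.span_induction with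
    | zero => simp
    | add x y _ _ hx hy => simp [hx, hy]
    | smul r x _ hx => simp [hx]
    | mem x hx =>
      obtain ⟨β, rfl⟩ := hx
      induction hspan c using Submodule.span_induction with
      | zero => simp
      | add x y _ _ hx hy => simp [hx, hy]
      | smul r x _ hx => simp [hx]
      | mem x hx =>
        obtain ⟨γ, rfl⟩ := hx
        rw [mulLinear_basis, mulLinear_basis]
        exact basisMul_assoc k α.hom β.hom γ.hom

noncomputable instance : NonUnitalRing (CategoryAlgebra k C) where
  mul a b := mulLinear k a b
  left_distrib a b c := map_add _ b c
  right_distrib a b c := by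
    change mulLinear k (a + b) c = _
    rw [map_add]
    rfl
  zero_mul a := by
    change mulLinear k 0 a = 0
    rw [map_zero]
    rfl
  mul_zero a := map_zero (mulLinear k a)
  mul_assoc a b c := mulLinear_assoc k a b c

theorem basis_mul_basis (α β : Arrow C) : basis k α * basis k β = basisMul k α β :=
  mulLinear_basis k α β

instance : IsScalarTower k (CategoryAlgebra k C) (CategoryAlgebra k C) where
  smul_assoc r a b := by
    change mulLinear k (r • a) b = r • mulLinear k a b
    rw [map_smul]
    rfl

instance : SMulCommClass k (CategoryAlgebra k C) (CategoryAlgebra k C) where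
  smul_comm r a b := (map_smul (mulLinear k a) r b).symm

/-- The component of degree `n` of `kC`: the span of the morphisms of length `n`. -/
noncomputable def gradedPiece (l : CategoryGrading C) (n : ℕ) : Submodule k (CategoryAlgebra k C) :=
  Submodule.span k {x | ∃ α : Arrow C, l.len α.hom = n ∧ x = basis k α}

theorem basis_mem (l : CategoryGrading C) (α : Arrow C) :
    basis k α ∈ gradedPiece k l (l.len α.hom) :=
  Submodule.subset_span ⟨α, rfl, rfl⟩

theorem basisMul_mem (l : CategoryGrading C) {a a' b b' : C} (α : a ⟶ a') (β : b ⟶ b') :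
    basisMul k (Arrow.mk α) (Arrow.mk β) ∈ gradedPiece k l (l.len α + l.len β) := by
  by_cases h : b' = a
  · subst h
    rw [basisMul_of_comp, add_comm, ← l.len_comp]
    exact basis_mem k l (Arrow.mk (β ≫ α))
  · rw [basisMul_of_ne k β α h]
    exact Submodule.zero_mem _

instance (l : CategoryGrading C) : SetLike.GradedMul (gradedPiece k l) where
  mul_mem i j a b ha hb := by
    change mulLinear k a b ∈ _
    induction ha using Submodule.span_induction with
    | zero => simp
    | add x y _ _ hx hy => simpa using Submodule.add_mem _ hx hy
    | smul r x _ hx => simpa using Submodule.smul_mem _ r hx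
    | mem x hx =>
      obtain ⟨α, rfl, rfl⟩ := hx
      induction hb using Submodule.span_induction with
      | zero => simp
      | add x y _ _ hx hy => simpa using Submodule.add_mem _ hx hy
      | smul r x _ hx => simpa using Submodule.smul_mem _ r hx
      | mem x hx =>
        obtain ⟨β, rfl, rfl⟩ := hx
        rw [mulLinear_basis]
        exact basisMul_mem k l α.hom β.hom

/-- The decomposition of an element of `kC` into its homogeneous components. -/
noncomputable def decomposeLinear (l : CategoryGrading C) :
    CategoryAlgebra k C →ₗ[k] DirectSum ℕ fun n => gradedPiece k l n :=
  lift fun α =>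
    DirectSum.lof k ℕ (fun n => gradedPiece k l n) (l.len α.hom) ⟨basis k α, basis_mem k l α⟩

theorem decomposeLinear_of_mem (l : CategoryGrading C) (n : ℕ) (x : CategoryAlgebra k C)
    (hx : x ∈ gradedPiece k l n) :
    decomposeLinear k l x = DirectSum.lof k ℕ (fun n => gradedPiece k l n) n ⟨x, hx⟩ := by
  induction hx using Submodule.span_induction with
  | zero => exact (map_zero _).trans (map_zero _).symm
  | add x y hx hy hx' hy' =>
    rw [map_add, hx', hy', ← map_add]
    rfl
  | smul r x hx hx' =>
    rw [map_smul, hx', ← map_smul]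
    rfl
  | mem x hx =>
    obtain ⟨α, rfl, rfl⟩ := hx
    rw [decomposeLinear, lift_basis]

noncomputable instance (l : CategoryGrading C) :
    DirectSum.Decomposition (gradedPiece k l) :=
  DirectSum.Decomposition.ofLinearMap _ (decomposeLinear k l)
    (hom_ext fun α => by
      rw [LinearMap.comp_apply, decomposeLinear, lift_basis, DirectSum.coeLinearMap_lof]
      rfl)
    (DirectSum.linearMap_ext _ fun n => LinearMap.ext fun x => by
      rw [LinearMap.comp_apply, LinearMap.comp_apply, DirectSum.coeLinearMap_lof,
        decomposeLinear_of_mem k l n x.1 x.2]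
      rfl)

end CategoryAlgebra

/-- The category algebra `kC`, graded by the length of morphisms, is Koszul. -/
def CategoryGrading.IsKoszul {C : Type u} [Category.{v} C] (l : CategoryGrading C)
    (k : Type w) [CommRing k] : Prop :=
  _root_.IsKoszul k (CategoryAlgebra.gradedPiece k l)

/-! ### Chains of positive degree and the relative bar complex. -/

section RelativeCochains

/-! The pivot is `HasDiagonalCohomology`: for every `p` of positive length, the reduced cohomology
of `C(p)` lives only in degree `l(p) - 2`. Koszulness is equivalent to it for every indiscretely
based category, and it involves nothing but the complexes `C(p)`. Existence and uniqueness of lifts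
say that `F` induces bijections from the simplices of `C(p)` to those of `D(F p)`, compatible with
faces. As every morphism of `D` is some `F p`, both the diagonal condition and the bouquet condition
hold for `C` if and only if they hold for `D`.

Koszulness becomes a condition on the complexes `C(p)` as follows. An equivalence of categories is
an almost discrete fibration, so `C` may be replaced by its skeleton, where the morphisms of length
zero are identities. A graded module gives a functor on pairs (object, degree), and its relative bar
cochains ending at `y` compute Ext into the simple functor at `y`; `Vanishes n y` is the vanishing
of the `n`-th Ext. On `A₀` all morphisms of positive length act by zero, so its bar complex splits
into complexes of functions on the chains from `x` to `y`. These split further, by the composite `p`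
of a chain, into the augmented cochain complexes of the `C(p)`, where chains of `m + 1` morphisms
are the `(m - 1)`-simplices (`chainExact_iff`). Thus diagonal cohomology means that the `j`-th Ext
from `A₀` to the simple functor at `y` vanishes unless `y` has degree `j`.

If `A₀` has a linear resolution, this vanishing follows by dimension shifting
(`vanishes_of_resolution`): projectivity contracts the bar complex in positive degrees
(`InducedSection.vanishes`), and a module generated in degree `i` has no Ext in cohomological degree
zero at objects of other degrees. Conversely, a module with diagonal Ext starting in degree `i` is
covered by a projective one generated in degree `i`, and the kernel has the same property for `i +
1` (`IsLinear.kernel`); iterating gives the linear resolution. `A₀` is semisimple because the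
submodules generated by the identities are simple.

For bouquets, an `n`-simplex of `C(p)` consists of `n + 2` morphisms of positive length, so `dim
C(p) ≤ l(p) - 2`, and diagonal cohomology implies bouquet. It also makes `C(p)` nonempty when `l(p)
≥ 2`, so that `p` factors and, by induction, `C` is generated in degree one. If conversely `C` is
generated in degree one, then `dim C(p) = l(p) - 2` for `l(p) ≥ 2`, and bouquet implies diagonal. -/

/-- A category whose objects carry a degree that is raised by every morphism except identities. -/
class DegreeCategory (E : Type u) [Category.{v} E] where
  deg : E → ℤ
  deg_le : ∀ {x y : E}, (x ⟶ y) → deg x ≤ deg y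
  eq_of_deg_eq : ∀ {x y : E} (f : x ⟶ y), deg x = deg y → ∃ h : x = y, f = eqToHom h

open DegreeCategory

/-- Chains of `n` composable morphisms of positive degree. -/
inductive DegreeChain {E : Type u} [Category.{v} E] [DegreeCategory E] :
    ℕ → E → E → Type (max u v)
  | nil (x : E) : DegreeChain 0 x x
  | cons {n : ℕ} {x z y : E} (f : x ⟶ z) (h : deg x < deg z) (c : DegreeChain n z y) :
      DegreeChain (n + 1) x y

namespace DegreeChain

variable {E : Type u} [Category.{v} E] [DegreeCategory E]

theorem lt_comp {x z t : E} (h : deg x < deg z) (g : z ⟶ t) : deg x < deg t :=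
  h.trans_le (deg_le g)

section MergeSum

variable {V : Type*} [AddCommGroup V]

/-- The alternating sum over all ways to compose two adjacent morphisms of a chain. -/
def mergeSum : ∀ {n : ℕ} {x y : E}, (DegreeChain n x y → V) → DegreeChain (n + 1) x y → V
  -- A single morphism has nothing to be composed with. This value also makes the coboundaries in
  -- `ChainExact k 1` trivial, as they have to be at the empty cell of the augmented complex.
  | 0, _, _, _, _ => 0
  | _ + 1, _, _, φ, .cons f hf (.cons g hg c) =>
      φ (.cons (f ≫ g) (lt_comp hf g) c) - mergeSum (fun c' => φ (.cons f hf c')) (.cons g hg c)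

theorem mergeSum_map {W : Type*} [AddCommGroup W] (L : V →+ W) : ∀ {n : ℕ} {x y : E}
    (φ : DegreeChain n x y → V) (c : DegreeChain (n + 1) x y),
    mergeSum (fun c' => L (φ c')) c = L (mergeSum φ c)
  | 0, _, _, _, _ => by simp [mergeSum]
  | _ + 1, _, _, φ, .cons f hf (.cons g hg c) => by
      simp only [mergeSum, map_sub]
      rw [mergeSum_map L (fun c' => φ (.cons f hf c'))]

theorem mergeSum_sub : ∀ {n : ℕ} {x y : E}
    (φ ψ : DegreeChain n x y → V) (c : DegreeChain (n + 1) x y),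
    mergeSum (fun c' => φ c' - ψ c') c = mergeSum φ c - mergeSum ψ c
  | 0, _, _, _, _, _ => by simp [mergeSum]
  | _ + 1, _, _, φ, ψ, .cons f hf (.cons g hg c) => by
      simp only [mergeSum]
      rw [mergeSum_sub (fun c' => φ (.cons f hf c'))]
      abel

/-- Induction on the first morphism `f`. The merges that involve `f` are split off by `aux`; the
others vanish by the induction hypothesis, and what remains is, by associativity, the merge sum of
the chain that starts with `f ≫ g`. -/
theorem mergeSum_mergeSum : ∀ {n : ℕ} {x y : E}
    (φ : DegreeChain n x y → V) (c : DegreeChain (n + 2) x y),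
    mergeSum (mergeSum φ) c = 0
  | 0, _, _, φ, .cons f hf (.cons g hg c) => by simp [mergeSum]
  | n + 1, x, y, φ, .cons f hf (.cons g hg (.cons h hh c)) => by
      have key : mergeSum (fun c' => mergeSum φ (.cons f hf c')) (.cons g hg (.cons h hh c)) =
          mergeSum φ (.cons (f ≫ g) (lt_comp hf g) (.cons h hh c)) := by
        have ih := mergeSum_mergeSum (fun c' => φ (.cons f hf c')) (.cons g hg (.cons h hh c))
        have aux : ∀ c' : DegreeChain (n + 1) _ y, mergeSum φ (.cons f hf c') =
            (match c' with | .cons g hg c => φ (.cons (f ≫ g) (lt_comp hf g) c)) -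
            mergeSum (fun c' => φ (.cons f hf c')) c' := by
          rintro (_ | ⟨g, hg, c⟩)
          simp [mergeSum]
        rw [funext aux, mergeSum_sub, ih, sub_zero]
        simp [mergeSum]
      rw [mergeSum, key, sub_self]

end MergeSum

end DegreeChain

/-- A representation: a functor to vector spaces. -/
structure CatRep (k : Type w) [Field k] (E : Type u) [Category.{v} E] where
  obj : E → Type u'
  [acg : ∀ x, AddCommGroup (obj x)]
  [mod : ∀ x, Module k (obj x)]
  map : ∀ {x y : E}, (x ⟶ y) → obj x →ₗ[k] obj y
  map_id : ∀ (x : E), map (𝟙 x) = LinearMap.id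
  map_comp : ∀ {x y z : E} (f : x ⟶ y) (g : y ⟶ z), map (f ≫ g) = map g ∘ₗ map f

attribute [instance] CatRep.acg CatRep.mod

namespace CatRep

open DegreeChain

variable {k : Type w} [Field k] {E : Type u} [Category.{v} E]

theorem map_comp_apply (M : CatRep.{u, v, w, u'} k E) {x y z : E} (f : x ⟶ y) (g : y ⟶ z)
    (m : M.obj x) : M.map (f ≫ g) m = M.map g (M.map f m) := by
  rw [M.map_comp]; rfl

/-- Natural transformations. -/
structure Hom (M : CatRep.{u, v, w, u'} k E) (N : CatRep.{u, v, w, v'} k E) where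
  app : ∀ x, M.obj x →ₗ[k] N.obj x
  naturality : ∀ {x y : E} (f : x ⟶ y) (m : M.obj x), app y (M.map f m) = N.map f (app x m)

variable [DegreeCategory E]

/-- Cochains of the relative bar complex of `M`, ending at `y`. -/
abbrev Cochain (M : CatRep.{u, v, w, u'} k E) (n : ℕ) (y : E) :=
  ∀ x, DegreeChain n x y → Module.Dual k (M.obj x)

/-- The differential of the relative bar complex. -/
def d (M : CatRep.{u, v, w, u'} k E) {n : ℕ} {y : E} (φ : M.Cochain n y) : M.Cochain (n + 1) y
  -- The first face acts through `M.map`. There is no term that drops the last morphism, since it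
  -- acts by zero on the simple functor at `y`.
  | x, .cons f hf c => (φ _ c).comp (M.map f) - mergeSum (φ x) (.cons f hf c)

theorem d_cons (M : CatRep.{u, v, w, u'} k E) {n : ℕ} {x y z : E} (φ : M.Cochain n y)
    (f : x ⟶ z) (hf : deg x < deg z) (c : DegreeChain n z y) (m : M.obj x) :
    M.d φ x (.cons f hf c) m =
      φ z c (M.map f m) - mergeSum (fun c' => φ x c' m) (.cons f hf c) := by
  have := mergeSum_map (LinearMap.applyₗ (R := k) (M₂ := k) m).toAddMonoidHom (φ x) (.cons f hf c)
  simp only [LinearMap.toAddMonoidHom_coe, LinearMap.applyₗ_apply_apply] at this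
  rw [this]
  rfl

theorem d_sub (M : CatRep.{u, v, w, u'} k E) {n : ℕ} {y : E} (φ ψ : M.Cochain n y) :
    M.d (φ - ψ) = M.d φ - M.d ψ := by
  funext x c
  cases c with
  | cons f hf c =>
    ext m
    simp only [Pi.sub_apply, LinearMap.sub_apply, d_cons, mergeSum_sub]
    abel

/-- Functoriality of `M` cancels the two terms in which `M` is applied to `f` and `g`, the mixed
terms cancel each other, and the pure merges cancel by `mergeSum_mergeSum`. -/
theorem d_d (M : CatRep.{u, v, w, u'} k E) {n : ℕ} {y : E} (φ : M.Cochain n y) :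
    M.d (M.d φ) = 0 := by
  funext x c
  match c with
  | .cons f hf (.cons g hg c) =>
    ext m
    have h1 : mergeSum (fun c' => M.d φ x c' m) (.cons f hf (.cons g hg c)) =
        M.d φ x (.cons (f ≫ g) (lt_comp hf g) c) m -
        mergeSum (fun c' => M.d φ x (.cons f hf c') m) (.cons g hg c) := rfl
    have h2 := mergeSum_mergeSum (fun c' => φ x c' m) (.cons f hf (.cons g hg c))
    rw [mergeSum, sub_eq_zero] at h2
    rw [d_cons, h1]
    simp only [d_cons, mergeSum_sub, map_comp_apply, ← h2, Pi.zero_apply, LinearMap.zero_apply]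
    abel

/-- Vanishing of the cohomology of the relative bar complex. -/
def Vanishes (M : CatRep.{u, v, w, u'} k E) : ℕ → E → Prop
  | 0, y => ∀ φ : M.Cochain 0 y, M.d φ = 0 → φ = 0
  | n + 1, y => ∀ φ : M.Cochain (n + 1) y, M.d φ = 0 → ∃ ψ : M.Cochain n y, M.d ψ = φ

namespace Hom

variable {M : CatRep.{u, v, w, u'} k E} {N : CatRep.{u, v, w, v'} k E}

/-- Pull back cochains. -/
def pull (α : Hom M N) {n : ℕ} {y : E} (φ : N.Cochain n y) : M.Cochain n y :=
  fun x c => (φ x c).comp (α.app x)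

theorem d_pull (α : Hom M N) {n : ℕ} {y : E} (φ : N.Cochain n y) :
    M.d (α.pull φ) = α.pull (N.d φ) := by
  funext x c
  cases c with
  | cons f hf c =>
    ext m
    simp [pull, d_cons, α.naturality]

theorem pull_injective (α : Hom M N) (hα : ∀ x, Function.Surjective (α.app x)) {n : ℕ} {y : E}
    {φ ψ : N.Cochain n y} (h : α.pull φ = α.pull ψ) : φ = ψ := by
  funext x c
  ext m
  obtain ⟨m, rfl⟩ := hα x m
  exact LinearMap.congr_fun (congrFun (congrFun h x) c) m

/-- Over a field the injections `α.app x` have left inverses. These need not be natural, because a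
cochain is an arbitrary family of functionals. -/
theorem pull_surjective (α : Hom M N) (hα : ∀ x, Function.Injective (α.app x)) {n : ℕ} {y : E}
    (φ : M.Cochain n y) : ∃ ψ : N.Cochain n y, α.pull ψ = φ := by
  choose r hr using fun x => LinearMap.exists_leftInverse_of_injective (α.app x)
    (LinearMap.ker_eq_bot.2 (hα x))
  refine ⟨fun x c => (φ x c).comp (r x), ?_⟩
  funext x c
  change ((φ x c).comp (r x)).comp (α.app x) = _
  rw [LinearMap.comp_assoc, hr, LinearMap.comp_id]

end Hom

end CatRep

end RelativeCochains

/-! ### Long exact sequences, projective representations, trivial representations. -/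

section RelativeCochains
open DegreeCategory
namespace CatRep

open DegreeChain

variable {k : Type w} [Field k] {E : Type u} [Category.{v} E] [DegreeCategory E]

section Shift

universe u₁ u₂ u₃

variable {M' : CatRep.{u, v, w, u₁} k E} {P : CatRep.{u, v, w, u₂} k E}
  {M : CatRep.{u, v, w, u₃} k E} (α : Hom M' P) (β : Hom P M)

/-- Pointwise linear sections of `β` descend a cochain that vanishes on the image of `α`; the choice
does not matter since two lifts differ by an element of that image. -/
theorem Hom.exists_pull_eq (hβ : ∀ x, Function.Surjective (β.app x))
    (hαβ : ∀ x, Function.Exact (α.app x) (β.app x)) {n : ℕ} {y : E} (φ : P.Cochain n y)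
    (h : α.pull φ = 0) : ∃ χ : M.Cochain n y, β.pull χ = φ := by
  choose s hs using fun x => LinearMap.exists_rightInverse_of_surjective (β.app x)
    (LinearMap.range_eq_top.2 (hβ x))
  refine ⟨fun x c => (φ x c).comp (s x), ?_⟩
  funext x c
  ext m
  have h1 : β.app x (s x (β.app x m) - m) = 0 := by
    rw [map_sub, sub_eq_zero]
    exact LinearMap.congr_fun (hs x) _
  obtain ⟨m', hm'⟩ := (hαβ x _).1 h1
  have h2 : φ x c (α.app x m') = 0 := LinearMap.congr_fun (congrFun (congrFun h x) c) m'
  rw [hm', map_sub, sub_eq_zero] at h2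
  exact h2

theorem Hom.pull_pull_eq_zero (hαβ : ∀ x, Function.Exact (α.app x) (β.app x)) {n : ℕ} {y : E}
    (χ : M.Cochain n y) : α.pull (β.pull χ) = 0 := by
  funext x c
  ext m
  change χ x c (β.app x (α.app x m)) = 0
  rw [(hαβ x).apply_apply_eq_zero, map_zero]

theorem Hom.pull_sub {n : ℕ} {y : E} (φ ψ : P.Cochain n y) :
    α.pull (φ - ψ) = α.pull φ - α.pull ψ := rfl

variable (hα : ∀ x, Function.Injective (α.app x)) (hβ : ∀ x, Function.Surjective (β.app x))
  (hαβ : ∀ x, Function.Exact (α.app x) (β.app x))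

include hα hβ hαβ

/-- Dimension shifting, from the quotient to the kernel. -/
theorem Vanishes.kernel {n : ℕ} {y : E} (hM : M.Vanishes (n + 1) y) (hP : P.Vanishes n y) :
    M'.Vanishes n y := by
  -- Cocycles on `M'` extend to cocycles on `P`: the differential of any extension `φ₁` comes from a
  -- cocycle of `M` in degree `n + 1`, and a primitive `η` of it corrects `φ₁`.
  have key : ∀ φ : M'.Cochain n y, M'.d φ = 0 → ∃ φ' : P.Cochain n y, P.d φ' = 0 ∧
      α.pull φ' = φ := by
    intro φ hφ
    obtain ⟨φ₁, rfl⟩ := α.pull_surjective hα φ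
    obtain ⟨χ, hχ⟩ := α.exists_pull_eq β hβ hαβ (P.d φ₁) (by rw [← α.d_pull, hφ])
    obtain ⟨η, rfl⟩ := hM χ (β.pull_injective hβ (by
      rw [← β.d_pull, hχ, d_d]; rfl))
    refine ⟨φ₁ - β.pull η, ?_, ?_⟩
    · rw [d_sub, β.d_pull, hχ, sub_self]
    · rw [α.pull_sub, α.pull_pull_eq_zero β hαβ, sub_zero]
  cases n with
  | zero =>
    intro φ hφ
    obtain ⟨φ', h, rfl⟩ := key φ hφ
    rw [hP φ' h]
    rfl
  | succ n =>
    intro φ hφ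
    obtain ⟨φ', h, rfl⟩ := key φ hφ
    obtain ⟨ζ, rfl⟩ := hP φ' h
    exact ⟨α.pull ζ, α.d_pull ζ⟩

/-- Dimension shifting, from the kernel to the quotient. -/
theorem Vanishes.quotient {n : ℕ} {y : E} (hM : M'.Vanishes n y) (hP : P.Vanishes (n + 1) y) :
    M.Vanishes (n + 1) y := by
  intro χ hχ
  obtain ⟨φ, hφ⟩ := hP (β.pull χ) (by rw [β.d_pull, hχ]; rfl)
  have h0 : M'.d (α.pull φ) = 0 := by rw [α.d_pull, hφ, α.pull_pull_eq_zero β hαβ]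
  -- Modify `φ` without changing its differential so that it vanishes on `M'` and descends to `M`.
  -- In degree zero its restriction to `M'` already vanishes; otherwise it is a coboundary and can
  -- be subtracted.
  have key : ∃ φ' : P.Cochain n y, P.d φ' = β.pull χ ∧ α.pull φ' = 0 := by
    cases n with
    | zero => exact ⟨φ, hφ, hM _ h0⟩
    | succ n =>
      obtain ⟨η, hη⟩ := hM _ h0
      obtain ⟨η, rfl⟩ := α.pull_surjective hα η
      refine ⟨φ - P.d η, by rw [d_sub, d_d, sub_zero, hφ], ?_⟩
      rw [α.pull_sub, ← α.d_pull, hη, sub_self]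
  obtain ⟨φ', h1, h2⟩ := key
  obtain ⟨ξ, rfl⟩ := α.exists_pull_eq β hβ hαβ φ' h2
  exact ⟨ξ, β.pull_injective hβ (by rw [← β.d_pull, h1])⟩

end Shift

/-- Vanishing in degree zero passes to quotients. -/
theorem Vanishes.of_surjective {P : CatRep.{u, v, w, u'} k E} {M : CatRep.{u, v, w, v'} k E}
    (β : Hom P M) {y : E} (hβ : ∀ x, Function.Surjective (β.app x))
    (h : P.Vanishes 0 y) : M.Vanishes 0 y := by
  intro φ hφ
  refine β.pull_injective hβ ?_
  rw [h (β.pull φ) (by rw [β.d_pull, hφ]; rfl)]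
  rfl

/-- Vanishing in degree zero says that there are no generators. -/
theorem vanishes_zero_iff {M : CatRep.{u, v, w, u'} k E} {y : E} : M.Vanishes 0 y ↔
    Submodule.span k {m | ∃ (x : E) (f : x ⟶ y) (_ : deg x < deg y) (m' : M.obj x),
      m = M.map f m'} = ⊤ := by
  set W := Submodule.span k {m | ∃ (x : E) (f : x ⟶ y) (_ : deg x < deg y) (m' : M.obj x),
      m = M.map f m'} with hW
  constructor
  · intro h
    by_contra hne
    -- If the images do not span, a nonzero functional that kills them is a nonzero cocycle in
    -- degree zero.
    obtain ⟨l, hl, hl'⟩ := Submodule.exists_le_ker_of_lt_top W (lt_top_iff_ne_top.2 hne)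
    apply hl
    let φ : M.Cochain 0 y := fun x c => match x, c with | _, .nil _ => l
    have h0 : φ = 0 := by
      apply h
      funext x c
      match x, c with
      | x, .cons f hf (.nil _) =>
        ext m
        rw [d_cons]
        simp only [mergeSum, sub_zero]
        exact hl' (Submodule.subset_span ⟨_, f, hf, m, rfl⟩)
    exact congrFun (congrFun h0 y) (.nil y)
  · intro h φ hφ
    funext x c
    match x, c with
    | _, .nil _ =>
      apply LinearMap.ext
      intro m
      have hm : m ∈ W := h ▸ Submodule.mem_top
      have hle : W ≤ LinearMap.ker (φ y (.nil y)) := by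
        rw [hW, Submodule.span_le]
        rintro _ ⟨x, f, hf, m', rfl⟩
        have := LinearMap.congr_fun (congrFun (congrFun hφ x) (.cons f hf (.nil y))) m'
        rw [d_cons] at this
        simpa [mergeSum] using this
      exact hle hm

section Projective

open DirectSum
open scoped Classical

/-- A natural splitting of the canonical map from the induced representation
`⨁_{g : z ⟶ x} M z` to `M x`. -/
structure InducedSection (M : CatRep.{u, v, w, u'} k E) where
  s : ∀ x, M.obj x →ₗ[k] ⨁ g : (Σ z, z ⟶ x), M.obj g.1
  natural : ∀ {x y : E} (f : x ⟶ y) (m : M.obj x), s y (M.map f m) =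
    DirectSum.toModule k _ _
      (fun g : (Σ z, z ⟶ x) => DirectSum.lof k (Σ z, z ⟶ y) (fun g => M.obj g.1) ⟨g.1, g.2 ≫ f⟩)
      (s x m)
  counit : ∀ (x : E) (m : M.obj x), DirectSum.toModule k _ _ (fun g => M.map g.2) (s x m) = m

/-- The contracting homotopy on cochains defined by a splitting. -/
noncomputable def InducedSection.homotopy {M : CatRep.{u, v, w, u'} k E} (S : M.InducedSection)
    {n : ℕ} {y : E} (φ : M.Cochain (n + 1) y) : M.Cochain n y := fun x c =>
  (DirectSum.toModule k (Σ z, z ⟶ x) k (fun g =>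
    -- Cochains live on chains of morphisms of positive degree, so the remaining `g`, which are
    -- identities, contribute zero.
    if h : deg g.1 < deg x then φ g.1 (.cons g.2 h c) else 0)).comp (S.s x)

theorem mergeSum_zero {V : Type*} [AddCommGroup V] {n : ℕ} {x y : E}
    (c : DegreeChain (n + 1) x y) : mergeSum (fun _ : DegreeChain n x y => (0 : V)) c = 0 := by
  simpa using mergeSum_map (0 : V →+ V) (fun _ : DegreeChain n x y => 0) c

theorem mergeSum_linear {V V' : Type*} [AddCommGroup V] [AddCommGroup V'] [Module k V] [Module k V']
    {n : ℕ} {x y : E} (φ : DegreeChain n x y → (V →ₗ[k] V')) (m : V)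
    (c : DegreeChain (n + 1) x y) :
    mergeSum (fun c' => φ c' m) c = mergeSum φ c m := by
  have := mergeSum_map (LinearMap.applyₗ (R := k) (M₂ := V') m).toAddMonoidHom φ c
  simpa using this

/-- On the induced representation the bar complex is contracted by prepending `g` to the chain; the
natural splitting carries this contraction to `M`. The equation is checked on each summand `g : t ⟶
x`. -/
theorem InducedSection.d_homotopy {M : CatRep.{u, v, w, u'} k E} (S : M.InducedSection)
    {n : ℕ} {y : E} (φ : M.Cochain (n + 1) y) (hφ : M.d φ = 0) : M.d (S.homotopy φ) = φ := by
  funext x c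
  match c with
  | @DegreeChain.cons _ _ _ _ _ z _ f hf c =>
  ext m
  rw [d_cons]
  conv_rhs => rw [← S.counit x m]
  have e1 : S.homotopy φ z c (M.map f m) = DirectSum.toModule k (Σ z, z ⟶ x) k (fun g =>
      φ g.1 (.cons (g.2 ≫ f) ((deg_le g.2).trans_lt hf) c)) (S.s x m) := by
    simp only [homotopy, LinearMap.comp_apply]
    rw [S.natural]
    generalize S.s x m = a
    rw [← LinearMap.comp_apply]
    refine LinearMap.congr_fun ?_ a
    apply DirectSum.linearMap_ext
    intro g
    ext m'
    simp [dif_pos ((deg_le g.2).trans_lt hf)]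
  have e2 : mergeSum (fun c' => S.homotopy φ x c' m) (.cons f hf c) =
      mergeSum (fun c' => DirectSum.toModule k (Σ z, z ⟶ x) k (fun g =>
        if h : deg g.1 < deg x then φ g.1 (.cons g.2 h c') else 0)) (.cons f hf c) (S.s x m) := by
    rw [← mergeSum_linear]
    rfl
  rw [e1, e2, ← LinearMap.sub_apply]
  generalize S.s x m = a
  rw [← LinearMap.comp_apply]
  refine LinearMap.congr_fun ?_ a
  apply DirectSum.linearMap_ext
  rintro ⟨t, g⟩
  ext m'
  simp only [LinearMap.comp_apply, LinearMap.sub_apply, DirectSum.toModule_lof]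
  rw [← mergeSum_linear]
  simp only [DirectSum.toModule_lof]
  by_cases h : deg t < deg x
  · simp only [dif_pos h]
    -- For `g` of positive degree it is the cocycle condition on the chain with `g` in front.
    have := LinearMap.congr_fun (congrFun (congrFun hφ t) (.cons g h (.cons f hf c))) m'
    rw [d_cons, mergeSum] at this
    simp only [Pi.zero_apply, LinearMap.zero_apply] at this
    linear_combination -this
  -- For an identity the homotopy is zero on the chains from `x`, and only the term with `𝟙 ≫ f = f`
  -- survives.
  · obtain ⟨rfl, hg⟩ := eq_of_deg_eq g (le_antisymm (deg_le g) (not_lt.1 h))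
    simp only [eqToHom_refl] at hg
    subst hg
    simp only [lt_irrefl, dif_neg, not_false_eq_true, LinearMap.zero_apply, mergeSum_zero, M.map_id,
      sub_zero, LinearMap.id_apply]
    simp

theorem InducedSection.vanishes {M : CatRep.{u, v, w, u'} k E} (S : M.InducedSection)
    (n : ℕ) (y : E) : M.Vanishes (n + 1) y :=
  fun φ hφ => ⟨S.homotopy φ, S.d_homotopy φ hφ⟩

end Projective

/-- Exactness of the complex of functions on chains. -/
def ChainExact (k : Type w) [Field k] : ∀ (_ : ℕ) (_ _ : E), Prop
  | 0, x, y => ∀ φ : DegreeChain 0 x y → k, mergeSum φ = 0 → φ = 0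
  | n + 1, x, y => ∀ φ : DegreeChain (n + 1) x y → k, mergeSum φ = 0 →
      ∃ ψ : DegreeChain n x y → k, mergeSum ψ = φ

section Trivial

variable {M : CatRep.{u, v, w, u'} k E}
  (hM : ∀ {x y : E} (f : x ⟶ y), deg x < deg y → M.map f = 0)

include hM

theorem d_of_trivial {n : ℕ} {y : E} (φ : M.Cochain n y) (x : E) (c : DegreeChain (n + 1) x y)
    (m : M.obj x) : M.d φ x c m = - mergeSum (fun c' => φ x c' m) c := by
  cases c with
  | cons f hf c => rw [d_cons, hM f hf]; simp

/-- With a trivial action, `d` is `-mergeSum` for each starting object `x` separately. A vector `m`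
and a functional `l` with `l m ≠ 0` make the complex of functions on chains from `x` to `y` a
retract of the bar complex, up to sign. -/
theorem Vanishes.chainExact {n : ℕ} {y : E} (h : M.Vanishes n y) (x : E) [Nontrivial (M.obj x)] :
    ChainExact k n x y := by
  classical
  obtain ⟨m, hm⟩ := exists_ne (0 : M.obj x)
  obtain ⟨l, hl⟩ : ∃ l : Module.Dual k (M.obj x), l m ≠ 0 := by
    by_contra! hl
    exact hm ((Module.forall_dual_apply_eq_zero_iff k m).1 hl)
  let ext : ∀ {n : ℕ}, (DegreeChain n x y → k) → M.Cochain n y := fun φ x' c =>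
    if e : x' = x then φ (e ▸ c) • (e ▸ l) else 0
  have hext : ∀ {n : ℕ} (φ : DegreeChain n x y → k) (c : DegreeChain n x y),
      ext φ x c = φ c • l := fun φ c => by simp [ext]
  have hd : ∀ φ : DegreeChain n x y → k, mergeSum φ = 0 → M.d (ext φ) = 0 := by
    intro φ hφ
    funext x' c
    ext m'
    rw [d_of_trivial hM, mergeSum_linear]
    by_cases e : x' = x
    · subst e
      have h1 : mergeSum (fun c => φ c • l) c = mergeSum φ c • l :=
        mergeSum_map ((LinearMap.toSpanSingleton k _ l).toAddMonoidHom) φ c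
      rw [funext (hext φ), h1, hφ]
      simp
    · have : ext φ x' = fun _ => 0 := by funext c; simp [ext, e]
      rw [this, mergeSum_zero]
      simp
  cases n with
  | zero =>
    intro φ hφ
    funext c
    have h1 := LinearMap.congr_fun (congrFun (congrFun (h _ (hd φ hφ)) x) c) m
    rw [hext] at h1
    simpa [hl] using h1
  | succ n =>
    intro φ hφ
    obtain ⟨ψ, hψ⟩ := h _ (hd φ hφ)
    -- The sign undoes `d = -mergeSum`, and the factor undoes the evaluation of `l` at `m`.
    refine ⟨fun c => - (l m)⁻¹ * ψ x c m, ?_⟩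
    funext c
    have h1 := LinearMap.congr_fun (congrFun (congrFun hψ x) c) m
    rw [hext, d_of_trivial hM, LinearMap.smul_apply, smul_eq_mul] at h1
    have h2 : mergeSum (fun c => - (l m)⁻¹ * ψ x c m) c = - (l m)⁻¹ * mergeSum (ψ x · m) c :=
      mergeSum_map (AddMonoidHom.mulLeft (- (l m)⁻¹)) (fun c => ψ x c m) c
    rw [h2, neg_mul, ← mul_neg, h1]
    field_simp

/-- A cochain at `x` is a family of functions on chains indexed by a basis of `M.obj x`, so
primitives can be found for each basis vector separately. -/
theorem vanishes_of_chainExact {n : ℕ} {y : E}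
    (h : ∀ x, Nontrivial (M.obj x) → ChainExact k n x y) : M.Vanishes n y := by
  have hb : ∀ x, (Module.Basis.ofVectorSpaceIndex k (M.obj x)).Nonempty → ChainExact k n x y :=
    fun x ⟨b, hb⟩ => h x ⟨_, 0, (Module.Basis.ofVectorSpace k (M.obj x)).ne_zero ⟨b, hb⟩⟩
  have hz : ∀ φ : M.Cochain n y, M.d φ = 0 → ∀ x
      (b : Module.Basis.ofVectorSpaceIndex k (M.obj x)),
      mergeSum (fun c => φ x c (Module.Basis.ofVectorSpace k (M.obj x) b)) = 0 := by
    intro φ hφ x b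
    funext c
    rw [← neg_inj, ← d_of_trivial hM, hφ]
    simp
  cases n with
  | zero =>
    intro φ hφ
    funext x c
    refine (Module.Basis.ofVectorSpace k (M.obj x)).ext fun b => ?_
    exact congrFun (hb x ⟨b, b.2⟩ _ (hz φ hφ x b)) c
  | succ n =>
    intro φ hφ
    choose ψ hψ using fun x (b : Module.Basis.ofVectorSpaceIndex k (M.obj x)) =>
      hb x ⟨b, b.2⟩ _ (hz φ hφ x b)
    refine ⟨fun x c => - (Module.Basis.ofVectorSpace k (M.obj x)).constr k fun b => ψ x b c, ?_⟩
    funext x c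
    refine (Module.Basis.ofVectorSpace k (M.obj x)).ext fun b => ?_
    rw [d_of_trivial hM, ← congrFun (hψ x b) c]
    simp only [LinearMap.neg_apply, Module.Basis.constr_basis]
    have h2 : mergeSum (fun c => - ψ x b c) c = - mergeSum (ψ x b) c :=
      mergeSum_map (-AddMonoidHom.id k) (ψ x b) c
    rw [h2, neg_neg]

end Trivial

end CatRep

end RelativeCochains

/-! ### Objects with degrees. -/

section GradedObjects

/-- A graded category in which the morphisms of length zero are the identities. -/
class CategoryGrading.IsSkeletal {B : Type u} [Category.{v} B] (l : CategoryGrading B) : Prop where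
  eq_eqToHom : ∀ {X Y : B} (f : X ⟶ Y), l.len f = 0 → ∃ h : X = Y, f = eqToHom h

/-- The objects of a graded category together with a degree. -/
@[ext]
structure GradedObj {B : Type u} [Category.{v} B] (l : CategoryGrading B) where
  obj : B
  deg : ℤ

variable {B : Type u} [Category.{v} B] {l : CategoryGrading B}

/-- Morphisms are those whose length is the difference of the degrees, so that a graded module
becomes an ordinary functor. -/
instance : Category.{v} (GradedObj l) where
  Hom x y := {f : x.obj ⟶ y.obj // y.deg = x.deg + l.len f}
  id x := ⟨𝟙 x.obj, by simp [l.len_id]⟩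
  comp f g := ⟨f.1 ≫ g.1, by
    have h1 := f.2
    have h2 := g.2
    rw [l.len_comp]; push_cast; omega⟩

namespace GradedObj

theorem hom_ext {x y : GradedObj l} {f g : x ⟶ y} (h : f.1 = g.1) : f = g := Subtype.ext h

/-- A morphism of the right length, as a morphism of graded objects. -/
def homMk (x y : GradedObj l) (f : x.obj ⟶ y.obj) (h : y.deg = x.deg + l.len f) : x ⟶ y := ⟨f, h⟩

theorem comp_val {x y z : GradedObj l} (f : x ⟶ y) (g : y ⟶ z) : (f ≫ g).1 = f.1 ≫ g.1 := rfl

theorem eqToHom_val {x y : GradedObj l} (h : x = y) :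
    (eqToHom h : x ⟶ y).1 = eqToHom (congrArg obj h) := by
  subst h; rfl

instance [l.IsSkeletal] : DegreeCategory (GradedObj l) where
  deg := deg
  deg_le f := by rw [f.2]; omega
  eq_of_deg_eq {x y} f h := by
    have hf := f.2
    obtain ⟨e, he⟩ := CategoryGrading.IsSkeletal.eq_eqToHom (l := l) f.1 (by omega)
    have hxy : x = y := GradedObj.ext e h
    refine ⟨hxy, hom_ext ?_⟩
    rw [he, eqToHom_val]

end GradedObj

end GradedObjects

/-! ### Chains of graded objects and sequences of morphisms. -/

section Chains

open DegreeCategory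

namespace DegreeChain

variable {E : Type u} [Category.{v} E] [DegreeCategory E]

/-- The degree of an intermediate object is a sum of lengths, so two chains often have intermediate
objects that agree only after a computation. Hence the transport on the first morphism and the
heterogeneous equality of the rest. -/
theorem cons_congr {n : ℕ} {x z z' y : E}
    (hz : z = z') (f : x ⟶ z) (f' : x ⟶ z') (h : deg x < deg z) (h' : deg x < deg z')
    (c : DegreeChain n z y) (c' : DegreeChain n z' y) (hf : f ≫ eqToHom hz = f') (hc : HEq c c') :
    DegreeChain.cons f h c = .cons f' h' c' := by
  subst hz
  obtain rfl := eq_of_heq hc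
  simp only [eqToHom_refl, Category.comp_id] at hf
  subst hf
  rfl

theorem cons_injective {n : ℕ} {x z z' y : E}
    {f : x ⟶ z} {f' : x ⟶ z'} {h : deg x < deg z} {h' : deg x < deg z'}
    {c : DegreeChain n z y} {c' : DegreeChain n z' y}
    (e : DegreeChain.cons f h c = .cons f' h' c') :
    ∃ hz : z = z', f ≫ eqToHom hz = f' ∧ HEq c c' := by
  cases e
  exact ⟨rfl, by simp, HEq.rfl⟩

/-- The composite of a chain. -/
def comp : ∀ {n : ℕ} {x y : E}, DegreeChain n x y → (x ⟶ y)
  | _, _, _, .nil x => 𝟙 x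
  | _, _, _, .cons f _ c => f ≫ comp c

theorem deg_lt : ∀ {n : ℕ} {x y : E}, DegreeChain (n + 1) x y → deg x < deg y
  | _, _, _, .cons _ h c => lt_of_lt_of_le h (deg_le (comp c))

/-- Compose two adjacent morphisms of a chain. -/
def face : ∀ {n : ℕ} {x y : E}, Fin (n + 1) → DegreeChain (n + 2) x y → DegreeChain (n + 1) x y
  | _, _, _, ⟨0, _⟩, .cons f hf (.cons g _ c) => .cons (f ≫ g) (lt_comp hf g) c
  | _ + 1, _, _, ⟨j + 1, hj⟩, .cons f hf c =>
      .cons f hf (face ⟨j, Nat.lt_of_succ_lt_succ hj⟩ c)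

/-- The minus sign in the recursion for `mergeSum` accumulates to `(-1) ^ j`. This puts the
differential on chains into the simplicial form of `coboundary`. -/
theorem mergeSum_eq_sum {k : Type*} [Ring k] : ∀ {n : ℕ} {x y : E}
    (φ : DegreeChain (n + 1) x y → k) (c : DegreeChain (n + 2) x y),
    mergeSum φ c = ∑ j : Fin (n + 1), (-1 : k) ^ (j : ℕ) * φ (c.face j)
  | 0, _, _, φ, .cons f hf (.cons g hg c) => by
      simp [mergeSum]
      rfl
  | n + 1, _, _, φ, .cons f hf (.cons g hg c) => by
      rw [mergeSum, mergeSum_eq_sum, Fin.sum_univ_succ (n := n + 1), sub_eq_add_neg,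
        ← Finset.sum_neg_distrib]
      congr 1
      · simp
        rfl
      · refine Finset.sum_congr rfl fun j _ => ?_
        rw [Fin.val_succ, pow_succ]
        have : (DegreeChain.cons f hf (.cons g hg c)).face j.succ =
          .cons f hf ((DegreeChain.cons g hg c).face j) := rfl
        rw [this]
        simp

end DegreeChain

variable {B : Type u} [Category.{v} B] {l : CategoryGrading B}

/-- A sequence of `r + 1` composable morphisms of positive length ending at `Y`. -/
structure ArrowSeq (l : CategoryGrading B) (r : ℕ) (Y : B) where
  obj : ∀ i, i ≤ r → B
  map : ∀ i (h : i + 1 ≤ r), obj i (Nat.le_of_succ_le h) ⟶ obj (i + 1) h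
  last : obj r le_rfl ⟶ Y
  map_pos : ∀ i h, 0 < l.len (map i h)
  last_pos : 0 < l.len last

namespace ArrowSeq

variable {Y : B}

/-- Omit the first morphism. -/
def tail {r : ℕ} (S : ArrowSeq l (r + 1) Y) : ArrowSeq l r Y where
  obj i h := S.obj (i + 1) (Nat.succ_le_succ h)
  map i h := S.map (i + 1) (Nat.succ_le_succ h)
  last := S.last
  map_pos i h := S.map_pos (i + 1) (Nat.succ_le_succ h)
  last_pos := S.last_pos

/-- The first object. -/
abbrev start {r : ℕ} (S : ArrowSeq l r Y) : B := S.obj 0 (Nat.zero_le r)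

/-- The first morphism. -/
abbrev head {r : ℕ} (S : ArrowSeq l (r + 1) Y) : S.start ⟶ S.tail.start :=
  S.map 0 (Nat.succ_le_succ (Nat.zero_le r))

/-- The composite. -/
def comp : ∀ {r : ℕ} (S : ArrowSeq l r Y), S.start ⟶ Y
  | 0, S => S.last
  | _ + 1, S => S.head ≫ S.tail.comp

theorem comp_succ {r : ℕ} (S : ArrowSeq l (r + 1) Y) : S.comp = S.head ≫ S.tail.comp := rfl

variable [l.IsSkeletal]

/-- The chain of graded objects defined by a sequence. -/
def chain : ∀ {r : ℕ} (S : ArrowSeq l r Y) (a b : ℤ) (_ : b = a + l.len S.comp),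
    DegreeChain (r + 1) (⟨S.start, a⟩ : GradedObj l) ⟨Y, b⟩
  | 0, S, a, b, hb =>
      .cons (z := ⟨Y, b⟩) (GradedObj.homMk _ _ S.last hb)
        (show a < b by
          have h1 := S.last_pos
          have h2 : b = a + l.len S.last := hb
          omega) (.nil _)
  | r + 1, S, a, b, hb =>
      .cons (z := ⟨S.tail.start, a + l.len S.head⟩) (GradedObj.homMk _ _ S.head rfl)
        (show a < a + l.len S.head by
          have h1 : 0 < l.len S.head := S.map_pos _ _
          omega)
        (S.tail.chain (a + l.len S.head) b (by
          rw [hb, comp_succ, l.len_comp]; push_cast; ring))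

theorem comp_chain : ∀ {r : ℕ} (S : ArrowSeq l r Y) (a b : ℤ) (hb : b = a + l.len S.comp),
    (S.chain a b hb).comp.1 = S.comp
  | 0, S, _, _, _ => Category.comp_id S.last
  | _ + 1, S, _, b, _ => congrArg (S.head ≫ ·) (S.tail.comp_chain _ b _)

/-- Sequences that differ by isomorphisms of the objects. -/
def Rel {r : ℕ} (S S' : ArrowSeq l r Y) (e : ∀ i h, S.obj i h ≅ S'.obj i h) : Prop :=
  (∀ i h, S.map i h ≫ (e (i + 1) h).hom = (e i (Nat.le_of_succ_le h)).hom ≫ S'.map i h) ∧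
    (e r le_rfl).hom ≫ S'.last = S.last

/-- Isomorphisms have length zero, and in the skeletal case such morphisms are identities. -/
theorem eq_of_iso (l : CategoryGrading B) [l.IsSkeletal] {X X' : B} (e : X ≅ X') :
    ∃ h : X = X', e.hom = eqToHom h :=
  CategoryGrading.IsSkeletal.eq_eqToHom (l := l) e.hom (l.len_eq_zero_of_isIso e.hom)

theorem heq_cons {n : ℕ} {Z Z' : B} {a : ℤ} {z z' y : GradedObj l} (h : Z = Z') (hz : z = z')
    (f : Z ⟶ z.obj) (f' : Z' ⟶ z'.obj) (hf : f ≫ eqToHom (congrArg GradedObj.obj hz) =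
      eqToHom h ≫ f') (p p') (q q') {c : DegreeChain n z y} {c' : DegreeChain n z' y}
    (hc : HEq c c') : HEq (DegreeChain.cons (GradedObj.homMk ⟨Z, a⟩ _ f p) q c)
      (DegreeChain.cons (GradedObj.homMk ⟨Z', a⟩ _ f' p') q' c') := by
  subst h hz
  simp only [eqToHom_refl, Category.id_comp, Category.comp_id] at hf
  subst hf
  obtain rfl := eq_of_heq hc
  rfl

omit [l.IsSkeletal] in
theorem len_eqToHom_comp {X X' Z : B} (h : X = X') (f : X' ⟶ Z) :
    l.len (eqToHom h ≫ f) = l.len f := by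
  subst h; simp

omit [l.IsSkeletal] in
theorem len_comp_eqToHom {X Z Z' : B} (h : Z = Z') (f : X ⟶ Z) :
    l.len (f ≫ eqToHom h) = l.len f := by
  subst h; simp

theorem Rel.head {r : ℕ} {S S' : ArrowSeq l (r + 1) Y} {e : ∀ i h, S.obj i h ≅ S'.obj i h}
    (H : S.Rel S' e) : ∃ (h0 : S.start = S'.start) (h1 : S.tail.start = S'.tail.start),
      S.head ≫ eqToHom h1 = eqToHom h0 ≫ S'.head ∧ l.len S.head = l.len S'.head := by
  obtain ⟨h0, e0⟩ := eq_of_iso l (e 0 (Nat.zero_le _))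
  obtain ⟨h1, e1⟩ := eq_of_iso l (e (0 + 1) (Nat.succ_le_succ (Nat.zero_le r)))
  have h3 := H.1 0 (Nat.succ_le_succ (Nat.zero_le r))
  rw [e0, e1] at h3
  exact ⟨h0, h1, h3, (len_comp_eqToHom (l := l) h1 S.head).symm.trans
    ((congrArg l.len h3).trans (len_eqToHom_comp h0 S'.head))⟩

/-- The connecting isomorphisms are identities up to equality of objects, so isomorphic sequences
have literally the same chain. This makes chains well defined on equivalence classes of
factorizations. -/
theorem Rel.chain : ∀ {r : ℕ} {S S' : ArrowSeq l r Y} {e : ∀ i h, S.obj i h ≅ S'.obj i h}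
    (_ : S.Rel S' e) (a a' b : ℤ) (_ : a = a') (hb : b = a + l.len S.comp)
    (hb' : b = a' + l.len S'.comp), HEq (S.chain a b hb) (S'.chain a' b hb')
  | 0, S, S', e, ⟨_, h2⟩, a, _, b, rfl, hb, hb' => by
      obtain ⟨h0, he⟩ := eq_of_iso l (e 0 le_rfl)
      rw [he] at h2
      exact heq_cons h0 rfl _ _ (by rw [h2]; exact Category.comp_id _) _ _ _ _ HEq.rfl
  | r + 1, S, S', e, H, a, _, b, rfl, hb, hb' => by
      obtain ⟨h0, h1, h2, h3⟩ := H.head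
      exact heq_cons h0 (GradedObj.ext h1 (by rw [h3])) _ _ h2 _ _ _ _
        (Rel.chain (S := S.tail) (S' := S'.tail) (e := fun i h => e (i + 1) _)
        ⟨fun i h => H.1 (i + 1) _, H.2⟩ (a + l.len S.head) (a + l.len S'.head) b (by rw [h3])
        (by rw [hb, comp_succ, l.len_comp]; push_cast; ring)
        (by rw [hb', comp_succ, l.len_comp]; push_cast; ring))

/-- Sequences with the same chain differ by isomorphisms. -/
theorem exists_rel_of_chain_heq : ∀ {r : ℕ} {S S' : ArrowSeq l r Y} (a a' b : ℤ) (_ : a = a')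
    (_ : S.start = S'.start) (hb : b = a + l.len S.comp)
    (hb' : b = a' + l.len S'.comp) (_ : HEq (S.chain a b hb) (S'.chain a' b hb')),
    ∃ e, S.Rel S' e
  | 0, S, S', a, _, b, rfl, h0, hb, hb', H => by
      refine ⟨fun i h => eqToIso (by obtain rfl := Nat.le_zero.1 h; exact h0), fun i h => by omega, ?_⟩
      have key : ∀ (Z Z' : B) (h : Z = Z') (f : Z ⟶ Y) (f' : Z' ⟶ Y)
          (p p' q q') (_ : HEq (DegreeChain.cons (x := (⟨Z, a⟩ : GradedObj l)) (z := ⟨Y, b⟩)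
            (GradedObj.homMk _ _ f p) q (.nil _))
            (DegreeChain.cons (x := (⟨Z', a⟩ : GradedObj l)) (z := ⟨Y, b⟩)
            (GradedObj.homMk _ _ f' p') q' (.nil _))), eqToHom h ≫ f' = f := by
        rintro Z _ rfl f f' p p' q q' H
        obtain ⟨_, h1, _⟩ := DegreeChain.cons_injective (eq_of_heq H)
        simp only [eqToHom_refl, Category.id_comp, Category.comp_id] at h1 ⊢
        exact (congrArg Subtype.val h1).symm
      exact key _ _ h0 _ _ _ _ _ _ H
  | r + 1, S, S', a, _, b, rfl, h0, hb, hb', H => by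
      have key : ∀ (n : ℕ) (Z Z' : B) (h : Z = Z') (z z' y : GradedObj l) (f : Z ⟶ z.obj)
          (f' : Z' ⟶ z'.obj) (p p' q q') (c : DegreeChain n z y) (c' : DegreeChain n z' y)
          (_ : HEq (DegreeChain.cons (GradedObj.homMk ⟨Z, a⟩ _ f p) q c)
            (DegreeChain.cons (GradedObj.homMk ⟨Z', a⟩ _ f' p') q' c')),
          ∃ hz : z = z', f ≫ eqToHom (congrArg GradedObj.obj hz) = eqToHom h ≫ f' ∧ HEq c c' := by
        rintro n Z _ rfl z z' y f f' p p' q q' c c' H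
        obtain ⟨rfl, h1, h2⟩ := DegreeChain.cons_injective (eq_of_heq H)
        refine ⟨rfl, ?_, h2⟩
        simp only [eqToHom_refl, Category.id_comp, Category.comp_id] at h1 ⊢
        exact (congrArg Subtype.val h1)
      obtain ⟨hz, h1, h2⟩ := key _ _ _ h0 _ _ _ _ _ _ _ _ _ _ _ H
      obtain ⟨e, he⟩ := exists_rel_of_chain_heq _ _ _ (congrArg GradedObj.deg hz)
        (congrArg GradedObj.obj hz) _ _ h2
      refine ⟨fun i h => match i with
        | 0 => eqToIso h0
        | i + 1 => e i (Nat.le_of_succ_le_succ h), fun i h => ?_, he.2⟩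
      match i with
      | 0 =>
        obtain ⟨h3, h4⟩ := eq_of_iso l (e 0 (Nat.zero_le r))
        change S.head ≫ (e 0 _).hom = eqToHom h0 ≫ S'.head
        rw [h4]
        exact h1
      | i + 1 => exact he.1 i (Nat.le_of_succ_le_succ h)

/-- Built by recursion: the first morphism of the chain is put in front of the sequence of the rest,
with an `eqToHom` at the joint. -/
theorem exists_chain_eq : ∀ {r : ℕ} {x y : GradedObj l} (c : DegreeChain (r + 1) x y),
    ∃ (S : ArrowSeq l r y.obj) (_ : x.obj = S.start) (hb : y.deg = x.deg + l.len S.comp),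
      HEq (S.chain x.deg y.deg hb) c
  | 0, x, y, .cons f hf (.nil _) => by
      have h0 : 0 < l.len f.1 := by
        have h1 : y.deg = _ := f.2
        have h2 : x.deg < y.deg := hf
        omega
      refine ⟨⟨fun _ _ => x.obj, fun i h => by omega, f.1, fun i h => by omega, h0⟩, rfl, f.2, ?_⟩
      rfl
  | r + 1, x, y, .cons (z := z) f hf c => by
      have h0 : 0 < l.len f.1 := by
        have h1 : z.deg = _ := f.2
        have h2 : x.deg < z.deg := hf
        omega
      obtain ⟨S, hS, hb, H⟩ := exists_chain_eq c
      let S' : ArrowSeq l (r + 1) y.obj :=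
        { obj := fun i h => match i with
            | 0 => x.obj
            | i + 1 => S.obj i (Nat.le_of_succ_le_succ h)
          map := fun i h => match i with
            | 0 => f.1 ≫ eqToHom hS
            | i + 1 => S.map i (Nat.le_of_succ_le_succ h)
          last := S.last
          map_pos := fun i h => match i with
            | 0 => by simpa [len_comp_eqToHom] using h0
            | i + 1 => S.map_pos i (Nat.le_of_succ_le_succ h)
          last_pos := S.last_pos }
      have h1 : l.len S'.head = l.len f.1 := len_comp_eqToHom hS f.1
      have h2 : z.deg = x.deg + l.len f.1 := f.2
      have h3 : x.deg + l.len S'.head = z.deg :=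
        (congrArg (fun n : ℕ => x.deg + (n : ℤ)) h1).trans h2.symm
      have hb' : y.deg = x.deg + l.len S'.comp := by
        rw [comp_succ, l.len_comp, Nat.cast_add, ← add_assoc, h3]
        exact hb
      have key : ∀ {X Z Z' : B} (g : X ⟶ Z) (h : Z = Z') (h' : Z' = Z),
          (g ≫ eqToHom h) ≫ eqToHom h' = 𝟙 X ≫ g := by
        rintro X Z _ g rfl h'
        simp
      refine ⟨S', rfl, hb', ?_⟩
      refine heq_cons (Z := x.obj) (Z' := x.obj) (z := ⟨S'.tail.start, x.deg + l.len S'.head⟩)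
        (z' := z) rfl (GradedObj.ext hS.symm h3) S'.head f.1 (key f.1 hS _) _ _ _ _ ?_
      refine HEq.trans ?_ H
      change HEq (S.chain (x.deg + l.len S'.head) y.deg _) _
      generalize_proofs p1
      generalize x.deg + (l.len S'.head : ℤ) = t at *
      subst h3
      rfl

end ArrowSeq

end Chains

/-! ### Factorizations as chains, and the chains between two graded objects as cells. -/

section FactorizationChains

open DegreeCategory

variable {B : Type u} [Category.{v} B] {l : CategoryGrading B}

theorem CategoryGrading.IsIndiscretelyBased.len_pos (hl : l.IsIndiscretelyBased) {X Y : B}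
    {f : X ⟶ Y} (hf : ¬ IsIso f) : 0 < l.len f :=
  Nat.pos_of_ne_zero fun h => hf (hl.isIso f h)

theorem CategoryGrading.not_isIso_of_len_pos {X Y : B} {f : X ⟶ Y} (hf : 0 < l.len f) :
    ¬ IsIso f := fun h => by
  rw [l.len_eq_zero_of_isIso] at hf
  exact lt_irrefl _ hf

/-- The order embedding `Fin.succAbove` on natural numbers. -/
def skipIndex : ℕ → ℕ → ℕ
  | 0, i => i + 1
  | _ + 1, 0 => 0
  | j + 1, i + 1 => skipIndex j i + 1

theorem skipIndex_le : ∀ {j i r : ℕ}, i ≤ r → skipIndex j i ≤ r + 1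
  | 0, _, _, h => Nat.succ_le_succ h
  | _ + 1, 0, _, _ => Nat.zero_le _
  | _ + 1, _ + 1, _ + 1, h => Nat.succ_le_succ (skipIndex_le (Nat.le_of_succ_le_succ h))

theorem skipIndex_lt : ∀ {j i i' : ℕ}, i < i' → skipIndex j i < skipIndex j i'
  | 0, _, _, h => Nat.succ_lt_succ h
  | _ + 1, 0, _ + 1, _ => Nat.succ_pos _
  | _ + 1, _ + 1, _ + 1, h => Nat.succ_lt_succ (skipIndex_lt (Nat.lt_of_succ_lt_succ h))

theorem coe_succAbove_eq_skipIndex : ∀ {n : ℕ} (j : Fin (n + 1)) (i : Fin n),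
    (j.succAbove i : ℕ) = skipIndex j i
  | 0, _, i => i.elim0
  | n + 1, j, i => by
    induction j using Fin.cases with
    | zero => simp [skipIndex]
    | succ j =>
      induction i using Fin.cases with
      | zero => simp [skipIndex]
      | succ i => simp [skipIndex, coe_succAbove_eq_skipIndex]

theorem GradedObj.mk_congr {Z : B} {a a' : ℤ} (h : a = a') :
    (⟨Z, a⟩ : GradedObj l) = ⟨Z, a'⟩ := by
  rw [h]

theorem GradedObj.comp_eqToHom_mk {x : GradedObj l} {Z : B} {a a' : ℤ} (h : a = a')
    (f : x ⟶ ⟨Z, a⟩) : (f ≫ eqToHom (GradedObj.mk_congr h)).1 = f.1 := by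
  subst h
  rw [eqToHom_refl, Category.comp_id]

namespace ArrowSeq

variable {Y : B}

theorem chain_heq_of_eq [l.IsSkeletal] {r : ℕ} (S : ArrowSeq l r Y) {a a' b : ℤ} (h : a = a')
    (hb : b = a + l.len S.comp) (hb' : b = a' + l.len S.comp) :
    HEq (S.chain a b hb) (S.chain a' b hb') := by
  subst h; rfl

theorem Rel.comp_eq : ∀ {r : ℕ} {S S' : ArrowSeq l r Y} {e : ∀ i h, S.obj i h ≅ S'.obj i h}
    (_ : S.Rel S' e), S.comp = (e 0 (Nat.zero_le r)).hom ≫ S'.comp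
  | 0, _, _, _, H => H.2.symm
  | r + 1, S, S', e, H => by
    have ih := Rel.comp_eq (S := S.tail) (S' := S'.tail) (e := fun i h => e (i + 1) _)
      ⟨fun i h => H.1 (i + 1) _, H.2⟩
    rw [comp_succ, ih, comp_succ]
    have h1 := H.1 0 (Nat.succ_le_succ (Nat.zero_le r))
    exact (Category.assoc _ _ _).symm.trans ((congrArg (· ≫ S'.tail.comp) h1).trans
      (Category.assoc _ _ _))

end ArrowSeq

namespace NontrivialFactorization

variable {X Y : B} {p : X ⟶ Y} {N : ℕ}

section

variable (hl : l.IsIndiscretelyBased) (f : NontrivialFactorization p N)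

include hl in
theorem len_last_pos (i : Fin (N + 1)) :
    0 < l.len (f.mid.map (homOfLE (Fin.le_last i)) ≫ f.last) := by
  rw [l.len_comp]
  have := hl.len_pos f.last_not_isIso
  omega

/-- The sequence of morphisms obtained from the interior objects with indices `s 0 < s 1 < ...`. -/
def seqAlong {r : ℕ} (s : ∀ i, i ≤ r → Fin (N + 1))
    (hs : ∀ i h, s i (Nat.le_of_succ_le h) < s (i + 1) h) : ArrowSeq l r Y where
  obj i h := f.mid.obj (s i h)
  map i h := f.mid.map (homOfLE (hs i h).le)
  last := f.mid.map (homOfLE (Fin.le_last _)) ≫ f.last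
  map_pos i h := hl.len_pos (f.mid_map_not_isIso hl (hs i h))
  last_pos := f.len_last_pos hl _

theorem comp_seqAlong : ∀ {r : ℕ} (s : ∀ i, i ≤ r → Fin (N + 1))
    (hs : ∀ i h, s i (Nat.le_of_succ_le h) < s (i + 1) h),
    (f.seqAlong hl s hs).comp =
      f.mid.map (homOfLE (Fin.le_last (s 0 (Nat.zero_le r)))) ≫ f.last
  | 0, s, hs => rfl
  | r + 1, s, hs => by
    rw [ArrowSeq.comp_succ]
    have : (f.seqAlong hl s hs).tail.comp = f.mid.map (homOfLE (Fin.le_last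
        (s (0 + 1) (Nat.succ_le_succ (Nat.zero_le r))))) ≫ f.last :=
      comp_seqAlong (fun i h => s (i + 1) (Nat.succ_le_succ h)) (fun i h => hs (i + 1) _)
    rw [this]
    change f.mid.map _ ≫ f.mid.map _ ≫ f.last = _
    rw [← f.mid.map_comp_assoc]
    rfl

variable [l.IsSkeletal]

/-- The sequence already starts at the interior object with index `s 0`, so face `j` omits the
object in position `j + 1`; this is the shift in `skipIndex (j + 1)`. -/
theorem face_chain_seqAlong : ∀ {r : ℕ} (s : ∀ i, i ≤ r + 1 → Fin (N + 1))
    (hs : ∀ i h, s i (Nat.le_of_succ_le h) < s (i + 1) h) (j : Fin (r + 1)) (a b : ℤ)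
    (hb : b = a + l.len (f.seqAlong hl s hs).comp)
    (hs' : ∀ i (h : i + 1 ≤ r), s (skipIndex (j + 1) i) (skipIndex_le (Nat.le_of_succ_le h)) <
      s (skipIndex (j + 1) (i + 1)) (skipIndex_le h))
    (hb' : b = a + l.len (f.seqAlong hl
      (fun i h => s (skipIndex (j + 1) i) (skipIndex_le h)) hs').comp),
    ((f.seqAlong hl s hs).chain a b hb).face j =
      (f.seqAlong hl (fun i h => s (skipIndex (j + 1) i) (skipIndex_le h)) hs').chain a b hb'
  | 0, s, hs, ⟨0, _⟩, a, b, hb, hs', hb' => by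
    refine DegreeChain.cons_congr rfl _ _ _ _ _ _ ?_ HEq.rfl
    rw [eqToHom_refl, Category.comp_id]
    apply GradedObj.hom_ext
    change f.mid.map _ ≫ f.mid.map _ ≫ f.last = f.mid.map _ ≫ f.last
    rw [← f.mid.map_comp_assoc]
    rfl
  | r + 1, s, hs, ⟨0, _⟩, a, b, hb, hs', hb' => by
    let S := f.seqAlong hl s hs
    let S' := f.seqAlong hl (fun i h => s (skipIndex (0 + 1) i) (skipIndex_le h)) hs'
    have h1 : S.head ≫ S.tail.head = S'.head := by
      change f.mid.map _ ≫ f.mid.map _ = f.mid.map _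
      rw [← f.mid.map_comp]
      rfl
    have h2 : a + l.len S.head + l.len S.tail.head = a + l.len S'.head := by
      have h3 : l.len S'.head = _ := (congrArg l.len h1).symm.trans (l.len_comp _ _)
      omega
    refine DegreeChain.cons_congr (GradedObj.mk_congr h2) _ _ _ _ _ _ ?_ ?_
    · apply GradedObj.hom_ext
      exact (GradedObj.comp_eqToHom_mk h2 _).trans h1
    · exact S.tail.tail.chain_heq_of_eq h2 _ _
  | r + 1, s, hs, ⟨j + 1, hj⟩, a, b, hb, hs', hb' => by
    let S := f.seqAlong hl s hs
    let S' := f.seqAlong hl (fun i h => s (skipIndex (j + 1 + 1) i) (skipIndex_le h)) hs'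
    have h1 : b = a + l.len S.head + l.len S.tail.comp := by
      rw [hb, ArrowSeq.comp_succ, l.len_comp, Nat.cast_add, ← add_assoc]
    have h2 : b = a + l.len S'.head + l.len S'.tail.comp := by
      rw [hb', ArrowSeq.comp_succ, l.len_comp, Nat.cast_add, ← add_assoc]
    have ih := face_chain_seqAlong (fun i h => s (i + 1) (Nat.succ_le_succ h))
      (fun i h => hs (i + 1) _) ⟨j, Nat.lt_of_succ_lt_succ hj⟩ (a + l.len S.head) b h1
      (fun i h => hs' (i + 1) (Nat.succ_le_succ h)) h2
    refine DegreeChain.cons_congr rfl _ _ _ _ _ _ (Category.comp_id _) (heq_of_eq ih)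

omit [l.IsSkeletal] in
theorem len_restriction (u : Fin (N + 1)) :
    l.len p = l.len (f.first ≫ f.mid.map (homOfLE (Fin.zero_le u))) +
      l.len (f.mid.map (homOfLE (Fin.le_last u)) ≫ f.last) := by
  rw [← l.len_comp, Category.assoc, ← f.mid.map_comp_assoc]
  exact congrArg l.len f.fac.symm

/-- The chain of graded objects obtained from the interior objects with indices
`s 0 < s 1 < ...`. -/
def chainAlong {r : ℕ} (s : ∀ i, i ≤ r → Fin (N + 1))
    (hs : ∀ i h, s i (Nat.le_of_succ_le h) < s (i + 1) h) (a b : ℤ) (hb : b = a + l.len p) :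
    DegreeChain (r + 2) (⟨X, a⟩ : GradedObj l) ⟨Y, b⟩ :=
  .cons (z := ⟨f.mid.obj (s 0 (Nat.zero_le r)), a + l.len (f.first ≫ f.mid.map
      (homOfLE (Fin.zero_le (s 0 (Nat.zero_le r)))))⟩)
    (GradedObj.homMk _ _ (f.first ≫ f.mid.map (homOfLE (Fin.zero_le _))) rfl)
    (show a < a + l.len (f.first ≫ f.mid.map (homOfLE (Fin.zero_le _))) by
      have h1 := hl.len_pos f.first_not_isIso
      rw [l.len_comp]
      omega)
    ((f.seqAlong hl s hs).chain _ b (by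
      have h1 := f.len_restriction (l := l) (s 0 (Nat.zero_le r))
      rw [comp_seqAlong, hb, h1, Nat.cast_add, add_assoc]
      rfl))

theorem comp_chainAlong {r : ℕ} (s : ∀ i, i ≤ r → Fin (N + 1))
    (hs : ∀ i h, s i (Nat.le_of_succ_le h) < s (i + 1) h) (a b : ℤ) (hb : b = a + l.len p) :
    (f.chainAlong hl s hs a b hb).comp.1 = p := by
  refine (congrArg (_ ≫ ·) ((f.seqAlong hl s hs).comp_chain _ _ _)).trans ?_
  rw [comp_seqAlong]
  refine (Category.assoc _ _ _).trans ((congrArg (f.first ≫ ·) ?_).trans f.fac)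
  refine (Category.assoc _ _ _).symm.trans (congrArg (· ≫ f.last) ?_)
  exact (f.mid.map_comp _ _).symm

/-- With the morphism from `X` in front, face `j` omits the object in position `j`: for `j = 0` the
second morphism is absorbed into the first one, and the other faces are those of the sequence behind
it. -/
theorem face_chainAlong {r : ℕ} (s : ∀ i, i ≤ r + 1 → Fin (N + 1))
    (hs : ∀ i h, s i (Nat.le_of_succ_le h) < s (i + 1) h) (j : Fin (r + 2)) (a b : ℤ)
    (hb : b = a + l.len p)
    (hs' : ∀ i (h : i + 1 ≤ r), s (skipIndex j i) (skipIndex_le (Nat.le_of_succ_le h)) <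
      s (skipIndex j (i + 1)) (skipIndex_le h)) :
    (f.chainAlong hl s hs a b hb).face j =
      f.chainAlong hl (fun i h => s (skipIndex j i) (skipIndex_le h)) hs' a b hb := by
  match j with
  | ⟨0, _⟩ =>
    let S := f.seqAlong hl s hs
    have h1 : (f.first ≫ f.mid.map (homOfLE (Fin.zero_le (s 0 (Nat.zero_le _))))) ≫ S.head =
        f.first ≫ f.mid.map (homOfLE (Fin.zero_le (s (0 + 1) (Nat.succ_le_succ (Nat.zero_le _))))) := by
      change (f.first ≫ f.mid.map _) ≫ f.mid.map _ = _
      rw [Category.assoc, ← f.mid.map_comp]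
      rfl
    have h2 : a + l.len (f.first ≫ f.mid.map (homOfLE (Fin.zero_le (s 0 (Nat.zero_le _))))) +
        l.len S.head = a + l.len (f.first ≫
          f.mid.map (homOfLE (Fin.zero_le (s (0 + 1) (Nat.succ_le_succ (Nat.zero_le _)))))) := by
      have h3 : l.len (f.first ≫ f.mid.map (homOfLE (Fin.zero_le (s (0 + 1) _)))) =
          l.len (f.first ≫ f.mid.map (homOfLE (Fin.zero_le (s 0 (Nat.zero_le _))))) +
          l.len S.head := (congrArg l.len h1).symm.trans (l.len_comp _ _)
      rw [h3]
      push_cast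
      ring
    refine DegreeChain.cons_congr (GradedObj.mk_congr h2) _ _ _ _ _ _ ?_ ?_
    · apply GradedObj.hom_ext
      exact (GradedObj.comp_eqToHom_mk h2 _).trans h1
    · exact S.tail.chain_heq_of_eq h2 _ _
  | ⟨j + 1, hj⟩ =>
    exact DegreeChain.cons_congr rfl _ _ _ _ _ _ (Category.comp_id _) (heq_of_eq
      (f.face_chain_seqAlong hl s hs ⟨j, Nat.lt_of_succ_lt_succ hj⟩ _ b _ hs' _))

/-- The chain of graded objects given by a factorization. -/
def toChain (a b : ℤ) (hb : b = a + l.len p) :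
    DegreeChain (N + 2) (⟨X, a⟩ : GradedObj l) ⟨Y, b⟩ :=
  f.chainAlong hl (fun i h => ⟨i, Nat.lt_succ_of_le h⟩) (fun i _ => Fin.mk_lt_mk.2 (Nat.lt_succ_self i)) a b hb

/-- Both sides run through the interior objects selected by `α`; only superfluous identities have to
be removed. -/
theorem toChain_restrict {m : ℕ} (α : Fin (m + 1) ↪o Fin (N + 1)) (a b : ℤ)
    (hb : b = a + l.len p) : (f.restrict hl α).toChain hl a b hb =
      f.chainAlong hl (fun i h => α ⟨i, Nat.lt_succ_of_le h⟩)
        (fun i _ => α.strictMono (Fin.mk_lt_mk.2 (Nat.lt_succ_self i))) a b hb := by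
  have hid : ∀ (G : Fin (m + 1) ⥤ B) (i : Fin (m + 1)) (g : i ⟶ i), G.map g = 𝟙 _ :=
    fun G i g => G.map_id i
  have h1 : ((f.restrict hl α).first ≫ (f.restrict hl α).mid.map (homOfLE (Fin.zero_le 0))) =
      f.first ≫ f.mid.map (homOfLE (Fin.zero_le (α 0))) := by
    rw [hid]
    exact Category.comp_id _
  have h2 := congrArg (fun n : ℕ => a + (n : ℤ)) (congrArg l.len h1)
  refine DegreeChain.cons_congr (GradedObj.mk_congr h2) _ _ _ _ _ _ ?_ ?_
  · apply GradedObj.hom_ext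
    exact (GradedObj.comp_eqToHom_mk h2 _).trans h1
  · refine ArrowSeq.Rel.chain (S := (f.restrict hl α).seqAlong hl _ _) (S' := f.seqAlong hl _ _)
      (e := fun i h => Iso.refl _) ⟨fun i h => ?_, ?_⟩ _ _ b h2 _ _
    · exact (Category.comp_id _).trans (Category.id_comp _).symm
    · refine (Category.id_comp _).trans ?_
      change f.mid.map _ ≫ f.last = f.mid.map _ ≫ f.mid.map _ ≫ f.last
      rw [← f.mid.map_comp_assoc]
      rfl

theorem chainAlong_congr {r : ℕ} {s s' : ∀ i, i ≤ r → Fin (N + 1)} (h : s = s')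
    (hs : ∀ i h, s i (Nat.le_of_succ_le h) < s (i + 1) h)
    (hs' : ∀ i h, s' i (Nat.le_of_succ_le h) < s' (i + 1) h) (a b : ℤ) (hb : b = a + l.len p) :
    f.chainAlong hl s hs a b hb = f.chainAlong hl s' hs' a b hb := by
  subst h; rfl

theorem face_toChain (f : NontrivialFactorization p (N + 1)) (j : Fin (N + 2)) (a b : ℤ)
    (hb : b = a + l.len p) :
    (f.toChain hl a b hb).face j =
      (f.restrict hl (Fin.succAboveOrderEmb j)).toChain hl a b hb := by
  rw [toChain_restrict]
  refine (f.face_chainAlong hl _ _ j a b hb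
    fun i h => Fin.lt_def.2 (skipIndex_lt (Nat.lt_succ_self i))).trans ?_
  refine f.chainAlong_congr hl ?_ _ _ a b hb
  funext i h
  apply Fin.ext
  exact (coe_succAbove_eq_skipIndex j ⟨i, _⟩).symm

theorem Equivalent.toChain_eq {f g : NontrivialFactorization p N} (h : f.Equivalent g) (a b : ℤ)
    (hb : b = a + l.len p) : f.toChain hl a b hb = g.toChain hl a b hb := by
  obtain ⟨e, h1, h2⟩ := h
  obtain ⟨h0, he⟩ := ArrowSeq.eq_of_iso l (e.app 0)
  change e.hom.app 0 = _ at he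
  have h3 : (f.first ≫ f.mid.map (homOfLE (Fin.zero_le 0))) ≫ eqToHom h0 =
      g.first ≫ g.mid.map (homOfLE (Fin.zero_le 0)) := by
    rw [← he, Category.assoc, e.hom.naturality, reassoc_of% h1]
  refine DegreeChain.cons_congr (GradedObj.ext h0 ?_) _ _ _ _ _ _ ?_ ?_
  · change a + (l.len (f.first ≫ f.mid.map (homOfLE (Fin.zero_le 0))) : ℤ) =
      a + (l.len (g.first ≫ g.mid.map (homOfLE (Fin.zero_le 0))) : ℤ)
    rw [← h3, ArrowSeq.len_comp_eqToHom]
  · apply GradedObj.hom_ext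
    rw [GradedObj.comp_val, GradedObj.eqToHom_val]
    exact h3
  · refine ArrowSeq.Rel.chain (S := f.seqAlong hl _ _) (S' := g.seqAlong hl _ _)
      (e := fun i h => e.app _) ⟨fun i h => e.hom.naturality _, ?_⟩ _ _ b ?_ _ _
    · change e.hom.app _ ≫ g.mid.map _ ≫ g.last = f.mid.map _ ≫ f.last
      rw [← h2, ← e.hom.naturality_assoc]
    · change a + (l.len (f.first ≫ f.mid.map (homOfLE (Fin.zero_le 0))) : ℤ) =
        a + (l.len (g.first ≫ g.mid.map (homOfLE (Fin.zero_le 0))) : ℤ)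
      rw [← h3, ArrowSeq.len_comp_eqToHom]

/-- Equal chains have equal interior objects, and the isomorphisms coming from these equalities
assemble into the natural isomorphism. -/
theorem equivalent_of_toChain_eq {f g : NontrivialFactorization p N} (a b : ℤ)
    (hb : b = a + l.len p) (h : f.toChain hl a b hb = g.toChain hl a b hb) : f.Equivalent g := by
  obtain ⟨hz, h1, h2⟩ := DegreeChain.cons_injective h
  obtain ⟨e, he⟩ := ArrowSeq.exists_rel_of_chain_heq _ _ _ (congrArg GradedObj.deg hz)
    (congrArg GradedObj.obj hz) _ _ h2
  have h3 := congrArg Subtype.val h1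
  rw [GradedObj.comp_val, GradedObj.eqToHom_val] at h3
  obtain ⟨h4, h5⟩ := ArrowSeq.eq_of_iso l (e 0 (Nat.zero_le _))
  have hid : ∀ (G : Fin (N + 1) ⥤ B) (i : Fin (N + 1)) (g : i ⟶ i), G.map g = 𝟙 _ :=
    fun G i g => G.map_id i
  refine ⟨ComposableArrows.isoMk (fun i => e i (Nat.le_of_lt_succ i.2)) fun i hi => ?_, ?_, ?_⟩
  · exact he.1 i hi
  · change (f.first ≫ f.mid.map _) ≫ eqToHom _ = g.first ≫ g.mid.map _ at h3
    have h6 : f.first ≫ f.mid.map (homOfLE (Fin.zero_le 0)) = f.first := by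
      rw [hid]; exact Category.comp_id _
    have h7 : g.first ≫ g.mid.map (homOfLE (Fin.zero_le 0)) = g.first := by
      rw [hid]; exact Category.comp_id _
    exact (congrArg (f.first ≫ ·) h5).trans
      ((congrArg (· ≫ eqToHom h4) h6.symm).trans (h3.trans h7))
  · have h6 : (e N le_rfl).hom ≫ g.mid.map _ ≫ g.last = f.mid.map _ ≫ f.last := he.2
    erw [hid, hid, Category.id_comp, Category.id_comp] at h6
    exact h6

/-- The sequence of the tail of the chain defines the functor `mid`. The morphism `p` is not
prescribed, because a chain between two graded objects fixes only the length of its composite. -/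
theorem exists_toChain_eq {a b : ℤ} (c : DegreeChain (N + 2) (⟨X, a⟩ : GradedObj l) ⟨Y, b⟩) :
    ∃ (p : X ⟶ Y) (hb : b = a + l.len p) (f : NontrivialFactorization p N),
      f.toChain hl a b hb = c := by
  match c with
  | @DegreeChain.cons _ _ _ _ _ z _ F hF c =>
  obtain ⟨S, hS, hb, H⟩ := ArrowSeq.exists_chain_eq c
  let G : Fin (N + 1) ⥤ B := ComposableArrows.mkOfObjOfMapSucc
    (fun i => S.obj i (Nat.le_of_lt_succ i.2)) (fun i => S.map i i.2)
  have hG : ∀ i (h : i + 1 ≤ N), G.map (homOfLE (Fin.mk_le_mk.2 (Nat.le_succ i)) :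
      (⟨i, by omega⟩ : Fin (N + 1)) ⟶ ⟨i + 1, by omega⟩) = S.map i h := fun i h =>
    ComposableArrows.mkOfObjOfMapSucc_map_succ _ _ i h
  obtain ⟨F', hF'⟩ : ∃ F' : X ⟶ G.obj 0, F' = F.1 ≫ eqToHom hS := ⟨_, rfl⟩
  obtain ⟨L, hL⟩ : ∃ L : G.obj (Fin.last N) ⟶ Y, L = S.last := ⟨_, rfl⟩
  have h0 : l.len F' = l.len F.1 :=
    (congrArg l.len hF').trans (ArrowSeq.len_comp_eqToHom hS F.1)
  have h2 : z.deg = a + l.len F.1 := F.2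
  have h2' : a < z.deg := hF
  let f : NontrivialFactorization (F' ≫ G.map (homOfLE (Fin.zero_le (Fin.last N))) ≫ L) N :=
    { mid := G
      first := F'
      last := L
      fac := rfl
      first_not_isIso := CategoryGrading.not_isIso_of_len_pos (l := l) (by omega)
      last_not_isIso := CategoryGrading.not_isIso_of_len_pos (l := l) (by
        rw [hL]; exact S.last_pos)
      mid_not_isIso := fun i => CategoryGrading.not_isIso_of_len_pos (l := l)
        ((S.map_pos _ i.2).trans_eq (congrArg l.len (hG i i.2)).symm) }
  have hid : ∀ (i : Fin (N + 1)) (g : i ⟶ i), G.map g = 𝟙 _ := fun i g => G.map_id i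
  have hrel : (f.seqAlong hl (fun i h => ⟨i, Nat.lt_succ_of_le h⟩)
      (fun i _ => Fin.mk_lt_mk.2 (Nat.lt_succ_self i))).Rel S (fun i h => Iso.refl _) := by
    refine ⟨fun i h => ?_, ?_⟩
    · refine (Category.comp_id _).trans (Eq.trans ?_ (Category.id_comp _).symm)
      exact hG i h
    · refine (Category.id_comp _).trans ?_
      refine hL.symm.trans ((Category.id_comp L).symm.trans ?_)
      exact congrArg (· ≫ L) (hid (Fin.last N) _).symm
  have hcomp : G.map (homOfLE (Fin.zero_le (Fin.last N))) ≫ L = S.comp := by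
    have := hrel.comp_eq
    rw [f.comp_seqAlong] at this
    exact this.trans (Category.id_comp _)
  have h1 : F' ≫ G.map (homOfLE (Fin.zero_le 0)) = F' := by
    rw [hid]; exact Category.comp_id _
  have h3 : a + l.len (F' ≫ G.map (homOfLE (Fin.zero_le 0))) = z.deg := by
    rw [h1, h0]
    exact h2.symm
  refine ⟨_, ?_, f, ?_⟩
  · have h4 : b = z.deg + l.len S.comp := hb
    have h5 : l.len (G.map (homOfLE (Fin.zero_le (Fin.last N))) ≫ L) = l.len S.comp :=
      congrArg l.len hcomp
    rw [l.len_comp F', h5, h0, Nat.cast_add, ← add_assoc]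
    exact h4.trans (congrArg (· + (l.len S.comp : ℤ)) h2)
  · refine DegreeChain.cons_congr (GradedObj.ext hS.symm h3) _ _ _ _ _ _ ?_ ?_
    · apply GradedObj.hom_ext
      rw [GradedObj.comp_val, GradedObj.eqToHom_val]
      refine (congrArg (· ≫ eqToHom hS.symm) (h1.trans hF')).trans ?_
      simp
    · refine HEq.trans ?_ H
      exact ArrowSeq.Rel.chain hrel _ _ b h3 _ _

end

end NontrivialFactorization

section Augmented

variable (hl : l.IsIndiscretelyBased) [l.IsSkeletal] {X Y : B}

/-- The chain given by a cell of the augmented complex of `C(p)`. -/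
def cellChain (p : X ⟶ Y) (hp : 0 < l.len p) (a b : ℤ) (hb : b = a + l.len p) :
    ∀ m, (factorizationComplex hl p).augSimplices m →
      DegreeChain (m + 1) (⟨X, a⟩ : GradedObj l) ⟨Y, b⟩
  -- The empty cell is the chain consisting of `p` alone; hence the shift between `m` and the `m +
  -- 1` morphisms.
  | 0 => fun _ => .cons (z := ⟨Y, b⟩) (GradedObj.homMk _ _ p hb) (show a < b by omega) (.nil _)
  | _ + 1 => Quotient.lift (fun f => f.toChain hl a b hb) fun _ _ h =>
      NontrivialFactorization.Equivalent.toChain_eq hl h a b hb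

theorem comp_cellChain (p : X ⟶ Y) (hp : 0 < l.len p) (a b : ℤ) (hb : b = a + l.len p) :
    ∀ m (σ : (factorizationComplex hl p).augSimplices m),
      (cellChain hl p hp a b hb m σ).comp.1 = p
  | 0, _ => Category.comp_id p
  | m + 1, σ => by
    induction σ using Quotient.inductionOn with
    | h f =>
      exact f.comp_chainAlong hl (fun i h => ⟨i, Nat.lt_succ_of_le h⟩)
        (fun i _ => Fin.mk_lt_mk.2 (Nat.lt_succ_self i)) a b hb

theorem cellChain_injective (p : X ⟶ Y) (hp : 0 < l.len p) (a b : ℤ) (hb : b = a + l.len p) :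
    ∀ m, Function.Injective (cellChain hl p hp a b hb m)
  | 0 => fun _ _ _ => rfl
  | m + 1 => fun σ τ h => by
    induction σ using Quotient.inductionOn with
    | h f =>
      induction τ using Quotient.inductionOn with
      | h g => exact Quotient.sound (NontrivialFactorization.equivalent_of_toChain_eq hl a b hb h)

theorem exists_cellChain_eq {a b : ℤ} : ∀ {m : ℕ}
    (c : DegreeChain (m + 1) (⟨X, a⟩ : GradedObj l) ⟨Y, b⟩),
    ∃ (p : X ⟶ Y) (hp : 0 < l.len p) (hb : b = a + l.len p)
      (σ : (factorizationComplex hl p).augSimplices m), cellChain hl p hp a b hb m σ = c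
  | 0, .cons f hf (.nil _) => by
    have h1 : b = a + l.len f.1 := f.2
    have h2 : a < b := hf
    exact ⟨f.1, by omega, h1, PUnit.unit, rfl⟩
  | m + 1, c => by
    obtain ⟨p, hb, f, hf⟩ := NontrivialFactorization.exists_toChain_eq hl c
    have h2 : a < b := c.deg_lt
    exact ⟨p, by omega, hb, f.toSimplex hl, hf⟩

/-- In the lowest degree, merging the two morphisms of a factorization gives back `p`, which is the
augmentation; in higher degrees the merge omits an interior object. -/
theorem face_cellChain (p : X ⟶ Y) (hp : 0 < l.len p) (a b : ℤ) (hb : b = a + l.len p) :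
    ∀ (m : ℕ) (j : Fin (m + 1)) (σ : (factorizationComplex hl p).augSimplices (m + 1)),
      (cellChain hl p hp a b hb (m + 1) σ).face j =
        cellChain hl p hp a b hb m ((factorizationComplex hl p).augFace m j σ)
  | 0, ⟨0, _⟩, σ => by
    induction σ using Quotient.inductionOn with
    | h f =>
      refine DegreeChain.cons_congr rfl _ _ _ _ _ _ ((Category.comp_id _).trans ?_) HEq.rfl
      apply GradedObj.hom_ext
      refine Eq.trans ?_ f.fac
      change (f.first ≫ f.mid.map _) ≫ f.mid.map _ ≫ f.last = _
      rw [Category.assoc, ← f.mid.map_comp_assoc]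
      rfl
  | m + 1, j, σ => by
    induction σ using Quotient.inductionOn with
    | h f =>
      refine (f.face_toChain hl j a b hb).trans ?_
      change _ = cellChain hl p hp a b hb (m + 1) (Quotient.mk _ (f.restrict hl
        (SemiSimplexCategory.homEquiv (SemiSimplexCategory.homEquiv.symm
          (Fin.succAboveOrderEmb j)))))
      rw [Equiv.apply_symm_apply]
      rfl

/-- Restricted to the chains with composite `p`, the differential on functions of chains is that of
the augmented cochain complex of `C(p)`. -/
theorem mergeSum_cellChain {k : Type w} [CommRing k] (p : X ⟶ Y) (hp : 0 < l.len p) (a b : ℤ)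
    (hb : b = a + l.len p) (m : ℕ)
    (φ : DegreeChain (m + 1) (⟨X, a⟩ : GradedObj l) ⟨Y, b⟩ → k)
    (σ : (factorizationComplex hl p).augSimplices (m + 1)) :
    DegreeChain.mergeSum φ (cellChain hl p hp a b hb (m + 1) σ) =
      (factorizationComplex hl p).coboundary k m (fun τ => φ (cellChain hl p hp a b hb m τ)) σ := by
  rw [DegreeChain.mergeSum_eq_sum]
  simp only [face_cellChain]
  rfl

/-- The chains between two graded objects are the cells of the complexes `C(p)`. -/
noncomputable def cellEquiv {a b : ℤ} (hab : a < b) (m : ℕ) :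
    (Σ p : {p : X ⟶ Y // b = a + l.len p}, (factorizationComplex hl p.1).augSimplices m) ≃
      DegreeChain (m + 1) (⟨X, a⟩ : GradedObj l) ⟨Y, b⟩ :=
  Equiv.ofBijective (fun σ => cellChain hl σ.1.1 (by have := σ.1.2; omega) a b σ.1.2 m σ.2) (by
    constructor
    · rintro ⟨⟨p, hp⟩, σ⟩ ⟨⟨q, hq⟩, τ⟩ h
      obtain rfl : p = q := (comp_cellChain hl p (by omega) a b hp m σ).symm.trans
        ((congrArg (fun c => c.comp.1) h).trans (comp_cellChain hl q (by omega) a b hq m τ))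
      obtain rfl := cellChain_injective hl p (by omega) a b hp m h
      rfl
    · intro c
      obtain ⟨p, hp, hb, σ, rfl⟩ := exists_cellChain_eq hl c
      exact ⟨⟨⟨p, hb⟩, σ⟩, rfl⟩)

/-- Exactness of the augmented cochain complex at one place. -/
theorem SemiSimplicialSet.subsingleton_reducedCohomology_iff (S : SemiSimplicialSet.{u})
    (k : Type w) [CommRing k] (m : ℕ) : Subsingleton (S.ReducedCohomology k m) ↔
      ∀ φ, S.coboundary k m φ = 0 → φ ∈ S.coboundaries k m := by
  rw [Submodule.Quotient.subsingleton_iff, Submodule.submoduleOf_eq_top]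
  rfl

/-- Merging does not change the composite of a chain. So the complex of functions on chains is the
product, over all `p` of length `b - a`, of the augmented cochain complexes of `C(p)`, and it is
exact if and only if each factor is. -/
theorem chainExact_iff (k : Type w) [Field k] {a b : ℤ} (hab : a < b) (m : ℕ) :
    CatRep.ChainExact k (m + 1) (⟨X, a⟩ : GradedObj l) ⟨Y, b⟩ ↔
      ∀ p : X ⟶ Y, b = a + l.len p →
        Subsingleton ((factorizationComplex hl p).ReducedCohomology k m) := by
  classical
  simp only [SemiSimplicialSet.subsingleton_reducedCohomology_iff]
  constructor
  · intro h p hb φ hφ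
    have hp : 0 < l.len p := by omega
    -- A cocycle of one factor is extended by zero to the chains with a different composite.
    let ext : (Σ p : {p : X ⟶ Y // b = a + l.len p},
        (factorizationComplex hl p.1).augSimplices m) → k := fun t =>
      if e : t.1.1 = p then φ (e ▸ t.2) else 0
    let ψ : DegreeChain (m + 1) (⟨X, a⟩ : GradedObj l) ⟨Y, b⟩ → k := fun c =>
      ext ((cellEquiv hl hab m).symm c)
    have hψ : ∀ (q : X ⟶ Y) (hq : b = a + l.len q) (σ),
        ψ (cellChain hl q (by omega) a b hq m σ) = if e : q = p then φ (e ▸ σ) else 0 := by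
      intro q hq σ
      have h1 : (cellEquiv hl hab m).symm (cellChain hl q (by omega) a b hq m σ) = ⟨⟨q, hq⟩, σ⟩ :=
        (Equiv.symm_apply_eq _).2 rfl
      exact congrArg ext h1
    have h0 : DegreeChain.mergeSum ψ = 0 := by
      funext c
      obtain ⟨q, hq, hqb, σ, rfl⟩ := exists_cellChain_eq hl c
      rw [mergeSum_cellChain]
      simp only [hψ]
      by_cases e : q = p
      · subst e
        simp only [dif_pos]
        exact congrFun hφ σ
      · simp only [dif_neg e]
        exact congrFun (map_zero ((factorizationComplex hl q).coboundary k m)) σ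
    obtain ⟨χ, hχ⟩ := h ψ h0
    cases m with
    | zero =>
      change φ = 0
      funext σ
      have := congrFun hχ (cellChain hl p hp a b hb 0 σ)
      rw [hψ, dif_pos rfl] at this
      rw [← this]
      rfl
    | succ m =>
      refine ⟨fun τ => χ (cellChain hl p hp a b hb m τ), ?_⟩
      funext σ
      rw [← mergeSum_cellChain, hχ, hψ, dif_pos rfl]
  · intro h φ hφ
    have h1 : ∀ (p : X ⟶ Y) (hb : b = a + l.len p),
        (fun τ => φ (cellChain hl p (by omega) a b hb m τ)) ∈
          (factorizationComplex hl p).coboundaries k m := by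
      intro p hb
      apply h p hb
      funext σ
      rw [← mergeSum_cellChain, hφ]
      rfl
    cases m with
    | zero =>
      -- `mergeSum` of any function on chains without morphisms is zero, as are the coboundaries at
      -- the empty cell; the claim is that `φ` vanishes.
      refine ⟨0, ?_⟩
      funext c
      obtain ⟨p, hp, hpb, σ, rfl⟩ := exists_cellChain_eq hl c
      exact (congrFun (h1 p hpb) σ).symm
    | succ m =>
      choose ψ hψ using h1
      refine ⟨fun c => ψ ((cellEquiv hl hab m).symm c).1.1 ((cellEquiv hl hab m).symm c).1.2
        ((cellEquiv hl hab m).symm c).2, ?_⟩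
      funext c
      obtain ⟨p, hp, hpb, σ, rfl⟩ := exists_cellChain_eq hl c
      rw [mergeSum_cellChain, ← congrFun (hψ p hpb) σ]
      refine congrFun (congrArg _ ?_) σ
      funext τ
      have h1 : (cellEquiv hl hab m).symm (cellChain hl p (by omega) a b hpb m τ) = ⟨⟨p, hpb⟩, τ⟩ :=
        (Equiv.symm_apply_eq _).2 rfl
      rw [h1]

end Augmented

end FactorizationChains

/-! ### Isomorphisms of semi-simplicial sets and almost discrete fibrations. -/

section Isomorphisms

namespace SemiSimplicialSet

variable {X : SemiSimplicialSet.{u}} {Y : SemiSimplicialSet.{u'}}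

/-- The bijections of the cells of the augmented complexes given by bijections of simplices. -/
def augEquiv (φ : ∀ n, X.simplices n ≃ Y.simplices n) : ∀ m, X.augSimplices m ≃ Y.augSimplices m
  | 0 => ⟨fun _ => PUnit.unit, fun _ => PUnit.unit, fun _ => rfl, fun _ => rfl⟩
  | n + 1 => φ n

variable (φ : ∀ n, X.simplices n ≃ Y.simplices n)
  (hφ : ∀ n (i : Fin (n + 2)) x, φ n (X.face i x) = Y.face i (φ (n + 1) x))

include hφ in
theorem augEquiv_augFace : ∀ (m : ℕ) (i : Fin (m + 1)) (x : X.augSimplices (m + 1)),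
    augEquiv φ m (X.augFace m i x) = Y.augFace m i (augEquiv φ (m + 1) x)
  | 0, _, _ => rfl
  | _ + 1, i, x => hφ _ i x

include hφ in
theorem coboundary_comp_augEquiv (k : Type w) [CommRing k] (m : ℕ) (ψ : Y.augSimplices m → k) :
    X.coboundary k m (ψ ∘ augEquiv φ m) = Y.coboundary k m ψ ∘ augEquiv φ (m + 1) := by
  funext x
  change ∑ i : Fin (m + 1), _ = ∑ i : Fin (m + 1), _
  refine Finset.sum_congr rfl fun i _ => ?_
  rw [← augEquiv_augFace φ hφ]
  rfl

include hφ in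
theorem subsingleton_reducedCohomology_of_equiv (k : Type w) [CommRing k] (m : ℕ)
    (h : Subsingleton (X.ReducedCohomology k m)) : Subsingleton (Y.ReducedCohomology k m) := by
  rw [subsingleton_reducedCohomology_iff] at h ⊢
  intro ψ hψ
  have h1 := h (ψ ∘ augEquiv φ m) (by rw [coboundary_comp_augEquiv φ hφ, hψ]; rfl)
  cases m with
  | zero =>
    change ψ = 0
    funext y
    exact congrFun (show ψ ∘ augEquiv φ 0 = 0 from h1) PUnit.unit
  | succ m =>
    obtain ⟨χ, hχ⟩ := h1
    refine ⟨χ ∘ (augEquiv φ m).symm, ?_⟩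
    have h2 := coboundary_comp_augEquiv φ hφ k m (χ ∘ (augEquiv φ m).symm)
    rw [Function.comp_assoc, Equiv.symm_comp_self, Function.comp_id, hχ] at h2
    funext y
    obtain ⟨x, rfl⟩ := (augEquiv φ (m + 1)).surjective y
    exact (congrFun h2 x).symm

include hφ in
theorem face_symm (n : ℕ) (i : Fin (n + 2)) (y : Y.simplices (n + 1)) :
    (φ n).symm (Y.face i y) = X.face i ((φ (n + 1)).symm y) := by
  rw [Equiv.symm_apply_eq, hφ, Equiv.apply_symm_apply]

include hφ in
theorem subsingleton_reducedCohomology_iff_of_equiv (k : Type w) [CommRing k] (m : ℕ) :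
    Subsingleton (X.ReducedCohomology k m) ↔ Subsingleton (Y.ReducedCohomology k m) :=
  ⟨subsingleton_reducedCohomology_of_equiv φ hφ k m,
    subsingleton_reducedCohomology_of_equiv (fun n => (φ n).symm) (face_symm φ hφ) k m⟩

include φ in
theorem dim_eq_of_equiv : X.dim = Y.dim := by
  unfold dim
  refine iSup_congr fun n => iSup_congr_Prop (φ n).nonempty_congr fun _ => rfl

include hφ in
theorem isBouquet_iff_of_equiv (k : Type w) [CommRing k] : X.IsBouquet k ↔ Y.IsBouquet k := by
  unfold IsBouquet
  rw [dim_eq_of_equiv φ]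
  exact forall_congr' fun m => imp_congr Iff.rfl
    (subsingleton_reducedCohomology_iff_of_equiv φ hφ k m)

end SemiSimplicialSet

variable {C : Type u} [Category.{v} C] {D : Type u'} [Category.{v'} D]
  {lC : CategoryGrading C} {lD : CategoryGrading D} (hC : lC.IsIndiscretelyBased)
  (hD : lD.IsIndiscretelyBased) (F : C ⥤ D)
  (hFl : ∀ ⦃X Y : C⦄ (f : X ⟶ Y), lD.len (F.map f) = lC.len f)

namespace NontrivialFactorization

variable {X Y : C} {p : X ⟶ Y}

include hC hFl in
theorem map_not_isIso {X Y : C} {f : X ⟶ Y} (hf : ¬ IsIso f) : ¬ IsIso (F.map f) :=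
  CategoryGrading.not_isIso_of_len_pos (l := lD) (by rw [hFl]; exact hC.len_pos hf)

/-- The image of a factorization. -/
def image {n : ℕ} (f : NontrivialFactorization p n) : NontrivialFactorization (F.map p) n where
  mid := f.mid ⋙ F
  first := F.map f.first
  last := F.map f.last
  fac := by
    have h := congrArg F.map f.fac
    rw [F.map_comp, F.map_comp] at h
    exact h
  first_not_isIso := map_not_isIso hC F hFl f.first_not_isIso
  last_not_isIso := map_not_isIso hC F hFl f.last_not_isIso
  mid_not_isIso i := map_not_isIso hC F hFl (f.mid_not_isIso i)

theorem image_equivalent {n : ℕ} {f g : NontrivialFactorization p n} (h : f.Equivalent g) :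
    (f.image hC F hFl).Equivalent (g.image hC F hFl) := by
  obtain ⟨e, h1, h2⟩ := h
  refine ⟨Functor.isoWhiskerRight e F, ?_, ?_⟩
  · exact (F.map_comp _ _).symm.trans (congrArg F.map h1)
  · exact (F.map_comp _ _).symm.trans (congrArg F.map h2)

theorem image_restrict {n m : ℕ} (α : Fin (m + 1) ↪o Fin (n + 1))
    (f : NontrivialFactorization p n) :
    ((f.restrict hC α).image hC F hFl).Equivalent ((f.image hC F hFl).restrict hD α) := by
  refine ⟨Iso.refl (α.monotone.functor ⋙ f.mid ⋙ F), ?_, ?_⟩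
  · exact (Category.comp_id _).trans (F.map_comp _ _)
  · exact (Category.id_comp _).trans (F.map_comp _ _).symm

end NontrivialFactorization

open NontrivialFactorization in
/-- An almost discrete fibration identifies the simplices of `C(p)` and `D(F p)`. -/
noncomputable def factorizationEquiv (hF : F.IsAlmostDiscreteFibration) {X Y : C} (p : X ⟶ Y)
    (n : ℕ) : (factorizationComplex hC p).simplices n ≃
      (factorizationComplex hD (F.map p)).simplices n :=
  Equiv.ofBijective (Quotient.map (image hC F hFl) fun _ _ h => image_equivalent hC F hFl h) (by
    constructor
    · intro x y h
      induction x using Quotient.inductionOn with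
      | h f =>
        induction y using Quotient.inductionOn with
        | h g =>
          -- `LiesOver` is equivalence with the image. Hence factorizations with equivalent images
          -- are lifts of one factorization, and uniqueness of lifts makes them equivalent.
          exact Quotient.sound ((hF p n (g.image hC F hFl)).2 f g (Quotient.exact h)
            ((equivalent_equivalence (F.map p) n).refl (g.image hC F hFl)))
    · intro y
      induction y using Quotient.inductionOn with
      | h g =>
        obtain ⟨f, hf⟩ := (hF p n g).1
        exact ⟨Quotient.mk _ f, Quotient.sound hf⟩)

theorem factorizationEquiv_toSimplex (hF : F.IsAlmostDiscreteFibration) {X Y : C} (p : X ⟶ Y)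
    (n : ℕ) (f : NontrivialFactorization p n) (g : NontrivialFactorization (F.map p) n)
    (h : f.LiesOver F g) :
    factorizationEquiv hC hD F hFl hF p n (f.toSimplex hC) = g.toSimplex hD :=
  Quotient.sound h

theorem factorizationEquiv_face (hF : F.IsAlmostDiscreteFibration) {X Y : C} (p : X ⟶ Y)
    (n : ℕ) (i : Fin (n + 2)) (x : (factorizationComplex hC p).simplices (n + 1)) :
    factorizationEquiv hC hD F hFl hF p n ((factorizationComplex hC p).face i x) =
      (factorizationComplex hD (F.map p)).face i (factorizationEquiv hC hD F hFl hF p (n + 1) x) := by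
  induction x using Quotient.inductionOn with
  | h f => exact Quotient.sound (NontrivialFactorization.image_restrict hC hD F hFl _ f)

/-- Equivalences of categories are almost discrete fibrations. -/
theorem CategoryTheory.Functor.isAlmostDiscreteFibration_of_isEquivalence [F.IsEquivalence] :
    F.IsAlmostDiscreteFibration := by
  intro X Y p n g
  obtain ⟨G, c, hc, hG⟩ : ∃ (G : D ⥤ C) (c : ∀ Z : D, F.obj (G.obj Z) ≅ Z),
      (∀ {Z W : D} (m : Z ⟶ W), F.map (G.map m) ≫ (c W).hom = (c Z).hom ≫ m) ∧
      G.ReflectsIsomorphisms :=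
    ⟨F.inv, fun Z => F.asEquivalence.counitIso.app Z,
      fun m => F.asEquivalence.counitIso.hom.naturality m, inferInstance⟩
  constructor
  -- Existence: the interior objects are lifted by the quasi-inverse `G`, and the outer morphisms by
  -- fullness after correction with the counit `c`.
  · obtain ⟨a, ha⟩ : ∃ a : X ⟶ G.obj (g.mid.obj 0), F.map a = g.first ≫ (c _).inv :=
      F.map_surjective _
    obtain ⟨b, hb⟩ : ∃ b : G.obj (g.mid.obj (Fin.last n)) ⟶ Y, F.map b = (c _).hom ≫ g.last :=
      F.map_surjective _
    have hc' : ∀ {Z W : D} (m : Z ⟶ W), (c Z).inv ≫ F.map (G.map m) = m ≫ (c W).inv := by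
      intro Z W m
      rw [Iso.inv_comp_eq, ← Category.assoc, ← hc, Category.assoc, Iso.hom_inv_id,
        Category.comp_id]
    refine ⟨{ mid := g.mid ⋙ G, first := a, last := b, fac := ?_, first_not_isIso := ?_,
              last_not_isIso := ?_, mid_not_isIso := ?_ }, ?_⟩
    · apply F.map_injective
      refine Eq.trans ?_ g.fac
      change F.map (a ≫ G.map _ ≫ b) = _
      rw [F.map_comp, F.map_comp, ha, hb, Category.assoc, reassoc_of% hc', Iso.inv_hom_id_assoc]
    · intro h
      apply g.first_not_isIso
      have h1 : g.first = F.map a ≫ (c _).hom := by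
        rw [ha, Category.assoc, Iso.inv_hom_id, Category.comp_id]
      rw [h1]
      infer_instance
    · intro h
      apply g.last_not_isIso
      have h1 : g.last = (c _).inv ≫ F.map b := by rw [hb, Iso.inv_hom_id_assoc]
      rw [h1]
      infer_instance
    · intro i h
      have h' : IsIso (G.map (g.mid.map (homOfLE i.castSucc_lt_succ.le))) := h
      exact g.mid_not_isIso i (isIso_of_reflects_iso (g.mid.map _) G)
    · refine ⟨NatIso.ofComponents (fun i => c (g.mid.obj i)) fun m => hc _, ?_, ?_⟩
      · change F.map a ≫ (c _).hom = _
        rw [ha, Category.assoc, Iso.inv_hom_id, Category.comp_id]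
      · exact hb.symm
  · rintro f f' ⟨e, h1, h2⟩ ⟨e', h1', h2'⟩
    -- Uniqueness: the two comparisons with `g` compose to isomorphisms between the images of the
    -- lifts, which come from `C` since `F` is fully faithful.
    obtain ⟨E, hE, hE1, hE2⟩ : ∃ E : ∀ i, F.obj (f.mid.obj i) ≅ F.obj (f'.mid.obj i),
        (∀ {i j} (m : i ⟶ j), F.map (f.mid.map m) ≫ (E j).hom =
          (E i).hom ≫ F.map (f'.mid.map m)) ∧
        F.map f.first ≫ (E 0).hom = F.map f'.first ∧
        (E (Fin.last n)).hom ≫ F.map f'.last = F.map f.last := by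
      refine ⟨fun i => (e.trans e'.symm).app i, fun m => (e.trans e'.symm).hom.naturality m, ?_, ?_⟩
      · change F.map f.first ≫ e.hom.app 0 ≫ e'.inv.app 0 = _
        rw [reassoc_of% h1, ← h1', Category.assoc, e'.hom_inv_id_app]
        exact Category.comp_id _
      · change (e.hom.app _ ≫ e'.inv.app _) ≫ _ = _
        rw [← h2', Category.assoc, ← h2, e'.inv_hom_id_app_assoc]
    refine ⟨NatIso.ofComponents (fun i => F.preimageIso (E i)) fun m => ?_, ?_, ?_⟩
    · apply F.map_injective
      rw [F.map_comp, F.map_comp, Functor.preimageIso_hom, Functor.preimageIso_hom,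
        F.map_preimage, F.map_preimage, hE]
    · apply F.map_injective
      change F.map (f.first ≫ (F.preimageIso (E 0)).hom) = _
      rw [F.map_comp, Functor.preimageIso_hom, F.map_preimage, hE1]
    · apply F.map_injective
      change F.map ((F.preimageIso (E (Fin.last n))).hom ≫ f'.last) = _
      rw [F.map_comp, Functor.preimageIso_hom, F.map_preimage, hE2]

end Isomorphisms

/-! ### Diagonal cohomology, bouquets and generation in degree one. -/

section Diagonal

variable {C : Type u} [Category.{v} C] {D : Type u'} [Category.{v'} D]

namespace CategoryGrading

/-- The reduced cohomology of `C(p)` is concentrated in degree `l(p) - 2`. -/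
def HasDiagonalCohomology {l : CategoryGrading C} (hl : l.IsIndiscretelyBased) (k : Type w)
    [CommRing k] : Prop :=
  -- Index `m` stands for degree `m - 1`, so the excepted degree `l(p) - 2` is `m + 1 = l(p)`.
  ∀ ⦃X Y : C⦄ (p : X ⟶ Y) (m : ℕ), 0 < l.len p → m + 1 ≠ l.len p →
    Subsingleton ((factorizationComplex hl p).ReducedCohomology k m)

section Fibration

variable {lC : CategoryGrading C} {lD : CategoryGrading D} (hC : lC.IsIndiscretelyBased)
  (hD : lD.IsIndiscretelyBased) (F : C ⥤ D)
  (hFl : ∀ ⦃X Y : C⦄ (f : X ⟶ Y), lD.len (F.map f) = lC.len f)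
  (hF : F.IsAlmostDiscreteFibration) (k : Type w) [CommRing k]

include hFl hF

-- This direction needs no surjectivity of `F` on morphisms, so it applies to both functors of the
-- equivalence between `C` and its skeleton.
variable {hC hD} in
theorem HasDiagonalCohomology.of_fibration (h : HasDiagonalCohomology hD k) :
    HasDiagonalCohomology hC k := by
  intro X Y p m h0 h1
  rw [SemiSimplicialSet.subsingleton_reducedCohomology_iff_of_equiv _
    (factorizationEquiv_face hC hD F hFl hF p)]
  exact h _ m (by rwa [hFl]) (by rwa [hFl])

theorem hasDiagonalCohomology_iff_of_fibration
    (hlift : ∀ q : Arrow D, ∃ p : Arrow C, F.mapArrow.obj p = q) :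
    HasDiagonalCohomology hC k ↔ HasDiagonalCohomology hD k := by
  refine ⟨fun h => ?_, fun h => h.of_fibration F hFl hF k⟩
  suffices key : ∀ (q : Arrow D) (m : ℕ), 0 < lD.len q.hom → m + 1 ≠ lD.len q.hom →
      Subsingleton ((factorizationComplex hD q.hom).ReducedCohomology k m) from
    fun X Y p => key (Arrow.mk p)
  intro q m h0 h1
  obtain ⟨p, rfl⟩ := hlift q
  refine (SemiSimplicialSet.subsingleton_reducedCohomology_iff_of_equiv _
    (factorizationEquiv_face hC hD F hFl hF p.hom) k m).1 (h p.hom m ?_ ?_)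
  · rw [← hFl]; exact h0
  · rw [← hFl]; exact h1

theorem isLocallyBouquet_iff_of_fibration
    (hlift : ∀ q : Arrow D, ∃ p : Arrow C, F.mapArrow.obj p = q) :
    IsLocallyBouquet hC k ↔ IsLocallyBouquet hD k := by
  have key : ∀ ⦃X Y : C⦄ (p : X ⟶ Y), (factorizationComplex hC p).IsBouquet k ↔
      (factorizationComplex hD (F.map p)).IsBouquet k := fun X Y p =>
    SemiSimplicialSet.isBouquet_iff_of_equiv _ (factorizationEquiv_face hC hD F hFl hF p) k
  refine ⟨fun h => ?_, fun h X Y p => (key p).2 (h _)⟩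
  suffices H : ∀ q : Arrow D, (factorizationComplex hD q.hom).IsBouquet k from
    fun X Y p => H (Arrow.mk p)
  intro q
  obtain ⟨p, rfl⟩ := hlift q
  exact (key p.hom).1 (h p.hom)

end Fibration

/-- The grading obtained by pulling back a grading along a functor. -/
def comap (l : CategoryGrading D) (F : C ⥤ D) : CategoryGrading C where
  len f := l.len (F.map f)
  len_id X := by rw [F.map_id, l.len_id]
  len_comp f g := by rw [F.map_comp, l.len_comp]

/-- The grading of the skeleton. -/
noncomputable abbrev skeleton (l : CategoryGrading C) : CategoryGrading (Skeleton C) :=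
  l.comap (fromSkeleton C)

theorem IsSkeletal.isIndiscretelyBased (l : CategoryGrading C) [l.IsSkeletal] :
    l.IsIndiscretelyBased := by
  intro X Y h
  have hXY : X = Y := by
    induction h with
    | rel _ _ h =>
      obtain ⟨f, hf⟩ := h
      exact (IsSkeletal.eq_eqToHom f hf).1
    | refl => rfl
    | symm _ _ _ ih => exact ih.symm
    | trans _ _ _ _ _ ih ih' => exact ih.trans ih'
  subst hXY
  refine ⟨𝟙 X, l.len_id X, fun f hf => ?_⟩
  obtain ⟨_, h⟩ := IsSkeletal.eq_eqToHom f hf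
  exact h

/-- A morphism of length zero is an isomorphism, so its ends coincide in the skeleton; by uniqueness
of morphisms of length zero it is the identity. -/
theorem IsIndiscretelyBased.isSkeletal_skeleton {l : CategoryGrading C}
    (hl : l.IsIndiscretelyBased) : l.skeleton.IsSkeletal where
  eq_eqToHom {X Y} f hf := by
    have h1 : IsIso ((fromSkeleton C).map f) := hl.isIso _ hf
    have h2 : IsIso f := isIso_of_reflects_iso f (fromSkeleton C)
    obtain rfl : X = Y := skeleton_skeletal C ⟨asIso f⟩
    refine ⟨rfl, (fromSkeleton C).map_injective ?_⟩
    exact (hl _ _ (.refl _)).unique hf (l.skeleton.len_id X)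

theorem len_toSkeletonFunctor_map (l : CategoryGrading C) {X Y : C} (f : X ⟶ Y) :
    l.skeleton.len ((toSkeletonFunctor C).map f) = l.len f := by
  change l.len ((fromSkeletonToSkeletonIso X).hom ≫ f ≫ (fromSkeletonToSkeletonIso Y).inv) = _
  rw [l.len_comp, l.len_comp, l.len_eq_zero_of_isIso (fromSkeletonToSkeletonIso X).hom,
    l.len_eq_zero_of_isIso (fromSkeletonToSkeletonIso Y).inv, zero_add, add_zero]

theorem hasDiagonalCohomology_skeleton_iff {l : CategoryGrading C} (hl : l.IsIndiscretelyBased)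
    (hl' : l.skeleton.IsIndiscretelyBased) (k : Type w) [CommRing k] :
    HasDiagonalCohomology hl' k ↔ HasDiagonalCohomology hl k := by
  have h1 : (toSkeletonFunctor C).IsEquivalence := (skeletonEquivalence C).isEquivalence_inverse
  exact ⟨fun h => h.of_fibration (toSkeletonFunctor C)
      (fun X Y f => l.len_toSkeletonFunctor_map f)
      (Functor.isAlmostDiscreteFibration_of_isEquivalence _) k,
    fun h => h.of_fibration (fromSkeleton C) (fun X Y f => rfl)
      (Functor.isAlmostDiscreteFibration_of_isEquivalence _) k⟩

/-- The starting object is normalised to degree zero, so `y.deg` is the length of the composites and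
`i = m + 1` is the number of morphisms of a chain. -/
theorem hasDiagonalCohomology_iff_chainExact {l : CategoryGrading C} [l.IsSkeletal]
    (hl : l.IsIndiscretelyBased) (k : Type w) [Field k] :
    HasDiagonalCohomology hl k ↔ ∀ (x y : GradedObj l) (i : ℕ), x.deg = 0 → y.deg ≠ i →
      CatRep.ChainExact k i x y := by
  constructor
  · rintro h ⟨X, a⟩ ⟨Y, b⟩ i (rfl : a = 0) (hi : b ≠ i)
    cases i with
    | zero =>
      intro φ _
      funext c
      cases c
      exact absurd rfl hi
    | succ m =>
      by_cases hb : 0 < b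
      · rw [chainExact_iff hl k hb]
        intro p hp
        refine h p m (by omega) fun h => hi ?_
        rw [hp, ← h, zero_add]
      -- If `b ≤ 0` there are no chains with at least one morphism.
      · intro φ _
        refine ⟨0, ?_⟩
        funext c
        exact absurd c.deg_lt hb
  · intro h X Y p m h0 h1
    refine (chainExact_iff hl k (a := 0) (b := l.len p) (by omega) m).1
      (h _ _ (m + 1) rfl ?_) p (zero_add _).symm
    change (l.len p : ℤ) ≠ _
    omega

theorem length_mid_le {l : CategoryGrading C} (hl : l.IsIndiscretelyBased) {X Y : C} {p : X ⟶ Y}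
    {n : ℕ} (f : NontrivialFactorization p n) : ∀ (i : ℕ) (h : i < n + 1),
    i + 1 ≤ l.len (f.first ≫ f.mid.map (homOfLE (Fin.zero_le (⟨i, h⟩ : Fin (n + 1)))))
  | 0, h => by
    have := hl.len_pos f.first_not_isIso
    rw [l.len_comp]
    omega
  | i + 1, h => by
    have ih := length_mid_le hl f i (by omega)
    have h1 := hl.len_pos (f.mid_not_isIso ⟨i, by omega⟩)
    have h2 : f.mid.map (homOfLE (Fin.zero_le (⟨i + 1, h⟩ : Fin (n + 1)))) =
        f.mid.map (homOfLE (Fin.zero_le (⟨i, by omega⟩ : Fin (n + 1)))) ≫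
          f.mid.map (homOfLE (Fin.castSucc_lt_succ (i := (⟨i, by omega⟩ : Fin n))).le) := by
      rw [← f.mid.map_comp]
      rfl
    rw [h2, ← Category.assoc, l.len_comp]
    omega

/-- Each of the `n + 2` morphisms has length at least one. This bounds the dimension of `C(p)` by
`l(p) - 2`. -/
theorem add_two_le_len {l : CategoryGrading C} (hl : l.IsIndiscretelyBased) {X Y : C} {p : X ⟶ Y}
    {n : ℕ} (h : Nonempty ((factorizationComplex hl p).simplices n)) : n + 2 ≤ l.len p := by
  obtain ⟨x⟩ := h
  induction x using Quotient.inductionOn with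
  | h f =>
    have h1 := length_mid_le hl f n (Nat.lt_succ_self n)
    have h2 := hl.len_pos f.last_not_isIso
    have h3 := congrArg l.len f.fac
    rw [← Category.assoc, l.len_comp] at h3
    have h4 : n + 1 + l.len f.last ≤ _ := Nat.add_le_add_right h1 _
    have h5 := h4.trans_eq h3
    omega

theorem IsCompOfLengthOne.map {lC : CategoryGrading C} {lD : CategoryGrading D} (F : C ⥤ D)
    (hFl : ∀ ⦃X Y : C⦄ (f : X ⟶ Y), lD.len (F.map f) = lC.len f) {X Y : C} {p : X ⟶ Y}
    (h : lC.IsCompOfLengthOne p) : lD.IsCompOfLengthOne (F.map p) := by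
  induction h with
  | of f h => exact .of _ (by rwa [hFl])
  | comp f g _ _ ih ih' =>
    rw [F.map_comp]
    exact .comp _ _ ih ih'

theorem _root_.DegreeChain.exists_append {E : Type u} [Category.{v} E] [DegreeCategory E] :
    ∀ {n m : ℕ} {x z y : E} (c : DegreeChain n x z) (c' : DegreeChain m z y),
    ∃ (N : ℕ) (_ : N = n + m) (c'' : DegreeChain N x y), c''.comp = c.comp ≫ c'.comp
  | _, m, _, _, _, .nil _, c' => ⟨m, (zero_add m).symm, c', (Category.id_comp _).symm⟩
  | _, _, _, _, _, .cons f h c, c' => by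
    obtain ⟨N, hN, c'', h''⟩ := c.exists_append c'
    refine ⟨N + 1, by omega, .cons f h c'', ?_⟩
    change f ≫ c''.comp = (f ≫ c.comp) ≫ _
    rw [h'', Category.assoc]

theorem IsCompOfLengthOne.exists_chain {l : CategoryGrading C} [l.IsSkeletal] {X Y : C}
    {p : X ⟶ Y} (h : l.IsCompOfLengthOne p) : ∀ (a b : ℤ), b = a + l.len p →
    ∃ (N : ℕ) (_ : N = l.len p) (c : DegreeChain N (⟨X, a⟩ : GradedObj l) ⟨Y, b⟩),
      c.comp.1 = p := by
  induction h with
  | @of X Y f h =>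
    intro a b hab
    refine ⟨1, h.symm, .cons (z := ⟨Y, b⟩) (GradedObj.homMk _ _ f hab)
      (show a < b by omega) (.nil _), Category.comp_id _⟩
  | comp f g _ _ ih ih' =>
    intro a b hab
    rw [l.len_comp] at hab
    obtain ⟨n, hn, c, hc⟩ := ih a (a + l.len f) rfl
    obtain ⟨n', hn', c', hc'⟩ := ih' (a + l.len f) b (by push_cast at hab; omega)
    obtain ⟨N, hN, c'', h''⟩ := c.exists_append c'
    refine ⟨N, by rw [l.len_comp]; omega, c'', ?_⟩
    rw [h'', GradedObj.comp_val, hc, hc']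

/-- The `l(p)` morphisms of length one form a chain with composite `p`, which is a simplex of the
top dimension `l(p) - 2`. -/
theorem IsCompOfLengthOne.nonempty_simplices_of_isSkeletal {l : CategoryGrading C} [l.IsSkeletal]
    (hl : l.IsIndiscretelyBased) {X Y : C} {p : X ⟶ Y} (h : l.IsCompOfLengthOne p) {n : ℕ}
    (hn : n + 2 = l.len p) : Nonempty ((factorizationComplex hl p).simplices n) := by
  obtain ⟨N, hN, c, hc⟩ := h.exists_chain 0 (l.len p) (zero_add _).symm
  obtain rfl : N = n + 2 := hN.trans hn.symm
  obtain ⟨q, hq, hb, σ, rfl⟩ := exists_cellChain_eq hl c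
  obtain rfl : q = p := (comp_cellChain hl q hq _ _ hb _ σ).symm.trans hc
  exact ⟨σ⟩

theorem IsCompOfLengthOne.nonempty_simplices {l : CategoryGrading C}
    (hl : l.IsIndiscretelyBased) {X Y : C} {p : X ⟶ Y} (h : l.IsCompOfLengthOne p) {n : ℕ}
    (hn : n + 2 = l.len p) : Nonempty ((factorizationComplex hl p).simplices n) := by
  have := hl.isSkeletal_skeleton
  have h1 : (toSkeletonFunctor C).IsEquivalence := (skeletonEquivalence C).isEquivalence_inverse
  have hF : ∀ ⦃X Y : C⦄ (f : X ⟶ Y), l.skeleton.len ((toSkeletonFunctor C).map f) = l.len f :=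
    fun X Y f => l.len_toSkeletonFunctor_map f
  obtain ⟨σ⟩ := (h.map (toSkeletonFunctor C) hF).nonempty_simplices_of_isSkeletal
    (IsSkeletal.isIndiscretelyBased _) (n := n) (by rw [hF, hn])
  exact ⟨(factorizationEquiv hl _ (toSkeletonFunctor C) hF
    (Functor.isAlmostDiscreteFibration_of_isEquivalence _) p n).symm σ⟩

end CategoryGrading

/-- The supremum may be infinite, so only a simplex of some dimension at least `m` can be asked for;
for `m = 0` one has to exclude `dim = ⊥`. -/
theorem SemiSimplicialSet.exists_le_of_le_dim {S : SemiSimplicialSet.{u}} {m : ℕ}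
    (h : (m : WithBot ℕ∞) ≤ S.dim) : ∃ n, m ≤ n ∧ Nonempty (S.simplices n) := by
  by_contra! H
  cases m with
  | zero =>
    have h1 : S.dim ≤ ⊥ := iSup₂_le fun n hn => (not_isEmpty_iff.2 hn (H n (Nat.zero_le n))).elim
    exact absurd (h.trans h1) (by simp)
  | succ m =>
    have h1 : S.dim ≤ (m : WithBot ℕ∞) := iSup₂_le fun n hn => by
      have : ¬ m + 1 ≤ n := fun h => not_isEmpty_iff.2 hn (H n h)
      exact_mod_cast (by omega : n ≤ m)
    have h2 := h.trans h1
    have h3 : m + 1 ≤ m := by exact_mod_cast h2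
    omega

theorem SemiSimplicialSet.le_dim {S : SemiSimplicialSet.{u}} {n : ℕ}
    (h : Nonempty (S.simplices n)) : (n : WithBot ℕ∞) ≤ S.dim :=
  le_iSup₂_of_le n h le_rfl

namespace CategoryGrading

variable {l : CategoryGrading C} (hl : l.IsIndiscretelyBased) (k : Type w) [CommRing k]

variable {hl k}

/-- From `m ≤ dim C(p) ≤ l(p) - 2` one gets `m + 1 < l(p)`, which is off the diagonal. -/
theorem HasDiagonalCohomology.isLocallyBouquet (h : HasDiagonalCohomology hl k) :
    IsLocallyBouquet hl k := by
  intro X Y p m hm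
  obtain ⟨n, hn, hs⟩ := SemiSimplicialSet.exists_le_of_le_dim hm
  have := add_two_le_len hl hs
  exact h p m (by omega) (by omega)

/-- If `l(f) ≥ 2`, the reduced cohomology of `C(f)` in degree `-1` vanishes, so `C(f)` is nonempty.
A vertex factors `f` into two shorter morphisms of positive length, and induction on the length
applies. -/
theorem HasDiagonalCohomology.isGeneratedInDegreeOne [Nontrivial k]
    (h : HasDiagonalCohomology hl k) : l.IsGeneratedInDegreeOne := by
  suffices key : ∀ (n : ℕ) ⦃X Y : C⦄ (f : X ⟶ Y), l.len f = n → 0 < n →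
      l.IsCompOfLengthOne f from fun X Y f hf => key _ f rfl hf
  intro n
  induction n using Nat.strong_induction_on with
  | _ n ih =>
  intro X Y f hf hn
  by_cases h1 : n = 1
  · exact .of f (hf.trans h1)
  have h2 : Nonempty ((factorizationComplex hl f).simplices 0) := by
    by_contra hne
    -- Without vertices, the constant function 1 on the empty cell is a nonzero cocycle, and there
    -- are no coboundaries at index zero.
    have h3 := (SemiSimplicialSet.subsingleton_reducedCohomology_iff _ k 0).1
      (h f 0 (by omega) (by omega)) (fun _ => 1)
      (funext fun x => (hne ⟨x⟩).elim)
    have h4 : (fun _ => 1 : (factorizationComplex hl f).augSimplices 0 → k) = 0 := h3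
    exact one_ne_zero (congrFun h4 PUnit.unit)
  obtain ⟨x⟩ := h2
  induction x using Quotient.inductionOn with
  | h g =>
    have h3 := hl.len_pos g.first_not_isIso
    have h4 := hl.len_pos g.last_not_isIso
    have h5 := congrArg l.len g.fac
    rw [l.len_comp] at h5
    have h6 : l.len g.last ≤ l.len (g.mid.map (homOfLE (Fin.zero_le (Fin.last 0))) ≫ g.last) := by
      rw [l.len_comp]
      omega
    rw [← g.fac]
    refine .comp _ _ (ih _ ?_ _ rfl h3) (ih _ ?_ _ rfl (h4.trans_le h6)) <;> omega

/-- Generation in degree one provides a simplex of dimension `l(p) - 2`, so bouquet covers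
everything below the diagonal. -/
theorem IsLocallyBouquet.hasDiagonalCohomology (h : IsLocallyBouquet hl k)
    (h1 : l.IsGeneratedInDegreeOne) : HasDiagonalCohomology hl k := by
  intro X Y p m hp hm
  by_cases hlt : m + 1 < l.len p
  · obtain ⟨n, hn⟩ : ∃ n, n + 2 = l.len p := ⟨l.len p - 2, by omega⟩
    refine h p m (le_trans ?_ (SemiSimplicialSet.le_dim ((h1 p hp).nonempty_simplices hl hn)))
    exact_mod_cast (by omega : m ≤ n)
  -- Above the diagonal there are no simplices, by `add_two_le_len`.
  · rw [SemiSimplicialSet.subsingleton_reducedCohomology_iff]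
    intro φ _
    cases m with
    | zero => omega
    | succ m =>
      have : φ = 0 := funext fun x => by
        have := add_two_le_len hl ⟨x⟩
        omega
      rw [this]
      exact Submodule.zero_mem _

end CategoryGrading

end Diagonal

/-! ### Graded modules over the category algebra as representations of the skeleton. -/

section CategoryModules

namespace CategoryAlgebra

variable (k : Type w) [CommRing k] {C : Type u} [Category.{v} C]

/-- A morphism as an element of the unitization of the category algebra. -/
noncomputable def arrow {X Y : C} (f : X ⟶ Y) : Unitization k (CategoryAlgebra k C) :=
  (basis k (Arrow.mk f) : CategoryAlgebra k C)

theorem arrow_mul {X Y Z : C} (f : X ⟶ Y) (g : Y ⟶ Z) :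
    arrow k g * arrow k f = arrow k (f ≫ g) := by
  rw [arrow, arrow, arrow, ← Unitization.inr_mul, basis_mul_basis, basisMul_of_comp]

theorem arrow_mul_of_ne {X Y Z W : C} (f : X ⟶ Y) (g : Z ⟶ W) (h : Y ≠ Z) :
    arrow k g * arrow k f = 0 := by
  rw [arrow, arrow, ← Unitization.inr_mul, basis_mul_basis, basisMul_of_ne k f g h,
    Unitization.inr_zero]

theorem induction_basis {p : CategoryAlgebra k C → Prop} (a : CategoryAlgebra k C) (zero : p 0)
    (add : ∀ a b, p a → p b → p (a + b))
    (smul : ∀ (r : k) (X Y : C) (f : X ⟶ Y), p (r • basis k (Arrow.mk f))) : p a := by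
  refine Finsupp.induction_linear a zero (fun f g hf hg => add f g hf hg) fun α r => ?_
  have h : (Finsupp.single α r : CategoryAlgebra k C) = r • basis k α :=
    ((Finsupp.smul_single r α (1 : k)).trans (congrArg _ (mul_one r))).symm
  rw [h]
  exact smul r _ _ α.hom

end CategoryAlgebra

open CategoryAlgebra

/-- A graded left module over a category algebra. -/
structure GradedCatModule {C : Type u} [Category.{v} C] (l : CategoryGrading C) (k : Type w)
    [Field k] where
  carrier : Type u'
  [addCommGroup : AddCommGroup carrier]
  [moduleBase : Module k carrier]
  [module : Module (Unitization k (CategoryAlgebra k C)) carrier]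
  [isScalarTower : IsScalarTower k (Unitization k (CategoryAlgebra k C)) carrier]
  piece : ℤ → Submodule k carrier
  isInternal : DirectSum.IsInternal piece
  arrow_smul_mem : ∀ {X Y : C} (f : X ⟶ Y) (n : ℤ) (v : carrier), v ∈ piece n →
    arrow k f • v ∈ piece (n + l.len f)

namespace GradedCatModule

attribute [instance] addCommGroup moduleBase module isScalarTower

variable {C : Type u} [Category.{v} C] {l : CategoryGrading C} {k : Type w} [Field k]
  (N : GradedCatModule.{u, v, w, u'} l k)

instance : SMulCommClass (Unitization k (CategoryAlgebra k C)) k N.carrier :=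
  IsScalarTower.to_smulCommClass'

noncomputable instance : DirectSum.Decomposition N.piece := N.isInternal.chooseDecomposition

/-- The projection to a homogeneous component. -/
noncomputable def proj (n : ℤ) : N.carrier →ₗ[k] N.carrier :=
  (N.piece n).subtype ∘ₗ DirectSum.component k ℤ _ n ∘ₗ
    (DirectSum.decomposeLinearEquiv N.piece).toLinearMap

theorem proj_apply (n : ℤ) (v : N.carrier) : N.proj n v = DirectSum.decompose N.piece v n := rfl

theorem proj_mem (n : ℤ) (v : N.carrier) : N.proj n v ∈ N.piece n := Subtype.mem _

theorem proj_of_mem {n : ℤ} {v : N.carrier} (h : v ∈ N.piece n) : N.proj n v = v :=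
  DirectSum.decompose_of_mem_same _ h

theorem proj_of_mem_ne {m n : ℤ} {v : N.carrier} (h : v ∈ N.piece m) (hmn : m ≠ n) :
    N.proj n v = 0 :=
  DirectSum.decompose_of_mem_ne _ h hmn

theorem induction_homogeneous {p : N.carrier → Prop} (v : N.carrier) (zero : p 0)
    (add : ∀ v w, p v → p w → p (v + w)) (homogeneous : ∀ n, ∀ v ∈ N.piece n, p v) : p v :=
  DirectSum.Decomposition.inductionOn N.piece zero (fun v => homogeneous _ v.1 v.2) add v

/-- The homogeneous elements on which the identity of an object acts as the identity. -/
def component (X : C) (n : ℤ) : Submodule k N.carrier where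
  carrier := {v | v ∈ N.piece n ∧ arrow k (𝟙 X) • v = v}
  add_mem' := fun ⟨h1, h2⟩ ⟨h1', h2'⟩ => ⟨add_mem h1 h1', by rw [smul_add, h2, h2']⟩
  zero_mem' := ⟨zero_mem _, smul_zero _⟩
  smul_mem' c v := fun ⟨h1, h2⟩ => ⟨Submodule.smul_mem _ c h1, by rw [smul_comm, h2]⟩

theorem arrow_smul_mem_component {X Y : C} (f : X ⟶ Y) {n m : ℤ} (h : m = n + l.len f)
    {v : N.carrier} (hv : v ∈ N.piece n) : arrow k f • v ∈ N.component Y m := by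
  refine ⟨h ▸ N.arrow_smul_mem f n v hv, ?_⟩
  rw [← mul_smul, arrow_mul, Category.comp_id]

theorem arrow_smul_smul {X Y Z : C} (f : X ⟶ Y) (g : Y ⟶ Z) (v : N.carrier) :
    arrow k g • arrow k f • v = arrow k (f ≫ g) • v := by
  rw [← mul_smul, arrow_mul]

/-- The multiplication by a morphism. -/
noncomputable def act {X Y : C} (f : X ⟶ Y) {n m : ℤ} (h : m = n + l.len f) :
    N.component X n →ₗ[k] N.component Y m where
  toFun v := ⟨arrow k f • v.1, N.arrow_smul_mem_component f h v.2.1⟩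
  map_add' _ _ := Subtype.ext (smul_add _ _ _)
  map_smul' _ _ := Subtype.ext (smul_comm _ _ _)

/-- The representation of the skeleton given by a graded module. -/
noncomputable def rep : CatRep.{u, v, w, u'} k (GradedObj l.skeleton) where
  obj x := N.component ((fromSkeleton C).obj x.obj) x.deg
  map {x y} f := N.act ((fromSkeleton C).map f.1) f.2
  map_id x := LinearMap.ext fun v => Subtype.ext (by
    change arrow k ((fromSkeleton C).map (𝟙 x.obj)) • v.1 = v.1
    rw [(fromSkeleton C).map_id]
    exact v.2.2)
  map_comp f g := LinearMap.ext fun v => Subtype.ext (by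
    change arrow k ((fromSkeleton C).map (f.1 ≫ g.1)) • v.1 = arrow k _ • arrow k _ • v.1
    rw [(fromSkeleton C).map_comp, arrow_smul_smul])

theorem rep_map_coe {x y : GradedObj l.skeleton} (f : x ⟶ y) (m : N.rep.obj x) :
    (N.rep.map f m).1 = arrow k ((fromSkeleton C).map f.1) • m.1 := rfl

/-- The morphism of the skeleton given by a morphism to an object of the skeleton. -/
noncomputable def skeletonArrow {X : C} (x : GradedObj l.skeleton)
    (f : X ⟶ (fromSkeleton C).obj x.obj) (d : ℤ) (h : x.deg = d + l.len f) :
    (⟨toSkeleton X, d⟩ : GradedObj l.skeleton) ⟶ x :=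
  ⟨(fromSkeleton C).preimage ((fromSkeletonToSkeletonIso X).hom ≫ f), by
    change x.deg = d + l.len ((fromSkeleton C).map _)
    rw [(fromSkeleton C).map_preimage, l.len_comp, l.len_eq_zero_of_isIso (fromSkeletonToSkeletonIso X).hom,
      zero_add, h]⟩

/-- The element of the representation given by a homogeneous element. -/
noncomputable def repMk (X : C) (d : ℤ) (v : N.carrier) (hv : v ∈ N.piece d) :
    N.rep.obj ⟨toSkeleton X, d⟩ :=
  ⟨arrow k (fromSkeletonToSkeletonIso X).inv • v, N.arrow_smul_mem_component _ (by
    rw [l.len_eq_zero_of_isIso]; simp) hv⟩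

theorem repMk_coe (X : C) (d : ℤ) (v : N.carrier) (hv : v ∈ N.piece d) :
    (N.repMk X d v hv).1 = arrow k (fromSkeletonToSkeletonIso X).inv • v := rfl

theorem rep_map_repMk {X : C} (x : GradedObj l.skeleton)
    (f : X ⟶ (fromSkeleton C).obj x.obj) (d : ℤ) (h : x.deg = d + l.len f) (v : N.carrier)
    (hv : v ∈ N.piece d) :
    (N.rep.map (skeletonArrow x f d h) (N.repMk X d v hv)).1 = arrow k f • v := by
  rw [rep_map_coe, repMk_coe, arrow_smul_smul, skeletonArrow, (fromSkeleton C).map_preimage,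
    Iso.inv_hom_id_assoc]

variable {N} {N' : GradedCatModule.{u, v, w, v'} l k}

/-- The projection of a graded module to a component of its representation. -/
noncomputable def repProj (N : GradedCatModule.{u, v, w, u'} l k) (x : GradedObj l.skeleton) :
    N.carrier →ₗ[k] N.rep.obj x where
  toFun v := ⟨arrow k (𝟙 _) • N.proj x.deg v, N.arrow_smul_mem_component _
    (by rw [l.len_id]; simp) (N.proj_mem _ _)⟩
  map_add' v w := Subtype.ext (by
    change arrow k (𝟙 _) • N.proj x.deg (v + w) =
      arrow k (𝟙 _) • N.proj x.deg v + arrow k (𝟙 _) • N.proj x.deg w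
    rw [map_add, smul_add])
  map_smul' c v := Subtype.ext (by
    change arrow k (𝟙 _) • N.proj x.deg (c • v) = c • arrow k (𝟙 _) • N.proj x.deg v
    rw [map_smul, smul_comm])

theorem repProj_coe (x : GradedObj l.skeleton) (v : N.carrier) :
    (N.repProj x v).1 = arrow k (𝟙 ((fromSkeleton C).obj x.obj)) • N.proj x.deg v := rfl

theorem repProj_self (x : GradedObj l.skeleton) (v : N.rep.obj x) : N.repProj x v.1 = v :=
  Subtype.ext (by rw [repProj_coe, N.proj_of_mem v.2.1]; exact v.2.2)

/-- Homomorphisms of graded modules. -/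
structure Hom (N : GradedCatModule.{u, v, w, u'} l k) (N' : GradedCatModule.{u, v, w, v'} l k) where
  toLinear : N.carrier →ₗ[Unitization k (CategoryAlgebra k C)] N'.carrier
  map_mem : ∀ {n : ℤ} {v : N.carrier}, v ∈ N.piece n → toLinear v ∈ N'.piece n

theorem Hom.map_smul_base (f : Hom N N') (c : k) (v : N.carrier) :
    f.toLinear (c • v) = c • f.toLinear v := LinearMap.map_smul_of_tower _ _ _

theorem Hom.proj_apply (f : Hom N N') (n : ℤ) (v : N.carrier) :
    N'.proj n (f.toLinear v) = f.toLinear (N.proj n v) := by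
  induction v using N.induction_homogeneous with
  | zero => simp
  | add v w hv hw => simp only [map_add, hv, hw]
  | homogeneous m v hv =>
    by_cases h : m = n
    · subst h
      rw [N.proj_of_mem hv, N'.proj_of_mem (f.map_mem hv)]
    · rw [N.proj_of_mem_ne hv h, N'.proj_of_mem_ne (f.map_mem hv) h, map_zero]

/-- The map of representations given by a homomorphism of graded modules. -/
noncomputable def Hom.rep (f : Hom N N') : CatRep.Hom N.rep N'.rep where
  app x :=
    { toFun := fun v => ⟨f.toLinear v.1, f.map_mem v.2.1, by rw [← map_smul, v.2.2]⟩
      map_add' := fun v w => Subtype.ext (map_add _ _ _)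
      map_smul' := fun c v => Subtype.ext (f.map_smul_base c _) }
  naturality g m := Subtype.ext (map_smul _ _ _)

/-- An arbitrary preimage can be replaced by its projection to the component of `x`, because `f`
commutes with these projections. So surjectivity and exactness pass to representations. -/
theorem Hom.exists_rep_app_eq (f : Hom N N') (x : GradedObj l.skeleton) (w : N'.rep.obj x)
    (h : w.1 ∈ Set.range f.toLinear) : ∃ v, f.rep.app x v = w := by
  obtain ⟨v, hv⟩ := h
  refine ⟨N.repProj x v, Subtype.ext ?_⟩
  change f.toLinear (arrow k (𝟙 _) • N.proj x.deg v) = w.1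
  rw [map_smul, ← f.proj_apply, hv, N'.proj_of_mem w.2.1]
  exact w.2.2

theorem Hom.rep_surjective (f : Hom N N') (h : Function.Surjective f.toLinear)
    (x : GradedObj l.skeleton) : Function.Surjective (f.rep.app x) :=
  fun w => f.exists_rep_app_eq x w (h w.1)

theorem Hom.rep_injective (f : Hom N N') (h : Function.Injective f.toLinear)
    (x : GradedObj l.skeleton) : Function.Injective (f.rep.app x) :=
  fun _ _ e => Subtype.ext (h (congrArg Subtype.val e))

universe w'

theorem Hom.rep_exact {N'' : GradedCatModule.{u, v, w, w'} l k} (f : Hom N N') (g : Hom N' N'')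
    (h : Function.Exact f.toLinear g.toLinear) (x : GradedObj l.skeleton) :
    Function.Exact (f.rep.app x) (g.rep.app x) := by
  intro w
  constructor
  · intro hw
    exact f.exists_rep_app_eq x w ((h w.1).1 (congrArg Subtype.val hw))
  · rintro ⟨v, rfl⟩
    exact Subtype.ext (h.apply_apply_eq_zero v.1)

theorem arrow_smul_of_eq {X Y Z : C} (f : X ⟶ Y) (v : N.carrier) (h : Y = Z) :
    arrow k (𝟙 Z) • arrow k f • v = arrow k f • v := by
  subst h
  rw [arrow_smul_smul, Category.comp_id]

theorem arrow_smul_of_ne {X Y Z : C} (f : X ⟶ Y) (v : N.carrier) (h : Y ≠ Z) :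
    arrow k (𝟙 Z) • arrow k f • v = 0 := by
  rw [← mul_smul, arrow_mul_of_ne k f _ h, zero_smul]

theorem inr_smul_basis (r : k) {X Y : C} (f : X ⟶ Y) (v : N.carrier) :
    ((r • basis k (Arrow.mk f) : CategoryAlgebra k C) : Unitization k (CategoryAlgebra k C)) • v =
      r • arrow k f • v := by
  rw [Unitization.inr_smul, smul_assoc]
  rfl

/-- A module that is generated in degree `i` has no generators in other degrees. -/
theorem vanishes_zero_of_generated [l.skeleton.IsSkeletal] {i : ℤ}
    (h : ∀ x : N.carrier, x ∈ AddSubgroup.closure {z | ∃ (a : CategoryAlgebra k C) (y : N.carrier),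
      y ∈ N.piece i ∧ z = (a : Unitization k (CategoryAlgebra k C)) • y})
    {y : GradedObj l.skeleton} (hy : y.deg ≠ i) : N.rep.Vanishes 0 y := by
  rw [CatRep.vanishes_zero_iff, eq_top_iff]
  intro m _
  set S := Submodule.span k {m | ∃ (x : GradedObj l.skeleton) (f : x ⟶ y)
    (_ : DegreeCategory.deg x < DegreeCategory.deg y) (m' : N.rep.obj x), m = N.rep.map f m'}
    with hS
  rw [← repProj_self y m]
  change m.1 ∈ S.comap (N.repProj y)
  refine (AddSubgroup.closure_le (S.comap (N.repProj y)).toAddSubgroup).2 ?_ (h m.1)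
  rintro _ ⟨a, p, hp, rfl⟩
  change _ ∈ S.comap (N.repProj y)
  induction a using induction_basis k with
  | zero => rw [Unitization.inr_zero, zero_smul]; exact zero_mem _
  | add a b ha hb => rw [Unitization.inr_add, add_smul]; exact add_mem ha hb
  | smul r X Y f =>
    rw [inr_smul_basis]
    refine Submodule.smul_mem _ r ?_
    have hf := N.arrow_smul_mem f i p hp
    rw [Submodule.mem_comap]
    by_cases hd : i + l.len f = y.deg
    · rw [hd] at hf
      by_cases hY : Y = (fromSkeleton C).obj y.obj
      · subst hY
        -- The generator lives in degree `i ≠ y.deg`, so the morphism that carries it to `y` has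
        -- positive length.
        refine Submodule.subset_span ⟨⟨toSkeleton X, i⟩, skeletonArrow y f i hd.symm, ?_,
          N.repMk X i p hp, Subtype.ext ?_⟩
        · change i < y.deg
          omega
        · rw [rep_map_repMk, repProj_coe, N.proj_of_mem hf, arrow_smul_of_eq f p rfl]
      · have : N.repProj y (arrow k f • p) = 0 := Subtype.ext (by
          rw [repProj_coe, N.proj_of_mem hf, arrow_smul_of_ne f p hY]; rfl)
        rw [this]
        exact zero_mem _
    · have : N.repProj y (arrow k f • p) = 0 := Subtype.ext (by
        rw [repProj_coe, N.proj_of_mem_ne hf hd, smul_zero]; rfl)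
      rw [this]
      exact zero_mem _

end GradedCatModule

end CategoryModules

/-! ### Projective modules have natural splittings. -/

section ProjectiveModules

open scoped Classical DirectSum

open CategoryAlgebra

namespace GradedCatModule

variable {C : Type u} [Category.{v} C] {l : CategoryGrading C} {k : Type w} [Field k]
  (N : GradedCatModule.{u, v, w, u'} l k)

theorem proj_arrow_smul {X Y : C} (f : X ⟶ Y) {n d : ℤ} (h : n = d + l.len f) (v : N.carrier) :
    N.proj n (arrow k f • v) = arrow k f • N.proj d v := by
  induction v using N.induction_homogeneous with
  | zero => simp
  | add v w hv hw => simp only [smul_add, map_add, hv, hw]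
  | homogeneous m v hv =>
    have hf := N.arrow_smul_mem f m v hv
    by_cases hm : m = d
    · subst hm
      rw [N.proj_of_mem hv, N.proj_of_mem (h ▸ hf)]
    · rw [N.proj_of_mem_ne hv hm, N.proj_of_mem_ne hf (by omega), smul_zero]

/-- The element of the induced representation given by a morphism and an element of the module. -/
noncomputable def inducedTerm (x : GradedObj l.skeleton) (v : N.carrier) (α : Arrow C) :
    ⨁ g : (Σ z, z ⟶ x), N.rep.obj g.1 :=
  if h : α.right = (fromSkeleton C).obj x.obj then
    DirectSum.lof k (Σ z, z ⟶ x) (fun g => N.rep.obj g.1)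
      ⟨⟨toSkeleton α.left, x.deg - l.len (α.hom ≫ eqToHom h)⟩,
        skeletonArrow x (α.hom ≫ eqToHom h) _ (by omega)⟩
      (N.repMk α.left _ (N.proj _ v) (N.proj_mem _ _))
  else 0

theorem inducedTerm_mk (x : GradedObj l.skeleton) (v : N.carrier) {X : C}
    (f : X ⟶ (fromSkeleton C).obj x.obj) (d : ℤ) (hd : x.deg = d + l.len f) :
    N.inducedTerm x v (Arrow.mk f) = DirectSum.lof k (Σ z, z ⟶ x) (fun g => N.rep.obj g.1)
      ⟨⟨toSkeleton X, d⟩, skeletonArrow x f d hd⟩ (N.repMk X d (N.proj d v) (N.proj_mem _ _)) := by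
  have key : ∀ (f' : X ⟶ (fromSkeleton C).obj x.obj) (d' : ℤ) (hd' : x.deg = d' + l.len f'),
      f' = f → DirectSum.lof k (Σ z, z ⟶ x) (fun g => N.rep.obj g.1)
        ⟨⟨toSkeleton X, d'⟩, skeletonArrow x f' d' hd'⟩
        (N.repMk X d' (N.proj d' v) (N.proj_mem _ _)) =
      DirectSum.lof k (Σ z, z ⟶ x) (fun g => N.rep.obj g.1)
        ⟨⟨toSkeleton X, d⟩, skeletonArrow x f d hd⟩
        (N.repMk X d (N.proj d v) (N.proj_mem _ _)) := by
    rintro f' d' hd' rfl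
    obtain rfl : d' = d := by omega
    rfl
  have h : (Arrow.mk f).right = (fromSkeleton C).obj x.obj := rfl
  rw [inducedTerm, dif_pos h]
  exact key _ _ _ (Category.comp_id f)

theorem inducedTerm_of_ne (x : GradedObj l.skeleton) (v : N.carrier) {X Y : C}
    (f : X ⟶ Y) (h : Y ≠ (fromSkeleton C).obj x.obj) :
    N.inducedTerm x v (Arrow.mk f) = 0 := dif_neg h

/-- The map from the free module on the elements of a graded module to the induced
representation. -/
noncomputable def inducedMap (x : GradedObj l.skeleton) :
    (N.carrier →₀ Unitization k (CategoryAlgebra k C)) →ₗ[k] ⨁ g : (Σ z, z ⟶ x), N.rep.obj g.1 :=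
  -- The scalar part of the unitization is dropped. Nothing is lost on multiples of an identity, by
  -- `arrow_mul_eq_inr`.
  Finsupp.lsum k fun v => (lift (N.inducedTerm x v)).comp
    (Unitization.sndHom k k (CategoryAlgebra k C))

theorem inducedMap_single (x : GradedObj l.skeleton) (v : N.carrier)
    (r : Unitization k (CategoryAlgebra k C)) :
    N.inducedMap x (Finsupp.single v r) = lift (N.inducedTerm x v) r.snd :=
  Finsupp.lsum_single _ _ _ _

theorem _root_.CategoryAlgebra.arrow_mul_eq_inr {X Y : C} (f : X ⟶ Y)
    (r : Unitization k (CategoryAlgebra k C)) :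
    arrow k f * r = ((arrow k f * r).snd : CategoryAlgebra k C) := by
  refine Unitization.ext ?_ ?_
  · rw [Unitization.fst_mul, arrow, Unitization.fst_inr, zero_mul, Unitization.fst_inr]
  · rw [Unitization.snd_inr]

/-- Multiplying out the terms `f ⊗ v` gives back the component of `a • v` at `x`; terms whose
morphism does not end at `x` vanish on both sides. -/
theorem toModule_lift_inducedTerm (x : GradedObj l.skeleton) (v : N.carrier)
    (a : CategoryAlgebra k C) :
    DirectSum.toModule k _ _ (fun g : (Σ z, z ⟶ x) => N.rep.map g.2)
      (lift (N.inducedTerm x v) a) =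
    N.repProj x ((a : Unitization k (CategoryAlgebra k C)) • v) := by
  induction a using induction_basis k with
  | zero => rw [Unitization.inr_zero, zero_smul, map_zero, map_zero, map_zero]
  | add a b ha hb => rw [Unitization.inr_add, add_smul, map_add, map_add, map_add, ha, hb]
  | smul r X Y f =>
    rw [inr_smul_basis, map_smul, map_smul, map_smul, lift_basis]
    congr 1
    by_cases hY : Y = (fromSkeleton C).obj x.obj
    · subst hY
      obtain ⟨d, hd⟩ : ∃ d, x.deg = d + l.len f := ⟨x.deg - l.len f, by omega⟩
      rw [N.inducedTerm_mk x v f d hd, DirectSum.toModule_lof]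
      refine Subtype.ext ?_
      rw [rep_map_repMk, repProj_coe, N.proj_arrow_smul f hd, arrow_smul_of_eq f _ rfl]
    · rw [N.inducedTerm_of_ne x v f hY, map_zero]
      refine Subtype.ext ?_
      obtain ⟨d, hd⟩ : ∃ d, x.deg = d + l.len f := ⟨x.deg - l.len f, by omega⟩
      rw [repProj_coe, N.proj_arrow_smul f hd, arrow_smul_of_ne f _ hY]
      rfl

theorem lift_inducedTerm_mul {x y : GradedObj l.skeleton} (f : x ⟶ y) (v : N.carrier)
    (a : CategoryAlgebra k C) :
    lift (N.inducedTerm y v) (basis k (Arrow.mk ((fromSkeleton C).map f.1)) * a) =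
      DirectSum.toModule k _ _ (fun g : (Σ z, z ⟶ x) =>
        DirectSum.lof k (Σ z, z ⟶ y) (fun g => N.rep.obj g.1) ⟨g.1, g.2 ≫ f⟩)
        (lift (N.inducedTerm x v) a) := by
  induction a using induction_basis k with
  | zero => rw [mul_zero, map_zero, map_zero, map_zero]
  | add a b ha hb => rw [mul_add, map_add, map_add, map_add, ha, hb]
  | smul r X Y g =>
    rw [mul_smul_comm, map_smul, map_smul, map_smul, lift_basis, basis_mul_basis]
    congr 1
    by_cases hY : Y = (fromSkeleton C).obj x.obj
    · subst hY
      obtain ⟨d, hd⟩ : ∃ d, x.deg = d + l.len g := ⟨x.deg - l.len g, by omega⟩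
      have hf : y.deg = x.deg + l.len ((fromSkeleton C).map f.1) := f.2
      have hd' : y.deg = d + l.len (g ≫ (fromSkeleton C).map f.1) := by
        rw [l.len_comp]; push_cast; omega
      rw [basisMul_of_comp, lift_basis, N.inducedTerm_mk x v g d hd,
        N.inducedTerm_mk y v _ d hd', DirectSum.toModule_lof]
      have h : skeletonArrow y (g ≫ (fromSkeleton C).map f.1) d hd' = skeletonArrow x g d hd ≫ f := by
        refine GradedObj.hom_ext ((fromSkeleton C).map_injective ?_)
        rw [GradedObj.comp_val, (fromSkeleton C).map_comp, skeletonArrow, skeletonArrow,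
          (fromSkeleton C).map_preimage, (fromSkeleton C).map_preimage, Category.assoc]
      rw [h]
    · rw [basisMul_of_ne k g _ hY, N.inducedTerm_of_ne x v g hY, map_zero, map_zero]

theorem toModule_inducedMap (x : GradedObj l.skeleton)
    (t : N.carrier →₀ Unitization k (CategoryAlgebra k C)) (X : C) :
    DirectSum.toModule k _ _ (fun g : (Σ z, z ⟶ x) => N.rep.map g.2)
      (N.inducedMap x (arrow k (𝟙 X) • t)) =
    N.repProj x (Finsupp.linearCombination _ id (arrow k (𝟙 X) • t)) := by
  induction t using Finsupp.induction_linear with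
  | zero => simp
  | add t t' h h' => simp only [smul_add, map_add, h, h']
  | single v r =>
    rw [Finsupp.smul_single, inducedMap_single, toModule_lift_inducedTerm,
      Finsupp.linearCombination_single, smul_eq_mul, ← arrow_mul_eq_inr]
    rfl

theorem inducedMap_natural {x y : GradedObj l.skeleton} (f : x ⟶ y)
    (t : N.carrier →₀ Unitization k (CategoryAlgebra k C)) (X : C) :
    N.inducedMap y (arrow k ((fromSkeleton C).map f.1) • arrow k (𝟙 X) • t) =
      DirectSum.toModule k _ _ (fun g : (Σ z, z ⟶ x) =>
        DirectSum.lof k (Σ z, z ⟶ y) (fun g => N.rep.obj g.1) ⟨g.1, g.2 ≫ f⟩)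
        (N.inducedMap x (arrow k (𝟙 X) • t)) := by
  induction t using Finsupp.induction_linear with
  | zero => simp
  | add t t' h h' => simp only [smul_add, map_add, h, h']
  | single v r =>
    rw [Finsupp.smul_single, Finsupp.smul_single, inducedMap_single, inducedMap_single,
      smul_eq_mul, smul_eq_mul, ← lift_inducedTerm_mul]
    have h := arrow_mul_eq_inr (𝟙 X) r
    rw [h, Unitization.snd_inr, arrow, ← Unitization.inr_mul, Unitization.snd_inr]

/-- The map to the induced representation given by a map to a free module. -/
noncomputable def inducedSectionMap
    (s : N.carrier →ₗ[Unitization k (CategoryAlgebra k C)]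
      (N.carrier →₀ Unitization k (CategoryAlgebra k C))) (x : GradedObj l.skeleton) :
    N.rep.obj x →ₗ[k] ⨁ g : (Σ z, z ⟶ x), N.rep.obj g.1 where
  toFun m := N.inducedMap x (s m.1)
  map_add' m m' := by
    have h : (m + m').1 = m.1 + m'.1 := rfl
    rw [h, map_add, map_add]
  map_smul' c m := by
    have h : (c • m).1 = c • m.1 := rfl
    rw [h, LinearMap.map_smul_of_tower, map_smul, RingHom.id_apply]

/-- An element of the component at `x` is fixed by the identity of `x`, hence so is its image under
`s`. This puts `s m` into the range where `inducedMap` is natural and compatible with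
multiplication. -/
theorem inducedSectionMap_apply
    (s : N.carrier →ₗ[Unitization k (CategoryAlgebra k C)]
      (N.carrier →₀ Unitization k (CategoryAlgebra k C))) (x : GradedObj l.skeleton)
    (m : N.rep.obj x) : N.inducedSectionMap s x m =
      N.inducedMap x (arrow k (𝟙 ((fromSkeleton C).obj x.obj)) • s m.1) := by
  have h : s m.1 = arrow k (𝟙 ((fromSkeleton C).obj x.obj)) • s m.1 := by
    rw [← map_smul]
    exact congrArg s m.2.2.symm
  change N.inducedMap x (s m.1) = _
  exact congrArg (N.inducedMap x) h

theorem inducedSectionMap_natural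
    (s : N.carrier →ₗ[Unitization k (CategoryAlgebra k C)]
      (N.carrier →₀ Unitization k (CategoryAlgebra k C))) {x y : GradedObj l.skeleton}
    (f : x ⟶ y) (m : N.rep.obj x) : N.inducedSectionMap s y (N.rep.map f m) =
      DirectSum.toModule k _ _ (fun g : (Σ z, z ⟶ x) =>
        DirectSum.lof k (Σ z, z ⟶ y) (fun g => N.rep.obj g.1) ⟨g.1, g.2 ≫ f⟩)
        (N.inducedSectionMap s x m) := by
  rw [N.inducedSectionMap_apply s x m, ← inducedMap_natural, ← map_smul s (arrow k (𝟙 _)), m.2.2,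
    ← map_smul]
  rfl

/-- A projective module splits off the free module on its own elements. The section `s` need not
respect the grading; `inducedMap` projects to the homogeneous components, which keeps naturality and
the splitting property. -/
theorem nonempty_inducedSection
    (h : Module.Projective (Unitization k (CategoryAlgebra k C)) N.carrier) :
    Nonempty N.rep.InducedSection := by
  obtain ⟨s, hs⟩ := Module.projective_def'.1 h
  refine ⟨⟨N.inducedSectionMap s, N.inducedSectionMap_natural s, fun x m => ?_⟩⟩
  rw [inducedSectionMap_apply, toModule_inducedMap, map_smul]
  have h1 := LinearMap.congr_fun hs m.1
  rw [LinearMap.comp_apply, LinearMap.id_apply] at h1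
  rw [h1, m.2.2, repProj_self]

end GradedCatModule

end ProjectiveModules

/-! ### Kernels and dimension shifting along a resolution. -/

namespace CatRep

variable {k : Type w} [Field k] {E : Type u} [Category.{v} E]

/-- The kernel of a homomorphism of representations. -/
def Hom.ker {P : CatRep.{u, v, w, u'} k E} {M : CatRep.{u, v, w, v'} k E} (α : Hom P M) :
    CatRep.{u, v, w, u'} k E where
  obj x := LinearMap.ker (α.app x)
  map {x y} f := (P.map f).restrict fun m hm => by
    rw [LinearMap.mem_ker, α.naturality, LinearMap.mem_ker.1 hm, map_zero]
  map_id x := LinearMap.ext fun m => Subtype.ext (by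
    change P.map (𝟙 x) m.1 = m.1
    rw [P.map_id]; rfl)
  map_comp f g := LinearMap.ext fun m => Subtype.ext (P.map_comp_apply f g m.1)

/-- The inclusion of the kernel. -/
def Hom.kerι {P : CatRep.{u, v, w, u'} k E} {M : CatRep.{u, v, w, v'} k E} (α : Hom P M) :
    Hom α.ker P where
  app _ := Submodule.subtype _
  naturality _ _ := rfl

variable [DegreeCategory E]

/-- Dimension shifting along a linear resolution. -/
theorem vanishes_of_resolution : ∀ (j : ℕ) (i : ℤ) (M : CatRep.{u, v, w, u'} k E)
    (Q : ℕ → CatRep.{u, v, w, u'} k E) (d : ∀ n, Hom (Q (n + 1)) (Q n)) (ε : Hom (Q 0) M)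
    (_ : ∀ x, Function.Surjective (ε.app x))
    (_ : ∀ x, Function.Exact ((d 0).app x) (ε.app x))
    (_ : ∀ n x, Function.Exact ((d (n + 1)).app x) ((d n).app x))
    (_ : ∀ n, Nonempty (Q n).InducedSection)
    (_ : ∀ (n : ℕ) (y : E), DegreeCategory.deg y ≠ i + n → (Q n).Vanishes 0 y) (y : E),
    DegreeCategory.deg y ≠ i + j → M.Vanishes j y
  | 0, i, M, Q, d, ε, hε, _, _, _, hQ, y, hy => (hQ 0 y hy).of_surjective ε hε
  | j + 1, i, M, Q, d, ε, hε, h0, hd, hs, hQ, y, hy => by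
    -- Degree `j + 1` for `M` reduces to degree `j` for the kernel of `ε`, as the bar complex of `Q
    -- 0` is exact in positive degrees.
    refine Vanishes.quotient ε.kerι ε (fun x => Subtype.val_injective) hε (fun x => ?_) ?_
      ((hs 0).some.vanishes j y)
    · intro m
      exact ⟨fun h => ⟨⟨m, h⟩, rfl⟩, fun ⟨m', h⟩ => h ▸ m'.2⟩
    -- The kernel is resolved by the shifted sequence, whose generators start in degree `i + 1`.
    · refine vanishes_of_resolution j (i + 1) ε.ker (fun n => Q (n + 1)) (fun n => d (n + 1))
        { app := fun x => (d 0).app x |>.codRestrict _ fun m => (h0 x).apply_apply_eq_zero m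
          naturality := fun f m => Subtype.ext ((d 0).naturality f m) }
        (fun x m => ?_) (fun x m => ?_) (fun n => hd (n + 1)) (fun n => hs (n + 1))
        (fun n y hy => hQ (n + 1) y ?_) y ?_
      · obtain ⟨m', hm'⟩ := (h0 x m.1).1 m.2
        exact ⟨m', Subtype.ext hm'⟩
      · rw [← hd 0 x m]
        exact Subtype.ext_iff
      · push_cast; omega
      · push_cast at hy; omega

end CatRep

/-! ### The module `A₀`, and Koszul implies diagonal cohomology. -/

section DegreeZeroModule

/-- An element of one piece that is also a sum of elements of the others is fixed and killed by the
same `π n`, so the pieces are independent. -/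
theorem DirectSum.isInternal_of_proj {k V : Type*} [Ring k] [AddCommGroup V] [Module k V]
    (piece : ℤ → Submodule k V) (π : ℤ → V →ₗ[k] V) (h1 : ∀ n, ∀ v ∈ piece n, π n v = v)
    (h2 : ∀ m n, m ≠ n → ∀ v ∈ piece m, π n v = 0) (h3 : ⨆ n, piece n = ⊤) :
    DirectSum.IsInternal piece := by
  rw [DirectSum.isInternal_submodule_iff_iSupIndep_and_iSup_eq_top]
  refine ⟨fun n => ?_, h3⟩
  rw [Submodule.disjoint_def]
  intro v hv hv'
  rw [← h1 n v hv]
  have : ⨆ j, ⨆ (_ : j ≠ n), piece j ≤ LinearMap.ker (π n) :=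
    iSup₂_le fun m hm w hw => h2 m n hm w hw
  exact this hv'

variable {C : Type u} [Category.{v} C] (l : CategoryGrading C) (k : Type w) [Field k]

open CategoryAlgebra

namespace DegreeZero

theorem inr_smul_val (a : CategoryAlgebra k C) (x : DegreeZero k (gradedPiece k l)) :
    Subtype.val (p := (· ∈ gradedPiece k l 0))
      ((a : Unitization k (CategoryAlgebra k C)) • x) =
    (DirectSum.decompose (gradedPiece k l) a 0 : CategoryAlgebra k C) *
      Subtype.val (p := (· ∈ gradedPiece k l 0)) x := by
  change Subtype.val (p := (· ∈ gradedPiece k l 0))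
    (Unitization.lift (action k (gradedPiece k l)) (a : Unitization k (CategoryAlgebra k C)) x) = _
  have h : Unitization.lift (action k (gradedPiece k l)) (a : Unitization k (CategoryAlgebra k C)) =
      action k (gradedPiece k l) a :=
    (Unitization.lift_symm_apply_apply _ a).symm.trans
      (DFunLike.congr_fun (Unitization.lift.symm_apply_apply (action k (gradedPiece k l))) a)
  rw [h]
  rfl

instance : IsScalarTower k (Unitization k (CategoryAlgebra k C))
    (DegreeZero k (gradedPiece k l)) where
  smul_assoc c r x := by
    change Unitization.lift (action k (gradedPiece k l)) (c • r) x =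
      c • Unitization.lift (action k (gradedPiece k l)) r x
    rw [map_smul, LinearMap.smul_apply]

theorem arrow_smul_of_len_pos {X Y : C} (f : X ⟶ Y) (hf : 0 < l.len f)
    (x : DegreeZero k (gradedPiece k l)) : arrow k f • x = 0 := by
  refine Subtype.ext ?_
  refine (inr_smul_val l k _ x).trans ?_
  rw [DirectSum.decompose_of_mem_ne (gradedPiece k l) (basis_mem k l (Arrow.mk f)) hf.ne', zero_mul]
  rfl

theorem arrow_smul_of_len_zero {X Y : C} (f : X ⟶ Y) (hf : l.len f = 0)
    (x : DegreeZero k (gradedPiece k l)) :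
    Subtype.val (p := (· ∈ gradedPiece k l 0)) (arrow k f • x) =
      basis k (Arrow.mk f) * Subtype.val (p := (· ∈ gradedPiece k l 0)) x := by
  refine (inr_smul_val l k _ x).trans ?_
  rw [DirectSum.decompose_of_mem_same (gradedPiece k l)
    (show basis k (Arrow.mk f) ∈ gradedPiece k l 0 from hf ▸ basis_mem k l (Arrow.mk f))]

end DegreeZero

open Classical in
/-- The grading of `A₀`, which is concentrated in degree zero. -/
noncomputable def DegreeZero.grading (n : ℤ) : Submodule k (DegreeZero k (gradedPiece k l)) :=
  if n = 0 then ⊤ else ⊥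

theorem DegreeZero.grading_zero : DegreeZero.grading l k 0 = ⊤ := if_pos rfl

theorem DegreeZero.grading_of_ne {n : ℤ} (hn : n ≠ 0) : DegreeZero.grading l k n = ⊥ := if_neg hn

open Classical in
/-- The graded module `A₀`. -/
noncomputable def degreeZeroModule : GradedCatModule.{u, v, w, max u v w} l k where
  carrier := DegreeZero k (gradedPiece k l)
  piece := DegreeZero.grading l k
  isInternal := by
    refine DirectSum.isInternal_of_proj _ (fun n => if n = 0 then LinearMap.id else 0) ?_ ?_ ?_
    · intro n v hv
      by_cases hn : n = 0
      · rw [if_pos hn]; rfl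
      · rw [DegreeZero.grading_of_ne l k hn] at hv
        rw [(Submodule.mem_bot k).1 hv, map_zero]
    · intro m n hmn v hv
      by_cases hn : n = 0
      · rw [DegreeZero.grading_of_ne l k fun h => hmn (h.trans hn.symm)] at hv
        rw [(Submodule.mem_bot k).1 hv, map_zero]
      · rw [if_neg hn]; rfl
    · refine eq_top_iff.2 (le_iSup_of_le 0 ?_)
      rw [DegreeZero.grading_zero]
  arrow_smul_mem f n v hv := by
    by_cases hn : n = 0
    · rcases Nat.eq_zero_or_pos (l.len f) with h | h
      · rw [h, hn, Nat.cast_zero, add_zero, DegreeZero.grading_zero]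
        trivial
      · rw [DegreeZero.arrow_smul_of_len_pos l k f h]
        exact zero_mem _
    · rw [DegreeZero.grading_of_ne l k hn] at hv
      rw [(Submodule.mem_bot k).1 hv, smul_zero]
      exact zero_mem _

namespace degreeZeroModule

theorem mem_piece_zero (v : (degreeZeroModule l k).carrier) :
    v ∈ (degreeZeroModule l k).piece 0 :=
  (DegreeZero.grading_zero l k).ge (Submodule.mem_top (x := v))

theorem eq_zero_of_mem_piece {n : ℤ} (hn : n ≠ 0) {v : (degreeZeroModule l k).carrier}
    (h : v ∈ (degreeZeroModule l k).piece n) : v = 0 :=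
  (Submodule.mem_bot k).1 ((DegreeZero.grading_of_ne l k hn).le h)

theorem deg_eq_zero {x : GradedObj l.skeleton} (h : Nontrivial ((degreeZeroModule l k).rep.obj x)) :
    x.deg = 0 := by
  by_contra hx
  obtain ⟨a, b, hab⟩ := h
  exact hab (Subtype.ext ((eq_zero_of_mem_piece l k hx a.2.1).trans
    (eq_zero_of_mem_piece l k hx b.2.1).symm))

/-- The identity of the object is a nonzero element. So the bar complex of `A₀` sees the chains from
every object of degree zero. -/
theorem nontrivial {x : GradedObj l.skeleton} (hx : x.deg = 0) :
    Nontrivial ((degreeZeroModule l k).rep.obj x) := by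
  obtain ⟨X, n⟩ := x
  obtain rfl : n = 0 := hx
  have h0 : l.len (𝟙 ((fromSkeleton C).obj X)) = 0 := l.len_id _
  have hmem : basis k (Arrow.mk (𝟙 ((fromSkeleton C).obj X))) ∈ gradedPiece k l 0 :=
    h0 ▸ basis_mem k l (Arrow.mk (𝟙 ((fromSkeleton C).obj X)))
  refine ⟨⟨(⟨_, hmem⟩ : gradedPiece k l 0), mem_piece_zero l k _, ?_⟩, 0, ?_⟩
  · refine Subtype.ext ?_
    refine (DegreeZero.arrow_smul_of_len_zero l k _ h0 _).trans ?_
    rw [basis_mul_basis, basisMul_of_comp, Category.comp_id]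
  · intro h
    have h1 : basis k (Arrow.mk (𝟙 ((fromSkeleton C).obj X))) = 0 :=
      congrArg (Subtype.val (p := (· ∈ gradedPiece k l 0))) (congrArg Subtype.val h)
    exact one_ne_zero (Finsupp.single_eq_zero.1 h1)

theorem rep_map_eq_zero [l.skeleton.IsSkeletal] {x y : GradedObj l.skeleton} (f : x ⟶ y)
    (h : DegreeCategory.deg x < DegreeCategory.deg y) : (degreeZeroModule l k).rep.map f = 0 :=
  LinearMap.ext fun m => Subtype.ext (DegreeZero.arrow_smul_of_len_pos l k _ (by
    have h1 : y.deg = x.deg + l.len ((fromSkeleton C).map f.1) := f.2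
    have h2 : x.deg < y.deg := h
    omega) m.1)

end degreeZeroModule

variable {l k}

namespace LinearProjectiveResolution

variable (L : LinearProjectiveResolution k (gradedPiece k l))

/-- The terms of a resolution as graded modules. -/
def term (i : ℕ) : GradedCatModule.{u, v, w, max u v w} l k where
  carrier := L.P i
  addCommGroup := L.addCommGroup i
  moduleBase := L.moduleBase i
  module := L.module i
  isScalarTower := L.isScalarTower i
  piece := L.piece i
  isInternal := L.isInternal i
  arrow_smul_mem f n v hv := by
    rw [add_comm]
    exact L.smul_mem i _ n _ v (basis_mem k l (Arrow.mk f)) hv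

include L

/-- The linear resolution becomes an exact sequence of representations: its `i`-th term has no
generators outside degree `i` and splits off an induced representation, so dimension shifting
applies. -/
theorem vanishes [l.skeleton.IsSkeletal] (j : ℕ) (y : GradedObj l.skeleton) (hy : y.deg ≠ j) :
    (degreeZeroModule l k).rep.Vanishes j y := by
  let d : ∀ i, GradedCatModule.Hom (L.term (i + 1)) (L.term i) := fun i =>
    ⟨L.d i, fun {n v} h => L.d_mem i n v h⟩
  let ε : GradedCatModule.Hom (L.term 0) (degreeZeroModule l k) :=
    ⟨L.ε, fun {n v} h => by
      by_cases hn : n = 0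
      · subst hn
        exact degreeZeroModule.mem_piece_zero l k _
      · change L.ε v ∈ DegreeZero.grading l k n
        rw [L.ε_eq_zero n v h hn]
        exact zero_mem _⟩
  refine CatRep.vanishes_of_resolution j 0 _ (fun i => (L.term i).rep) (fun i => (d i).rep) ε.rep
    (fun x => ε.rep_surjective L.ε_surjective x) (fun x => (d 0).rep_exact ε L.exact_zero x)
    (fun i x => (d (i + 1)).rep_exact (d i) (L.exact_succ i) x)
    (fun i => (L.term i).nonempty_inducedSection (L.projective i)) (fun i y hy => ?_) y ?_
  · refine (L.term i).vanishes_zero_of_generated (i := i) (L.generated i) ?_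
    intro h
    apply hy
    rw [zero_add]
    exact h
  · intro h
    apply hy
    rw [zero_add] at h
    exact h

theorem chainExact [l.skeleton.IsSkeletal] (x y : GradedObj l.skeleton) (i : ℕ) (hx : x.deg = 0)
    (hy : y.deg ≠ i) : CatRep.ChainExact k i x y := by
  have := degreeZeroModule.nontrivial l k hx
  exact (L.vanishes i y hy).chainExact
    (fun f h => degreeZeroModule.rep_map_eq_zero l k f h) x

end LinearProjectiveResolution

theorem CategoryGrading.IsKoszul.hasDiagonalCohomology (hl : l.IsIndiscretelyBased)
    (h : l.IsKoszul k) : CategoryGrading.HasDiagonalCohomology hl k := by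
  obtain ⟨-, ⟨L⟩⟩ := h
  have := hl.isSkeletal_skeleton
  rw [← CategoryGrading.hasDiagonalCohomology_skeleton_iff hl
    (CategoryGrading.IsSkeletal.isIndiscretelyBased _),
    CategoryGrading.hasDiagonalCohomology_iff_chainExact]
  exact fun x y i => L.chainExact x y i

end DegreeZeroModule

/-! ### Sums of the left ideals generated by identities. -/

section FreeModules

open CategoryAlgebra

variable {C : Type u} [Category.{v} C] (k : Type w) [Field k]
  (l : CategoryGrading C) {B : Type u'} (X : B → C) (i : ℤ)

/-- The direct sum of the left ideals generated by identities of objects, as a submodule. -/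
noncomputable def idealSumSubmodule : Submodule (Unitization k (CategoryAlgebra k C))
    (B →₀ Unitization k (CategoryAlgebra k C)) where
  carrier := {x | ∀ b, x b * arrow k (𝟙 (X b)) = x b}
  add_mem' := fun {x y} hx hy b => by rw [Finsupp.add_apply, add_mul, hx, hy]
  zero_mem' := fun _ => zero_mul _
  smul_mem' := fun r x hx b => by rw [Finsupp.smul_apply, smul_eq_mul, mul_assoc, hx]

/-- The direct sum of the left ideals generated by identities of objects. -/
def IdealSum : Type (max u v w u') := idealSumSubmodule k X

namespace IdealSum

noncomputable instance : AddCommGroup (IdealSum k X) :=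
  inferInstanceAs (AddCommGroup (idealSumSubmodule k X))

noncomputable instance : Module (Unitization k (CategoryAlgebra k C)) (IdealSum k X) :=
  inferInstanceAs (Module (Unitization k (CategoryAlgebra k C)) (idealSumSubmodule k X))

noncomputable instance : Module k (IdealSum k X) :=
  inferInstanceAs (Module k (idealSumSubmodule k X))

instance : IsScalarTower k (Unitization k (CategoryAlgebra k C)) (IdealSum k X) :=
  inferInstanceAs (IsScalarTower k (Unitization k (CategoryAlgebra k C)) (idealSumSubmodule k X))

/-- The inclusion into the free module. -/
noncomputable def incl : IdealSum k X →ₗ[Unitization k (CategoryAlgebra k C)]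
    (B →₀ Unitization k (CategoryAlgebra k C)) := (idealSumSubmodule k X).subtype

/-- The element of the direct sum given by a morphism. -/
noncomputable def of (b : B) {Y : C} (f : X b ⟶ Y) : IdealSum k X :=
  ⟨Finsupp.single b (arrow k f), fun b' => by
    classical
    rw [Finsupp.single_apply]
    split_ifs with h
    · subst h
      rw [arrow_mul, Category.id_comp]
    · exact zero_mul _⟩

/-- The multiplication by the identities from the right. -/
noncomputable def retraction : (B →₀ Unitization k (CategoryAlgebra k C))
    →ₗ[Unitization k (CategoryAlgebra k C)] IdealSum k X :=
  Finsupp.linearCombination _ fun b => of k X b (𝟙 (X b))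

theorem retraction_single (b : B) (r : Unitization k (CategoryAlgebra k C)) :
    retraction k X (Finsupp.single b r) = r • of k X b (𝟙 (X b)) :=
  Finsupp.linearCombination_single _ _ _

theorem arrow_smul_of (b : B) {Y Z : C} (f : X b ⟶ Y) (g : Y ⟶ Z) :
    arrow k g • of k X b f = of k X b (f ≫ g) := Subtype.ext (by
  change arrow k g • Finsupp.single b (arrow k f) = Finsupp.single b (arrow k (f ≫ g))
  rw [Finsupp.smul_single, smul_eq_mul, arrow_mul])

theorem arrow_smul_of_of_ne (b : B) {Y Z W : C} (f : X b ⟶ Y) (g : Z ⟶ W) (h : Y ≠ Z) :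
    arrow k g • of k X b f = 0 := Subtype.ext (by
  change arrow k g • Finsupp.single b (arrow k f) = 0
  rw [Finsupp.smul_single, smul_eq_mul, arrow_mul_of_ne k f g h, Finsupp.single_zero])

theorem retraction_single_arrow (b : B) {Y : C} (f : X b ⟶ Y) :
    retraction k X (Finsupp.single b (arrow k f)) = of k X b f := by
  rw [retraction_single, arrow_smul_of, Category.id_comp]

theorem retraction_apply (x : B →₀ Unitization k (CategoryAlgebra k C)) (b : B) :
    (retraction k X x).1 b = x b * arrow k (𝟙 (X b)) := by
  classical
  induction x using Finsupp.induction_linear with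
  | zero => rw [map_zero]; exact (zero_mul _).symm
  | add x y hx hy =>
    rw [map_add, Finsupp.add_apply, add_mul, ← hx, ← hy]
    rfl
  | single b' r =>
    rw [retraction_single]
    change (r • Finsupp.single b' (arrow k (𝟙 (X b')))) b = _
    rw [Finsupp.smul_single, smul_eq_mul, Finsupp.single_apply, Finsupp.single_apply]
    split_ifs with h
    · rw [h]
    · rw [zero_mul]

theorem retraction_coe (x : IdealSum k X) : retraction k X x.1 = x :=
  Subtype.ext (Finsupp.ext fun b => (retraction_apply k X x.1 b).trans (x.2 b))

/-- Right multiplication by the idempotents retracts the free module onto it. -/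
theorem projective : Module.Projective (Unitization k (CategoryAlgebra k C)) (IdealSum k X) :=
  .of_split (incl k X) (retraction k X) (LinearMap.ext fun x => retraction_coe k X x)

/-- The morphisms out of the objects `X b` span the direct sum over `k`. Later statements about
covers are checked only on these elements. -/
theorem mem_of_forall_of_mem (S : Submodule k (IdealSum k X))
    (hS : ∀ (b : B) (Y : C) (f : X b ⟶ Y), of k X b f ∈ S) (x : IdealSum k X) : x ∈ S := by
  rw [← retraction_coe k X x]
  change x.1 ∈ S.comap ((retraction k X).restrictScalars k)
  induction x.1 using Finsupp.induction_linear with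
  | zero => exact zero_mem _
  | add x y hx hy => exact add_mem hx hy
  | single b r =>
    change retraction k X (Finsupp.single b r) ∈ S
    rw [retraction_single]
    induction r using Unitization.ind with
    | inl_add_inr c a =>
      rw [add_smul]
      refine add_mem ?_ ?_
      · rw [← Unitization.algebraMap_eq_inl, algebraMap_smul]
        exact S.smul_mem c (hS _ _ _)
      · induction a using induction_basis k with
        | zero => rw [Unitization.inr_zero, zero_smul]; exact zero_mem _
        | add a b ha hb => rw [Unitization.inr_add, add_smul]; exact add_mem ha hb
        | smul c Z Y f =>
          rw [Unitization.inr_smul, smul_assoc]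
          refine S.smul_mem c ?_
          change arrow k f • of k X b (𝟙 _) ∈ S
          by_cases h : X b = Z
          · subst h
            rw [arrow_smul_of, Category.id_comp]
            exact hS _ _ _
          · rw [arrow_smul_of_of_ne k X b _ f h]
            exact zero_mem _

/-- The homogeneous components of the direct sum, with generators in degree `i`. -/
noncomputable def piece (n : ℤ) : Submodule k (IdealSum k X) :=
  Submodule.span k {x | ∃ (b : B) (Y : C) (f : X b ⟶ Y), i + l.len f = n ∧ x = of k X b f}

theorem of_mem_piece (b : B) {Y : C} (f : X b ⟶ Y) {n : ℤ} (h : i + l.len f = n) :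
    of k X b f ∈ piece k l X i n := Submodule.subset_span ⟨b, Y, f, h, rfl⟩

open Classical in
/-- The projections of the free module to morphisms of a given length. -/
noncomputable def filter (l : CategoryGrading C) (n : ℤ) :
    (B →₀ Unitization k (CategoryAlgebra k C)) →ₗ[k] (B →₀ Unitization k (CategoryAlgebra k C)) :=
  Finsupp.lsum k fun b => Finsupp.lsingle b ∘ₗ
    (lift fun α => if i + l.len α.hom = n then arrow k α.hom else 0) ∘ₗ
    Unitization.sndHom k k (CategoryAlgebra k C)

theorem filter_single (b : B) {Y Z : C} (f : Y ⟶ Z) (n : ℤ) [Decidable (i + l.len f = n)] :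
    filter k i l n (Finsupp.single b (arrow k f)) =
      Finsupp.single b (if i + l.len f = n then arrow k f else 0) := by
  rw [filter, Finsupp.lsum_single]
  refine congrArg (Finsupp.single b) ((lift_basis _ _).trans ?_)
  congr!

/-- The projections to the homogeneous components. -/
noncomputable def proj (n : ℤ) : IdealSum k X →ₗ[k] IdealSum k X :=
  (retraction k X).restrictScalars k ∘ₗ filter k i l n ∘ₗ (incl k X).restrictScalars k

theorem proj_of (b : B) {Y : C} (f : X b ⟶ Y) (n : ℤ) :
    (i + l.len f = n → proj k l X i n (of k X b f) = of k X b f) ∧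
      (i + l.len f ≠ n → proj k l X i n (of k X b f) = 0) := by
  classical
  have h : proj k l X i n (of k X b f) = retraction k X (Finsupp.single b
      (if i + l.len f = n then arrow k f else 0)) :=
    congrArg (retraction k X) (filter_single k l i b f n)
  rw [h]
  refine ⟨fun hn => ?_, fun hn => ?_⟩
  · rw [if_pos hn, retraction_single_arrow]
  · rw [if_neg hn, Finsupp.single_zero, map_zero]

theorem isInternal : DirectSum.IsInternal (piece k l X i) := by
  classical
  refine DirectSum.isInternal_of_proj (k := k) (V := IdealSum k X) (piece k l X i)
    (proj k l X i) ?_ ?_ ?_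
  · intro n v hv
    refine Submodule.span_le (p := LinearMap.eqLocus (proj k l X i n) LinearMap.id).2 ?_ hv
    rintro _ ⟨b, Y, f, hf, rfl⟩
    exact (proj_of k l X i b f n).1 hf
  · intro m n hmn v hv
    refine Submodule.span_le (p := LinearMap.ker (proj k l X i n)).2 ?_ hv
    rintro _ ⟨b, Y, f, hf, rfl⟩
    exact (proj_of k l X i b f n).2 (by omega)
  · refine eq_top_iff.2 fun x _ => mem_of_forall_of_mem k X _ (fun b Y f => ?_) x
    exact Submodule.mem_iSup_of_mem _ (of_mem_piece k l X i b f rfl)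

/-- The direct sum as a graded module. -/
noncomputable def toModule : GradedCatModule.{u, v, w, max u v w u'} l k where
  carrier := IdealSum k X
  piece := piece k l X i
  isInternal := isInternal k l X i
  arrow_smul_mem {Z W} g n v hv := by
    induction hv using Submodule.span_induction with
    | zero => rw [smul_zero]; exact zero_mem _
    | add x y _ _ hx hy => rw [smul_add]; exact add_mem hx hy
    | smul c x _ hx =>
      have : arrow k g • c • x = c • arrow k g • x := by
        have := IsScalarTower.to_smulCommClass' (R := k) (A := Unitization k (CategoryAlgebra k C))
          (M := IdealSum k X)
        exact smul_comm _ _ _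
      rw [this]
      exact Submodule.smul_mem _ c hx
    | mem x hx =>
      obtain ⟨b, Y, f, rfl, rfl⟩ := hx
      by_cases h : Y = Z
      · subst h
        rw [arrow_smul_of]
        exact of_mem_piece k l X i b _ (by rw [l.len_comp]; push_cast; ring)
      · rw [arrow_smul_of_of_ne k X b f g h]
        exact zero_mem _

theorem generated (x : (toModule k l X i).carrier) : x ∈ AddSubgroup.closure
    {z | ∃ (a : CategoryAlgebra k C) (y : (toModule k l X i).carrier),
      y ∈ (toModule k l X i).piece i ∧ z = (a : Unitization k (CategoryAlgebra k C)) • y} := by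
  -- The closure is a `k`-subspace since scalars can be moved into the coefficient `a`.
  let S : Submodule k (IdealSum k X) :=
    { AddSubgroup.closure {z : IdealSum k X | ∃ (a : CategoryAlgebra k C) (y : IdealSum k X),
        y ∈ piece k l X i i ∧ z = (a : Unitization k (CategoryAlgebra k C)) • y} with
      smul_mem' := fun c x hx => by
        refine AddSubgroup.closure_induction (p := fun x _ => c • x ∈ AddSubgroup.closure _)
          ?_ ?_ ?_ ?_ hx
        · rintro _ ⟨a, y, hy, rfl⟩
          refine AddSubgroup.subset_closure ⟨c • a, y, hy, ?_⟩
          rw [Unitization.inr_smul, smul_assoc]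
        · rw [smul_zero]; exact zero_mem _
        · intro x y _ _ hx hy
          rw [smul_add]; exact add_mem hx hy
        · intro x _ hx
          rw [smul_neg]; exact neg_mem hx }
  refine mem_of_forall_of_mem k X S (fun b Y f => ?_) x
  refine AddSubgroup.subset_closure ⟨basis k (Arrow.mk f), of k X b (𝟙 (X b)),
    of_mem_piece k l X i b _ (by rw [l.len_id]; simp), ?_⟩
  refine Eq.trans ?_ (arrow_smul_of k X b (𝟙 _) f).symm
  rw [Category.id_comp]

end IdealSum

end FreeModules

/-! ### Modules with diagonal Ext and their projective covers. -/

section LinearModules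

open CategoryAlgebra

variable {C : Type u} [Category.{v} C] {l : CategoryGrading C} {k : Type w} [Field k]

namespace IdealSum

variable (N : GradedCatModule.{u, v, w, v'} l k) {B : Type u'} (X : B → C) (i : ℤ)
  (n : ∀ b, N.component (X b) i)

theorem linearCombination_of (b : B) {Y : C} (f : X b ⟶ Y) :
    Finsupp.linearCombination _ (fun b => (n b).1) (incl k X (of k X b f)) =
      arrow k f • (n b).1 :=
  Finsupp.linearCombination_single _ _ _

/-- The homomorphism given by the images of the generators. -/
noncomputable def desc : GradedCatModule.Hom (toModule k l X i) N where
  toLinear := Finsupp.linearCombination _ (fun b => (n b).1) ∘ₗ incl k X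
  map_mem {m x} hx := by
    refine Submodule.span_le (p := (N.piece m).comap
      ((Finsupp.linearCombination _ (fun b => (n b).1) ∘ₗ incl k X).restrictScalars k)).2 ?_ hx
    rintro _ ⟨b, Y, f, rfl, rfl⟩
    change Finsupp.linearCombination _ (fun b => (n b).1) (incl k X (of k X b f)) ∈
      N.piece (i + l.len f)
    rw [linearCombination_of]
    exact N.arrow_smul_mem f i _ (n b).2.1

theorem desc_of (b : B) {Y : C} (f : X b ⟶ Y) :
    (desc N X i n).toLinear (of k X b f) = arrow k f • (n b).1 :=
  linearCombination_of N X i n b f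

end IdealSum

namespace GradedCatModule

variable (N : GradedCatModule.{u, v, w, u'} l k)

/-- The elements on which a finite sum of identities acts as the identity. -/
noncomputable def unital : Submodule k N.carrier where
  -- Demanding the equation for all finite sets above `S₀` makes the condition stable under sums.
  carrier := {v | ∃ S₀ : Finset C, ∀ S, S₀ ⊆ S → ∑ X ∈ S, arrow k (𝟙 X) • v = v}
  zero_mem' := ⟨∅, fun S _ => by simp⟩
  add_mem' := by
    classical
    rintro v w ⟨S, hS⟩ ⟨T, hT⟩
    refine ⟨S ∪ T, fun U hU => ?_⟩
    simp only [smul_add, Finset.sum_add_distrib]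
    rw [hS U (Finset.subset_union_left.trans hU), hT U (Finset.subset_union_right.trans hU)]
  smul_mem' := by
    rintro c v ⟨S, hS⟩
    refine ⟨S, fun U hU => ?_⟩
    simp only [smul_comm _ c v]
    rw [← Finset.smul_sum, hS U hU]

theorem arrow_smul_mem_unital {X Y : C} (f : X ⟶ Y) (v : N.carrier) :
    arrow k f • v ∈ N.unital := by
  refine ⟨{Y}, fun S hS => ?_⟩
  rw [Finset.sum_eq_single Y]
  · exact arrow_smul_of_eq f v rfl
  · exact fun Z _ hZ => arrow_smul_of_ne f v (Ne.symm hZ)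
  · exact fun h => (h (hS (Finset.mem_singleton_self Y))).elim

theorem sum_support_proj [∀ (n : ℤ) (x : N.piece n), Decidable (x ≠ 0)] (v : N.carrier) :
    ∑ n ∈ (DirectSum.decompose N.piece v).support, N.proj n v = v :=
  DirectSum.sum_support_decompose N.piece v

variable {N} {N' : GradedCatModule.{u, v, w, v'} l k}

/-- The kernel of a homomorphism of graded modules. -/
noncomputable def Hom.kernel (f : Hom N N') : GradedCatModule.{u, v, w, u'} l k where
  carrier := LinearMap.ker f.toLinear
  piece n := (N.piece n).comap ((LinearMap.ker f.toLinear).subtype.restrictScalars k)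
  isInternal := by
    classical
    have hf : ∀ n (v : LinearMap.ker f.toLinear), N.proj n v.1 ∈ LinearMap.ker f.toLinear :=
      fun n v => by
        rw [LinearMap.mem_ker, ← f.proj_apply, LinearMap.mem_ker.1 v.2, map_zero]
    refine DirectSum.isInternal_of_proj (k := k) (V := LinearMap.ker f.toLinear) _
      (fun n => { toFun := fun v => ⟨N.proj n v.1, hf n v⟩
                  map_add' := fun v w => Subtype.ext (map_add (N.proj n) v.1 w.1)
                  map_smul' := fun c v => Subtype.ext (map_smul (N.proj n) c v.1) }) ?_ ?_ ?_
    · exact fun n v hv => Subtype.ext (N.proj_of_mem hv)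
    · exact fun m n hmn v hv => Subtype.ext (N.proj_of_mem_ne hv hmn)
    · refine eq_top_iff.2 fun v _ => ?_
      have h : v = ∑ n ∈ (DirectSum.decompose N.piece v.1).support,
          (⟨N.proj n v.1, hf n v⟩ : LinearMap.ker f.toLinear) := by
        refine Subtype.ext ?_
        rw [AddSubmonoidClass.coe_finsetSum]
        exact (N.sum_support_proj v.1).symm
      rw [h]
      exact Submodule.sum_mem _ fun n _ => Submodule.mem_iSup_of_mem n (N.proj_mem n v.1)
  arrow_smul_mem g n v hv := N.arrow_smul_mem g n v.1 hv

/-- The inclusion of the kernel. -/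
noncomputable def Hom.kernelι (f : Hom N N') : Hom f.kernel N where
  toLinear := (LinearMap.ker f.toLinear).subtype
  map_mem h := h

theorem Hom.exact_kernelι (f : Hom N N') : Function.Exact f.kernelι.toLinear f.toLinear :=
  LinearMap.exact_subtype_ker_map f.toLinear

theorem Hom.kernelι_injective (f : Hom N N') : Function.Injective f.kernelι.toLinear :=
  Subtype.val_injective

theorem Hom.mem_unital_kernel (f : Hom N N') (h : ∀ v, v ∈ N.unital) (v : f.kernel.carrier) :
    v ∈ f.kernel.unital := by
  obtain ⟨S, hS⟩ := h (f.kernelι.toLinear v)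
  refine ⟨S, fun T hT => f.kernelι_injective ?_⟩
  rw [map_sum]
  simp only [map_smul]
  exact hS T hT

variable [l.skeleton.IsSkeletal] (N) (i : ℤ)

/-- Modules such that the relative bar complex has cohomology only on the diagonal. -/
structure IsLinear : Prop where
  eq_zero : ∀ y : GradedObj l.skeleton, y.deg < i → ∀ v : N.rep.obj y, v = 0
  mem_unital : ∀ v, v ∈ N.unital
  vanishes : ∀ (j : ℕ) (y : GradedObj l.skeleton), y.deg ≠ i + j → N.rep.Vanishes j y

omit [l.skeleton.IsSkeletal]

/-- The objects of the generators of the projective cover. -/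
noncomputable def coverObj
    (b : Σ q : Skeleton C, Module.Basis.ofVectorSpaceIndex k (N.rep.obj ⟨q, i⟩)) : C :=
  (fromSkeleton C).obj b.1

/-- A graded projective module with generators in degree `i`. -/
noncomputable def cover : GradedCatModule.{u, v, w, max u v w u'} l k :=
  IdealSum.toModule k l (N.coverObj i) i

/-- The generators of a module in degree `i`. -/
noncomputable def coverGen
    (b : Σ q : Skeleton C, Module.Basis.ofVectorSpaceIndex k (N.rep.obj ⟨q, i⟩)) :
    N.component (N.coverObj i b) i :=
  (Module.Basis.ofVectorSpace k (N.rep.obj ⟨b.1, i⟩) b.2 :)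

/-- The canonical map from the cover. -/
noncomputable def coverHom : Hom (N.cover i) N := IdealSum.desc N _ i (N.coverGen i)

theorem mem_unital_cover (v : (N.cover i).carrier) : v ∈ (N.cover i).unital := by
  refine IdealSum.mem_of_forall_of_mem k (N.coverObj i) (N.cover i).unital (fun b Y f => ?_) v
  have h := IdealSum.arrow_smul_of k (N.coverObj i) b (𝟙 _) f
  rw [Category.id_comp] at h
  rw [← h]
  exact (N.cover i).arrow_smul_mem_unital f _

theorem cover_eq_zero (y : GradedObj l.skeleton) (hy : y.deg < i) (v : (N.cover i).rep.obj y) :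
    v = 0 := by
  rw [← repProj_self y v]
  change v.1 ∈ LinearMap.ker ((N.cover i).repProj y)
  refine IdealSum.mem_of_forall_of_mem k (N.coverObj i) (LinearMap.ker ((N.cover i).repProj y))
    (fun b Y f => ?_) v.1
  refine LinearMap.mem_ker.2 (Subtype.ext ?_)
  refine (repProj_coe y _).trans ?_
  rw [(N.cover i).proj_of_mem_ne (IdealSum.of_mem_piece k l (N.coverObj i) i b f rfl) (by omega),
    smul_zero]
  rfl

/-- The generators of the cover. -/
noncomputable def coverUnit (q : Skeleton C)
    (j : Module.Basis.ofVectorSpaceIndex k (N.rep.obj ⟨q, i⟩)) : (N.cover i).carrier :=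
  IdealSum.of k (N.coverObj i) ⟨q, j⟩ (𝟙 _)

/-- The linear combinations of the generators of the cover at an object of the skeleton. -/
noncomputable def coverLinearCombination (q : Skeleton C) :
    (Module.Basis.ofVectorSpaceIndex k (N.rep.obj ⟨q, i⟩) →₀ k) →ₗ[k] (N.cover i).carrier :=
  Finsupp.linearCombination k (N.coverUnit i q)

theorem coverHom_coverLinearCombination (q : Skeleton C)
    (c : Module.Basis.ofVectorSpaceIndex k (N.rep.obj ⟨q, i⟩) →₀ k) :
    (N.coverHom i).toLinear (N.coverLinearCombination i q c) =
      (Finsupp.linearCombination k (Module.Basis.ofVectorSpace k (N.rep.obj ⟨q, i⟩)) c).1 := by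
  induction c using Finsupp.induction_linear with
  | zero => rw [map_zero, map_zero, map_zero]; rfl
  | add c d hc hd => rw [map_add, map_add, map_add, hc, hd]; rfl
  | single j r =>
    rw [coverLinearCombination, Finsupp.linearCombination_single, Finsupp.linearCombination_single,
      Hom.map_smul_base]
    refine congrArg (r • ·) ((IdealSum.desc_of N _ i (N.coverGen i) ⟨q, j⟩ (𝟙 _)).trans ?_)
    exact (N.coverGen i ⟨q, j⟩).2.2

/-- In its lowest degree `i` the cover contains only morphisms of length zero; in the skeleton these
are identities, so this degree is spanned by the generators. -/
theorem repProj_mem_range [l.skeleton.IsSkeletal] (q : Skeleton C) (v : (N.cover i).carrier) :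
    ((N.cover i).repProj ⟨q, i⟩ v).1 ∈ LinearMap.range (N.coverLinearCombination i q) := by
  refine IdealSum.mem_of_forall_of_mem k (N.coverObj i)
    ((LinearMap.range (N.coverLinearCombination i q)).comap
      (Submodule.subtype _ ∘ₗ (N.cover i).repProj ⟨q, i⟩)) (fun b Y f => ?_) v
  change ((N.cover i).repProj ⟨q, i⟩ (IdealSum.of k (N.coverObj i) b f)).1 ∈
    LinearMap.range (N.coverLinearCombination i q)
  change arrow k (𝟙 ((fromSkeleton C).obj q)) • (N.cover i).proj i _ ∈ _
  have hf : IdealSum.of k (N.coverObj i) b f ∈ (N.cover i).piece (i + l.len f) :=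
    IdealSum.of_mem_piece k l (N.coverObj i) i b f rfl
  by_cases h0 : l.len f = 0
  · rw [h0, Nat.cast_zero, add_zero] at hf
    rw [(N.cover i).proj_of_mem hf]
    by_cases hY : Y = (fromSkeleton C).obj q
    · subst hY
      obtain ⟨q', j⟩ := b
      obtain ⟨g, rfl⟩ := (fromSkeleton C).map_surjective f
      obtain ⟨rfl, rfl⟩ := CategoryGrading.IsSkeletal.eq_eqToHom (l := l.skeleton) g h0
      refine ⟨Finsupp.single j 1, ?_⟩
      rw [coverLinearCombination, Finsupp.linearCombination_single, one_smul]
      refine Eq.trans ?_ (IdealSum.arrow_smul_of k (N.coverObj i) ⟨q', j⟩ _ _).symm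
      exact congrArg (IdealSum.of k (N.coverObj i) ⟨q', j⟩)
        ((Category.comp_id _).trans ((fromSkeleton C).map_id q')).symm
    · have h : arrow k (𝟙 ((fromSkeleton C).obj q)) • IdealSum.of k (N.coverObj i) b f = 0 :=
        IdealSum.arrow_smul_of_of_ne k (N.coverObj i) b f _ hY
      exact h.symm ▸ zero_mem _
  · have h : (N.cover i).proj i (IdealSum.of k (N.coverObj i) b f) = 0 :=
      (N.cover i).proj_of_mem_ne hf (by omega)
    rw [h, smul_zero]
    exact zero_mem _

/-- In degree `i` the generators at `q` are mapped to a basis, so the cover is injective there. This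
minimality makes the kernel start in degree `i + 1`. -/
theorem eq_zero_of_coverHom_eq_zero [l.skeleton.IsSkeletal] (q : Skeleton C)
    (v : (N.cover i).rep.obj ⟨q, i⟩) (hv : (N.coverHom i).toLinear v.1 = 0) : v = 0 := by
  obtain ⟨c, hc⟩ := N.repProj_mem_range i q v.1
  rw [repProj_self] at hc
  rw [← hc, coverHom_coverLinearCombination] at hv
  have h0 : Finsupp.linearCombination k (Module.Basis.ofVectorSpace k (N.rep.obj ⟨q, i⟩)) c = 0 :=
    Subtype.ext hv
  have h1 := linearIndependent_iff.1 (Module.Basis.linearIndependent _) c h0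
  refine Subtype.ext ?_
  rw [← hc, h1, map_zero]
  rfl

variable {N i} [l.skeleton.IsSkeletal]

/-- Graded Nakayama, by induction on the degree: below `i` the module is zero, in degree `i` the
generators map to a basis, and above it `Vanishes 0` says that everything comes from smaller
degrees. -/
theorem IsLinear.rep_mem_range (h : N.IsLinear i) : ∀ (m : ℕ) (y : GradedObj l.skeleton)
    (_ : y.deg < i + m) (v : N.rep.obj y), v.1 ∈ LinearMap.range (N.coverHom i).toLinear := by
  intro m
  induction m with
  | zero =>
    intro y hy v
    rw [h.eq_zero y (by simpa using hy) v]
    exact zero_mem _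
  | succ m ih =>
    rintro ⟨q, n⟩ hy v
    by_cases hn : n = i
    · subst hn
      refine ⟨N.coverLinearCombination n q ((Module.Basis.ofVectorSpace k _).repr v), ?_⟩
      rw [coverHom_coverLinearCombination, Module.Basis.linearCombination_repr]
    · have h1 := CatRep.vanishes_zero_iff.1 (h.vanishes 0 ⟨q, n⟩ (by simpa using hn))
      have h2 : v ∈ Submodule.span k {m | ∃ (x : GradedObj l.skeleton) (f : x ⟶ ⟨q, n⟩)
        (_ : DegreeCategory.deg x < DegreeCategory.deg (⟨q, n⟩ : GradedObj l.skeleton))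
        (m' : N.rep.obj x), m = N.rep.map f m'} := by rw [h1]; trivial
      refine Submodule.span_le (p := ((LinearMap.range (N.coverHom i).toLinear).restrictScalars
        k).comap (Submodule.subtype _)).2 ?_ h2
      rintro _ ⟨x, f, hx, m', rfl⟩
      have hx' : x.deg < n := hx
      have hy' : n < i + (m + 1 : ℕ) := hy
      exact Submodule.smul_mem _ _ (ih x (by push_cast at hy'; omega) m')

theorem IsLinear.identity_smul_mem_range (h : N.IsLinear i) (X : C) (v : N.carrier) :
    arrow k (𝟙 X) • v ∈ LinearMap.range (N.coverHom i).toLinear := by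
  induction v using N.induction_homogeneous with
  | zero => rw [smul_zero]; exact zero_mem _
  | add v w hv hw => rw [smul_add]; exact add_mem hv hw
  | homogeneous n v hv =>
    have h1 := h.rep_mem_range (n - i + 1).toNat ⟨toSkeleton X, n⟩ (by
      change n < _; omega) (N.repMk X n v hv)
    have h2 := Submodule.smul_mem _ (arrow k (fromSkeletonToSkeletonIso X).hom) h1
    rwa [repMk_coe, arrow_smul_smul, Iso.inv_hom_id] at h2

/-- Every `v` is a finite sum of elements `arrow k (𝟙 X) • v`, so the statement at single objects
suffices. This is the purpose of `mem_unital`. -/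
theorem IsLinear.coverHom_surjective (h : N.IsLinear i) :
    Function.Surjective (N.coverHom i).toLinear := by
  intro v
  obtain ⟨S, hS⟩ := h.mem_unital v
  have h1 : ∑ X ∈ S, arrow k (𝟙 X) • v ∈ LinearMap.range (N.coverHom i).toLinear :=
    Submodule.sum_mem _ fun X _ => h.identity_smul_mem_range X v
  rwa [hS S subset_rfl] at h1

theorem vanishes_cover (j : ℕ) (y : GradedObj l.skeleton) (hy : j = 0 → y.deg ≠ i) :
    (N.cover i).rep.Vanishes j y := by
  cases j with
  | zero =>
    refine vanishes_zero_of_generated (N := N.cover i) (i := i)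
      (IdealSum.generated k l (N.coverObj i) i) (hy rfl)
  | succ j =>
    exact ((N.cover i).nonempty_inducedSection
      (IdealSum.projective k (N.coverObj i))).some.vanishes j y

theorem kernel_coverHom_eq_zero (y : GradedObj l.skeleton) (hy : y.deg < i + 1)
    (v : (N.coverHom i).kernel.rep.obj y) : v = 0 := by
  obtain ⟨q, n⟩ := y
  have hy' : n < i + 1 := hy
  refine (N.coverHom i).kernelι.rep_injective (N.coverHom i).kernelι_injective _ ?_
  rw [map_zero]
  by_cases hn : n = i
  · subst hn
    exact N.eq_zero_of_coverHom_eq_zero n q _ v.1.2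
  · refine N.cover_eq_zero i _ ?_ _
    change n < i
    omega

/-- Dimension shifting along the cover lowers the cohomological degree by one and keeps the object,
so the diagonal moves from `i` to `i + 1`. -/
theorem IsLinear.kernel (h : N.IsLinear i) : (N.coverHom i).kernel.IsLinear (i + 1) where
  eq_zero := kernel_coverHom_eq_zero
  mem_unital := (N.coverHom i).mem_unital_kernel (N.mem_unital_cover i)
  vanishes j y hy := by
    -- The only place where the cover may have cohomology; there the kernel is zero, by minimality
    -- of the cover.
    by_cases hj : j = 0 ∧ y.deg = i
    · obtain ⟨rfl, hj⟩ := hj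
      rw [CatRep.vanishes_zero_iff, eq_top_iff]
      intro m _
      rw [kernel_coverHom_eq_zero y (by omega) m]
      exact zero_mem _
    · exact CatRep.Vanishes.kernel (N.coverHom i).kernelι.rep (N.coverHom i).rep
        ((N.coverHom i).kernelι.rep_injective (N.coverHom i).kernelι_injective)
        ((N.coverHom i).rep_surjective h.coverHom_surjective)
        ((N.coverHom i).kernelι.rep_exact (N.coverHom i) (N.coverHom i).exact_kernelι)
        (h.vanishes (j + 1) y (by push_cast; omega))
        (vanishes_cover j y fun h0 h1 => hj ⟨h0, h1⟩)

end GradedCatModule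

end LinearModules

/-! ### Semisimplicity of `A₀` and construction of the linear resolution. -/

section LinearResolution

open CategoryAlgebra

variable {C : Type u} [Category.{v} C] {l : CategoryGrading C} {k : Type w} [Field k]

namespace DegreeZero

/-- A morphism of length zero as an element of `A₀`. -/
noncomputable def of {X Y : C} (f : X ⟶ Y) (h : l.len f = 0) : DegreeZero k (gradedPiece k l) :=
  (⟨basis k (Arrow.mk f), h ▸ basis_mem k l (Arrow.mk f)⟩ : gradedPiece k l 0)

theorem of_ne_zero {X Y : C} (f : X ⟶ Y) (h : l.len f = 0) : of (k := k) f h ≠ 0 := fun h0 =>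
  one_ne_zero (Finsupp.single_eq_zero.1
    (congrArg (Subtype.val (p := (· ∈ gradedPiece k l 0))) h0))

theorem arrow_smul_of {X Y Z : C} (f : X ⟶ Y) (g : Y ⟶ Z) (hf : l.len f = 0) (hg : l.len g = 0) :
    arrow k g • of (k := k) f hf = of (f ≫ g) (by rw [l.len_comp, hf, hg]) := by
  refine Subtype.ext ?_
  refine (arrow_smul_of_len_zero l k g hg _).trans ?_
  change basis k (Arrow.mk g) * basis k (Arrow.mk f) = basis k (Arrow.mk (f ≫ g))
  rw [basis_mul_basis, basisMul_of_comp]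

theorem mem_of_forall_of_mem (S : Submodule k (DegreeZero k (gradedPiece k l)))
    (hS : ∀ (X Y : C) (f : X ⟶ Y) (h : l.len f = 0), of f h ∈ S)
    (x : DegreeZero k (gradedPiece k l)) : x ∈ S := by
  suffices key : ∀ (a : CategoryAlgebra k C) (ha : a ∈ gradedPiece k l 0),
      ((⟨a, ha⟩ : gradedPiece k l 0) : DegreeZero k (gradedPiece k l)) ∈ S from
    key _ (Subtype.prop (p := (· ∈ gradedPiece k l 0)) x)
  intro a ha
  induction ha using Submodule.span_induction with
  | zero => exact zero_mem S
  | add x y hx hy hx' hy' => exact add_mem hx' hy'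
  | smul c x hx hx' => exact S.smul_mem c hx'
  | mem x hx =>
    obtain ⟨α, hα, rfl⟩ := hx
    exact hS _ _ α.hom hα

end DegreeZero

namespace degreeZeroModule

theorem mem_unital (v : (degreeZeroModule l k).carrier) : v ∈ (degreeZeroModule l k).unital := by
  refine DegreeZero.mem_of_forall_of_mem (degreeZeroModule l k).unital (fun X Y f h => ?_) v
  have h1 := DegreeZero.arrow_smul_of (k := k) f (𝟙 Y) h (l.len_id Y)
  simp only [Category.comp_id] at h1
  rw [← h1]
  exact (degreeZeroModule l k).arrow_smul_mem_unital (𝟙 Y) _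

theorem isLinear [l.skeleton.IsSkeletal] (H : ∀ (x y : GradedObj l.skeleton) (i : ℕ), x.deg = 0 →
    y.deg ≠ i → CatRep.ChainExact k i x y) : (degreeZeroModule l k).IsLinear 0 where
  eq_zero y hy v := Subtype.ext (eq_zero_of_mem_piece l k hy.ne v.2.1)
  mem_unital := mem_unital
  vanishes j y hy := CatRep.vanishes_of_chainExact (fun f h => rep_map_eq_zero l k f h)
    fun x hx => H x y j (deg_eq_zero l k hx) (by simpa using hy)

end degreeZeroModule

section Semisimple

variable (hl : l.IsIndiscretelyBased)

namespace DegreeZero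

variable (l k) in
/-- The submodule of `A₀` generated by the identity of an object. -/
noncomputable def simple (X : C) : Submodule (Unitization k (CategoryAlgebra k C))
    (DegreeZero k (gradedPiece k l)) :=
  Submodule.span _ {of (𝟙 X) (l.len_id X)}

variable (l k) in
/-- The span of the morphisms of length zero between two objects. -/
noncomputable def homSpan (X Y : C) : Submodule k (DegreeZero k (gradedPiece k l)) :=
  Submodule.span k {x | ∃ (f : X ⟶ Y) (h : l.len f = 0), x = of f h}

theorem arrow_smul_mem_homSpan {X Y Z W : C} (g : Z ⟶ W) {x : DegreeZero k (gradedPiece k l)}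
    (hx : x ∈ homSpan l k X Y) :
    arrow k g • x ∈ homSpan l k X W := by
  have hsc := IsScalarTower.to_smulCommClass' (R := k) (A := Unitization k (CategoryAlgebra k C))
    (M := DegreeZero k (gradedPiece k l))
  by_cases hg : l.len g = 0
  · induction hx using Submodule.span_induction with
    | zero => rw [smul_zero]; exact zero_mem _
    | add x y _ _ hx hy => rw [smul_add]; exact add_mem hx hy
    | smul c x _ hx => rw [smul_comm]; exact Submodule.smul_mem _ c hx
    | mem x hx =>
      obtain ⟨f, hf, rfl⟩ := hx
      by_cases h : Y = Z
      · subst h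
        rw [arrow_smul_of f g hf hg]
        exact Submodule.subset_span ⟨_, _, rfl⟩
      · have h0 : arrow k g • of (k := k) f hf = 0 := by
          have h1 := arrow_smul_of (k := k) f (𝟙 Y) hf (l.len_id Y)
          simp only [Category.comp_id] at h1
          rw [← h1, ← mul_smul, arrow_mul_of_ne k _ g h, zero_smul]
        rw [h0]
        exact zero_mem _
  · rw [arrow_smul_of_len_pos l k g (Nat.pos_of_ne_zero hg)]
    exact zero_mem _

theorem identity_smul_mem_homSpan {X : C} {x : DegreeZero k (gradedPiece k l)}
    (hx : x ∈ simple l k X) (Y : C) : arrow k (𝟙 Y) • x ∈ homSpan l k X Y := by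
  obtain ⟨r, rfl⟩ := Submodule.mem_span_singleton.1 hx
  clear hx
  have hsc := IsScalarTower.to_smulCommClass' (R := k) (A := Unitization k (CategoryAlgebra k C))
    (M := DegreeZero k (gradedPiece k l))
  have h0 : of (k := k) (𝟙 X) (l.len_id X) ∈ homSpan l k X X := Submodule.subset_span ⟨_, _, rfl⟩
  induction r using Unitization.ind with
  | inl_add_inr c a =>
    rw [add_smul, smul_add]
    refine add_mem ?_ ?_
    · rw [← Unitization.algebraMap_eq_inl, algebraMap_smul, smul_comm]
      exact Submodule.smul_mem _ c (arrow_smul_mem_homSpan _ h0)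
    · induction a using induction_basis k with
      | zero => rw [Unitization.inr_zero, zero_smul, smul_zero]; exact zero_mem _
      | add a b ha hb => rw [Unitization.inr_add, add_smul, smul_add]; exact add_mem ha hb
      | smul c Z W f =>
        rw [Unitization.inr_smul, smul_assoc, smul_comm]
        exact Submodule.smul_mem _ c (arrow_smul_mem_homSpan _ (arrow_smul_mem_homSpan f h0))

-- Between two objects there is at most one morphism of length zero, so a nonzero component of `x`
-- at some `Y` is a scalar times an isomorphism `f : X ⟶ Y`. Dividing by the scalar and multiplying
-- by `inv f` gives the identity of `X`.
include hl in
theorem of_mem_of_ne_zero {X : C} {x : DegreeZero k (gradedPiece k l)}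
    (hx : x ∈ simple l k X) (h0 : x ≠ 0) (N : Submodule (Unitization k (CategoryAlgebra k C))
      (DegreeZero k (gradedPiece k l))) (hN : x ∈ N) : of (𝟙 X) (l.len_id X) ∈ N := by
  have hsc := IsScalarTower.to_smulCommClass' (R := k) (A := Unitization k (CategoryAlgebra k C))
    (M := DegreeZero k (gradedPiece k l))
  -- `x` is the sum of its components at finitely many objects, so one of them is nonzero.
  obtain ⟨Y, hY⟩ : ∃ Y : C, arrow k (𝟙 Y) • x ≠ 0 := by
    by_contra! H
    obtain ⟨S, hS⟩ := degreeZeroModule.mem_unital (l := l) (k := k) x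
    refine h0 ((hS S subset_rfl).symm.trans (Finset.sum_eq_zero fun Y _ => H Y))
  have hmem := identity_smul_mem_homSpan hx Y
  obtain ⟨f, hf⟩ : ∃ f : X ⟶ Y, l.len f = 0 := by
    by_contra! H
    refine hY ((Submodule.mem_bot k).1 (Submodule.span_le.2 ?_ hmem))
    rintro _ ⟨f, hf, -⟩
    exact (H f hf).elim
  have hspan : homSpan l k X Y ≤ Submodule.span k {of f hf} := by
    refine Submodule.span_le.2 ?_
    rintro _ ⟨g, hg, rfl⟩
    obtain rfl := (hl X Y (.rel _ _ ⟨f, hf⟩)).unique hg hf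
    exact Submodule.mem_span_singleton_self _
  obtain ⟨c, hc⟩ := Submodule.mem_span_singleton.1 (hspan hmem)
  have hc0 : c ≠ 0 := by
    rintro rfl
    rw [zero_smul] at hc
    exact hY hc.symm
  have := hl.isIso f hf
  have h1 : c⁻¹ • arrow k (inv f) • arrow k (𝟙 Y) • x = of (𝟙 X) (l.len_id X) := by
    rw [← hc, smul_comm _ c, inv_smul_smul₀ hc0, arrow_smul_of f _ hf (l.len_eq_zero_of_isIso _)]
    simp only [IsIso.hom_inv_id]
  rw [← h1]
  exact N.smul_of_tower_mem _ (N.smul_mem _ (N.smul_mem _ hN))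

include hl in
theorem isSimpleModule_simple (X : C) :
    IsSimpleModule (Unitization k (CategoryAlgebra k C)) (simple l k X) := by
  rw [isSimpleModule_iff_isAtom]
  refine ⟨?_, fun N hN => ?_⟩
  · rw [Ne, simple, Submodule.span_singleton_eq_bot]
    exact of_ne_zero _ _
  · by_contra h0
    obtain ⟨x, hx, hx0⟩ := N.ne_bot_iff.1 h0
    refine hN.not_ge ?_
    rw [simple, Submodule.span_singleton_le_iff_mem]
    exact of_mem_of_ne_zero hl (hN.le hx) hx0 N hx

-- A morphism `f : X ⟶ Y` of length zero is `f` times the identity of `X`, so the simple submodules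
-- generated by the identities span `A₀`.
include hl in
theorem isSemisimpleModule : IsSemisimpleModule (Unitization k (CategoryAlgebra k C))
    (DegreeZero k (gradedPiece k l)) := by
  refine IsSemisimpleModule.of_sSup_simples_eq_top (eq_top_iff.2 fun x _ => ?_)
  refine mem_of_forall_of_mem ((sSup {m : Submodule (Unitization k (CategoryAlgebra k C))
    (DegreeZero k (gradedPiece k l)) | IsSimpleModule (Unitization k (CategoryAlgebra k C)) m
    }).restrictScalars k) (fun X Y f h => ?_) x
  have h1 : of (k := k) (𝟙 X) (l.len_id X) ∈ sSup {m : Submodule (Unitization k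
      (CategoryAlgebra k C)) (DegreeZero k (gradedPiece k l)) |
      IsSimpleModule (Unitization k (CategoryAlgebra k C)) m} :=
    (le_sSup (isSimpleModule_simple hl X) : simple l k X ≤ _) (Submodule.mem_span_singleton_self _)
  have h2 := arrow_smul_of (k := k) (𝟙 X) f (l.len_id X) h
  simp only [Category.id_comp] at h2
  rw [← h2]
  exact Submodule.smul_mem _ _ h1

end DegreeZero

end Semisimple

section Resolution

variable (l k)

/-- The syzygies of `A₀`. -/
noncomputable def syzygy : ℕ → GradedCatModule.{u, v, w, max u v w} l k
  | 0 => degreeZeroModule l k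
  | i + 1 => ((syzygy i).coverHom i).kernel

variable {l k}

theorem smul_mem_of_mem_gradedPiece (N : GradedCatModule.{u, v, w, u'} l k) (m : ℕ) (n : ℤ)
    (a : CategoryAlgebra k C) (x : N.carrier) (ha : a ∈ gradedPiece k l m) (hx : x ∈ N.piece n) :
    (a : Unitization k (CategoryAlgebra k C)) • x ∈ N.piece (m + n) := by
  induction ha using Submodule.span_induction with
  | zero => rw [Unitization.inr_zero, zero_smul]; exact zero_mem _
  | add a b _ _ ha hb => rw [Unitization.inr_add, add_smul]; exact add_mem ha hb
  | smul c a _ ha => rw [Unitization.inr_smul, smul_assoc]; exact Submodule.smul_mem _ c ha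
  | mem a ha =>
    obtain ⟨α, rfl, rfl⟩ := ha
    rw [add_comm]
    exact N.arrow_smul_mem α.hom n x hx

variable [l.skeleton.IsSkeletal] (H : ∀ (x y : GradedObj l.skeleton) (i : ℕ), x.deg = 0 →
    y.deg ≠ i → CatRep.ChainExact k i x y)

include H

/-- Each step uses `IsLinear.kernel`. With it, all covers are surjective, which makes the spliced
sequence exact, and the `i`-th cover is generated in degree `i`. -/
theorem isLinear_syzygy : ∀ i : ℕ, (syzygy l k i).IsLinear i
  | 0 => degreeZeroModule.isLinear H
  | i + 1 => by
    have h := (isLinear_syzygy i).kernel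
    rw [← Nat.cast_succ] at h
    exact h

/-- The linear resolution of `A₀` obtained by iterated projective covers. -/
noncomputable def linearProjectiveResolution :
    LinearProjectiveResolution k (gradedPiece k l) where
  P i := ((syzygy l k i).cover i).carrier
  addCommGroup i := ((syzygy l k i).cover i).addCommGroup
  moduleBase i := ((syzygy l k i).cover i).moduleBase
  module i := ((syzygy l k i).cover i).module
  isScalarTower i := ((syzygy l k i).cover i).isScalarTower
  piece i := ((syzygy l k i).cover i).piece
  isInternal i := ((syzygy l k i).cover i).isInternal
  smul_mem i m n a x ha hx := smul_mem_of_mem_gradedPiece _ m n a x ha hx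
  projective i := IdealSum.projective k _
  d i := ((syzygy l k i).coverHom i).kernelι.toLinear ∘ₗ
    ((syzygy l k (i + 1)).coverHom (i + 1 : ℕ)).toLinear
  d_mem i n x hx := ((syzygy l k (i + 1)).coverHom (i + 1 : ℕ)).map_mem hx
  ε := ((syzygy l k 0).coverHom 0).toLinear
  ε_eq_zero n x hx hn := degreeZeroModule.eq_zero_of_mem_piece l k hn
    (((syzygy l k 0).coverHom 0).map_mem hx)
  ε_surjective := (isLinear_syzygy H 0).coverHom_surjective
  exact_zero x := by
    refine (((syzygy l k 0).coverHom 0).exact_kernelι x).trans ?_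
    constructor
    · rintro ⟨y, rfl⟩
      obtain ⟨z, rfl⟩ := (isLinear_syzygy H 1).coverHom_surjective y
      exact ⟨z, rfl⟩
    · rintro ⟨z, rfl⟩
      exact ⟨_, rfl⟩
  exact_succ i x := by
    refine (map_eq_zero_iff _ ((syzygy l k i).coverHom i).kernelι_injective).trans ?_
    refine (((syzygy l k (i + 1)).coverHom (i + 1 : ℕ)).exact_kernelι x).trans ?_
    constructor
    · rintro ⟨y, rfl⟩
      obtain ⟨z, rfl⟩ := (isLinear_syzygy H (i + 2)).coverHom_surjective y
      exact ⟨z, rfl⟩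
    · rintro ⟨z, rfl⟩
      exact ⟨_, rfl⟩
  generated i := IdealSum.generated k l _ i

end Resolution

theorem CategoryGrading.HasDiagonalCohomology.isKoszul {hl : l.IsIndiscretelyBased}
    (h : CategoryGrading.HasDiagonalCohomology hl k) : l.IsKoszul k := by
  have := hl.isSkeletal_skeleton
  rw [← CategoryGrading.hasDiagonalCohomology_skeleton_iff hl
    (CategoryGrading.IsSkeletal.isIndiscretelyBased _),
    CategoryGrading.hasDiagonalCohomology_iff_chainExact] at h
  exact ⟨DegreeZero.isSemisimpleModule hl, ⟨linearProjectiveResolution h⟩⟩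

theorem CategoryGrading.isKoszul_iff_hasDiagonalCohomology (hl : l.IsIndiscretelyBased) :
    l.IsKoszul k ↔ CategoryGrading.HasDiagonalCohomology hl k :=
  ⟨fun h => h.hasDiagonalCohomology hl, fun h => h.isKoszul⟩

end LinearResolution

/-! ### The main theorem. -/

theorem mainTheorem3 {k : Type w} [Field k]
    {C : Type u} [Category.{v} C] {D : Type u'} [Category.{v'} D]
    (lC : CategoryGrading C) (lD : CategoryGrading D)
    (hC : lC.IsIndiscretelyBased) (hD : lD.IsIndiscretelyBased)
    (F : C ⥤ D) (hFl : ∀ ⦃X Y : C⦄ (f : X ⟶ Y), lD.len (F.map f) = lC.len f)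
    (hF : F.IsAlmostDiscreteFibration)
    (hlift : ∀ q : Arrow D, ∃ p : Arrow C, F.mapArrow.obj p = q) :
    -- if `C` is generated in degree one, then all four properties are equivalent
    (lC.IsGeneratedInDegreeOne →
      List.TFAE [lC.IsKoszul k, lD.IsKoszul k,
        CategoryGrading.IsLocallyBouquet hC k, CategoryGrading.IsLocallyBouquet hD k]) ∧
    -- the implications that hold for all gradings
    (lC.IsKoszul k ↔ lD.IsKoszul k) ∧
    (CategoryGrading.IsLocallyBouquet hC k ↔ CategoryGrading.IsLocallyBouquet hD k) ∧
    (lC.IsKoszul k → lC.IsGeneratedInDegreeOne ∧ CategoryGrading.IsLocallyBouquet hC k) ∧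
    -- `F` induces an isomorphism of semi-simplicial sets from `C(p)` to `D(F p)`
    (∀ ⦃X Y : C⦄ (p : X ⟶ Y),
      ∃ φ : ∀ n : ℕ, (factorizationComplex hC p).simplices n ≃
          (factorizationComplex hD (F.map p)).simplices n,
        (∀ (n : ℕ) (i : Fin (n + 2)) (x : (factorizationComplex hC p).simplices (n + 1)),
          φ n ((factorizationComplex hC p).face i x) =
            (factorizationComplex hD (F.map p)).face i (φ (n + 1) x)) ∧
        ∀ (n : ℕ) (f : NontrivialFactorization p n)
          (g : NontrivialFactorization (F.map p) n), f.LiesOver F g →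
          φ n (f.toSimplex hC) = g.toSimplex hD) := by
  have hK : lC.IsKoszul k ↔ lD.IsKoszul k := by
    rw [CategoryGrading.isKoszul_iff_hasDiagonalCohomology hC,
      CategoryGrading.isKoszul_iff_hasDiagonalCohomology hD]
    exact CategoryGrading.hasDiagonalCohomology_iff_of_fibration hC hD F hFl hF k hlift
  have hB := CategoryGrading.isLocallyBouquet_iff_of_fibration hC hD F hFl hF k hlift
  have hKB : lC.IsKoszul k → lC.IsGeneratedInDegreeOne ∧ CategoryGrading.IsLocallyBouquet hC k := by
    rw [CategoryGrading.isKoszul_iff_hasDiagonalCohomology hC]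
    exact fun h => ⟨h.isGeneratedInDegreeOne, h.isLocallyBouquet⟩
  refine ⟨fun h1 => ?_, hK, hB, hKB, fun X Y p => ⟨factorizationEquiv hC hD F hFl hF p,
    factorizationEquiv_face hC hD F hFl hF p, factorizationEquiv_toSimplex hC hD F hFl hF p⟩⟩
  tfae_have 1 ↔ 2 := hK
  tfae_have 3 ↔ 4 := hB
  tfae_have 1 → 3 := fun h => (hKB h).2
  -- Generation in degree one enters here: it makes the dimension of `C(p)` equal to `l(p) - 2` when
  -- `l(p) ≥ 2`, so that bouquet reaches up to the diagonal.
  tfae_have 3 → 1 := fun h => (h.hasDiagonalCohomology h1).isKoszul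
  tfae_finish
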